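/- Let $M$ be a smooth Riemannian manifold (without boundary), let $J\subset\mathbb R$ be an interval with more than one point, and let $c\colon J\to M$ be a unit speed geodesic. Put $E_t=\dot c(t)^\perp\subset T_{c(t)}M$, let $X'=\nabla_{\dot c}X$ denote the covariant derivative along $c$, and let $R=R(\cdot,\dot c)\dot c$. (At end points of $J$ belonging to $J$, derivatives, limits and smoothness are one-sided.) Fix $t_0\in J$. Let $A_t\colon E_{t_0}\to E_t$, $t\in J$, be a *Lagrange tensor*: a smooth family of linear maps with $A''+RA=0$ such that for every $w\ne 0$ the Jacobi field $t\mapsto A_tw$ is not identically zero, $A_t$ is invertible for at least one $t\in J$, and $S:=A'A^{-1}$ is symmetric at every *regular* point, i.e. at every $t$ at which $A_t$ is invertible. Let $v\in E_{t_0}$, $v\neq 0$. At regular points put $$Z_t=(A_t^*)^{-1}v,\qquad g_v(t)=\frac{|v|^2}{|Z_t|}.$$ Then the singular (i.e. non-regular) points are isolated in $J$; at a singular point let $g_v$ denote the limit of its values at regular points, which exists by (b). The following hold. (a) $g_v(t)\le |A_tv|$ for all $t\in J$, and at regular points, with $g=g_v$, $$\frac{g''}{g}=-\sec(\dot c,Z)-3\,\frac{|SZ|^2}{|Z|^2}\,\sin^2\angle(SZ,Z).$$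 (b) $g_v$ is continuous on $J$. For $t^*\in J$, $g_v(t^*)>0$ if and only if $v\perp\ker A_{t^*}$, and $g_v$ is smooth and positive at $t^*$ if and only if $v\perp\ker A_{t^*}$; if $t^*$ is an interior point of $J$, then $g_v$ is smooth at $t^*$ if and only if $v\perp\ker A_{t^*}$. (c) If all planes containing some $\dot c(t)$, $t\in J$, have sectional curvature $\ge 0$ (in particular, if $\sec_M\ge 0$), then $g_v$ is concave on every interval $K\subset J$ on which it is positive; if all these sectional curvatures are $>0$ (in particular, if $\sec_M>0$), then $g_v$ is strictly concave on every such $K$. If all these sectional curvatures are $\ge0$ and $g_v$ is constant on $J$, then $Z$ extends from the regular points to a smooth vector field along $c$ on $J$ that is a parallel Jacobi field, and if moreover $A_{t_0}=\mathrm{Id}$, then this field is $A_tv$ for all $t\in J$. -/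

import Mathlib

open Bundle Set Filter
open scoped Manifold ContDiff Topology

noncomputable section

namespace VirtualJacobi

/-! ### Levi-Civita connection and curvature, in the charts of a Riemannian manifold

`M` is a manifold without boundary modelled on the finite-dimensional space `E`, with a Riemannian
metric on its tangent bundle. The chart `extChartAt 𝓘(ℝ, E) x₀` and the trivialization
`trivializationAt E (TangentSpace 𝓘(ℝ, E)) x₀` of the tangent bundle that it induces give
coordinates for the points near `x₀` and for the tangent vectors at these points. -/

section Geometry

variable {E : Type*} [NormedAddCommGroup E] [NormedSpace ℝ E]
  {M : Type*} [TopologicalSpace M] [ChartedSpace E M] [IsManifold 𝓘(ℝ, E) ∞ M]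

/-- The coordinates, in the chart at `x₀`, of a tangent vector `v` at `p`. -/
def toCoord (x₀ p : M) (v : TangentSpace 𝓘(ℝ, E) p) : E :=
  (trivializationAt E (TangentSpace 𝓘(ℝ, E) : M → Type _) x₀).continuousLinearMapAt ℝ p v

/-- The tangent vector at `p` with given coordinates in the chart at `x₀`. -/
def ofCoord (x₀ p : M) (a : E) : TangentSpace 𝓘(ℝ, E) p :=
  (trivializationAt E (TangentSpace 𝓘(ℝ, E) : M → Type _) x₀).symmL ℝ p a

/-- The velocity `ċ(t)` of a curve `c` defined on the interval `J` (one-sided at end points). -/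
def velocity (c : ℝ → M) (J : Set ℝ) (t : ℝ) : TangentSpace 𝓘(ℝ, E) (c t) :=
  mfderivWithin 𝓘(ℝ, ℝ) 𝓘(ℝ, E) c J t (1 : ℝ)

variable [RiemannianBundle (fun x : M ↦ TangentSpace 𝓘(ℝ, E) x)]

/-- The metric in the chart at `x₀`: the bilinear form `g_{ij}(y)` at the point with
coordinates `y`. -/
def chartMetric (x₀ : M) (y : E) : E →L[ℝ] E →L[ℝ] ℝ :=
  (innerSL ℝ (E := TangentSpace 𝓘(ℝ, E) ((extChartAt 𝓘(ℝ, E) x₀).symm y))).bilinearComp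
    ((trivializationAt E (TangentSpace 𝓘(ℝ, E) : M → Type _) x₀).symmL ℝ
      ((extChartAt 𝓘(ℝ, E) x₀).symm y))
    ((trivializationAt E (TangentSpace 𝓘(ℝ, E) : M → Type _) x₀).symmL ℝ
      ((extChartAt 𝓘(ℝ, E) x₀).symm y))

/-- The Christoffel symbols of the first kind:
`z ↦ ½ (∂_a g(b, z) + ∂_b g(a, z) - ∂_z g(a, b))`. -/
def christoffelFirst (x₀ : M) (y a b : E) : E →L[ℝ] ℝ :=
  (1 / 2 : ℝ) • (fderiv ℝ (chartMetric x₀) y a b + fderiv ℝ (chartMetric x₀) y b a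
    - ((fderiv ℝ (chartMetric x₀) y).flip a).flip b)

/-- The Christoffel symbols `Γ_y(a, b)` of the Levi-Civita connection in the chart at `x₀`: the
vector with `g_y(Γ_y(a, b), z) = ½ (∂_a g(b, z) + ∂_b g(a, z) - ∂_z g(a, b))` for all `z`. -/
def christoffel (x₀ : M) (y a b : E) : E :=
  (chartMetric x₀ y).inverse (christoffelFirst x₀ y a b)

/-- The curvature `R(a, b) z = ∇_a ∇_b z - ∇_b ∇_a z` in the chart at `x₀`, for constant
coordinate vector fields `a`, `b`, `z`. -/
def chartCurvature (x₀ : M) (y a b z : E) : E :=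
  fderiv ℝ (fun y' ↦ christoffel x₀ y' b z) y a - fderiv ℝ (fun y' ↦ christoffel x₀ y' a z) y b
    + christoffel x₀ y a (christoffel x₀ y b z) - christoffel x₀ y b (christoffel x₀ y a z)

/-- The Riemann curvature tensor `R(u, v) w` of `M` at `p`, with the sign for which
`⟪R(u, v) v, u⟫` is positive on round spheres. -/
def curvature (p : M) (u v w : TangentSpace 𝓘(ℝ, E) p) : TangentSpace 𝓘(ℝ, E) p :=
  ofCoord p p (chartCurvature p (extChartAt 𝓘(ℝ, E) p p) (toCoord p p u) (toCoord p p v)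
    (toCoord p p w))

/-- The sectional curvature of the plane spanned by `u` and `v`. -/
def sec (p : M) (u v : TangentSpace 𝓘(ℝ, E) p) : ℝ :=
  inner ℝ (curvature p v u u) v / (‖u‖ ^ 2 * ‖v‖ ^ 2 - (inner ℝ u v) ^ 2)

/-- The covariant derivative `X' = ∇_ċ X` of a vector field `X` along the curve `c`, defined on the
interval `J`; in coordinates it is `X' = dX/dt + Γ(ċ, X)`, read in the chart at `c t`. -/
def covDeriv (c : ℝ → M) (J : Set ℝ) (X : ∀ t, TangentSpace 𝓘(ℝ, E) (c t)) (t : ℝ) :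
    TangentSpace 𝓘(ℝ, E) (c t) :=
  ofCoord (c t) (c t)
    (derivWithin (fun s ↦ toCoord (c t) (c s) (X s)) J t
      + christoffel (c t) (extChartAt 𝓘(ℝ, E) (c t) (c t))
          (derivWithin (fun s ↦ extChartAt 𝓘(ℝ, E) (c t) (c s)) J t)
          (toCoord (c t) (c t) (X t)))

/-- `c` is a (smooth) geodesic of unit speed on the interval `J`. -/
structure IsUnitGeodesicOn (c : ℝ → M) (J : Set ℝ) : Prop where
  smooth : ContMDiffOn 𝓘(ℝ, ℝ) 𝓘(ℝ, E) ∞ c J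
  geodesic : ∀ t ∈ J, covDeriv (E := E) c J (velocity c J) t = 0
  unit_speed : ∀ t ∈ J, ‖velocity (E := E) c J t‖ = 1

/-- `X` is a smooth vector field along `c` with `X'' + R(X, ċ) ċ = 0`. -/
structure IsJacobiField (c : ℝ → M) (J : Set ℝ) (X : ∀ t, TangentSpace 𝓘(ℝ, E) (c t)) : Prop where
  smooth : ContMDiffOn 𝓘(ℝ, ℝ) (𝓘(ℝ, E).tangent) ∞
    (fun t ↦ (⟨c t, X t⟩ : TangentBundle 𝓘(ℝ, E) M)) J
  jacobi : ∀ t ∈ J, covDeriv c J (covDeriv c J X) t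
    + curvature (c t) (X t) (velocity c J t) (velocity c J t) = 0

variable (E) in
/-- The space `E_t`: the orthogonal complement of `ċ(t)` in the tangent space at `c t`. -/
abbrev normalSpace (c : ℝ → M) (J : Set ℝ) (t : ℝ) : Submodule ℝ (TangentSpace 𝓘(ℝ, E) (c t)) :=
  (ℝ ∙ velocity c J t)ᗮ

end Geometry

instance tangentSpace_finiteDimensional {E : Type*} [NormedAddCommGroup E] [NormedSpace ℝ E]
    [FiniteDimensional ℝ E] {M : Type*} [TopologicalSpace M] [ChartedSpace E M] (p : M) :
    FiniteDimensional ℝ (TangentSpace 𝓘(ℝ, E) p) :=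
  inferInstanceAs (FiniteDimensional ℝ E)

/-! ### Lagrange tensors and virtual Jacobi fields -/

section Lagrange

variable {E : Type*} [NormedAddCommGroup E] [NormedSpace ℝ E] [FiniteDimensional ℝ E]
  {M : Type*} [TopologicalSpace M] [ChartedSpace E M] [IsManifold 𝓘(ℝ, E) ∞ M]
  [RiemannianBundle (fun x : M ↦ TangentSpace 𝓘(ℝ, E) x)]
  {c : ℝ → M} {J : Set ℝ} {t₀ : ℝ}

/-- The point `t` is regular for the family `A_t : E_{t₀} → E_t` if `A_t` is invertible. -/
def IsRegularPt (A : ∀ t, normalSpace E c J t₀ →ₗ[ℝ] normalSpace E c J t) (t : ℝ) : Prop :=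
  Function.Bijective (A t)

/-- The covariant derivative `A'_t w = (A_t w)'`. -/
def tensorDeriv (A : ∀ t, normalSpace E c J t₀ →ₗ[ℝ] normalSpace E c J t) (t : ℝ)
    (w : normalSpace E c J t₀) : TangentSpace 𝓘(ℝ, E) (c t) :=
  covDeriv c J (fun s ↦ (A s w : TangentSpace 𝓘(ℝ, E) (c s))) t

/-- The Riccati operator `S = A' A⁻¹` (meaningful at regular points). -/
def riccati (A : ∀ t, normalSpace E c J t₀ →ₗ[ℝ] normalSpace E c J t) (t : ℝ)
    (x : normalSpace E c J t) : TangentSpace 𝓘(ℝ, E) (c t) :=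
  tensorDeriv A t (Function.invFun (A t) x)

/-- `A` is a Lagrange tensor along the geodesic `c` on `J`: it solves `A'' + R A = 0`, it is
non-degenerate, and `S = A' A⁻¹` is defined somewhere and symmetric at all regular points. -/
structure IsLagrangeTensor (A : ∀ t, normalSpace E c J t₀ →ₗ[ℝ] normalSpace E c J t) : Prop where
  jacobi : ∀ w, IsJacobiField c J (fun t ↦ (A t w : TangentSpace 𝓘(ℝ, E) (c t)))
  nondegenerate : ∀ w, w ≠ 0 → ∃ t ∈ J, A t w ≠ 0
  /-- Without this the symmetry of `S` could hold vacuously, e.g. for `A_t (a, b) = (a + t b, 0)` in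
  Euclidean space. -/
  exists_regular : ∃ t ∈ J, IsRegularPt A t
  symmetric : ∀ t ∈ J, IsRegularPt A t → ∀ x y : normalSpace E c J t,
    inner ℝ (riccati A t x) (y : TangentSpace 𝓘(ℝ, E) (c t))
      = inner ℝ (x : TangentSpace 𝓘(ℝ, E) (c t)) (riccati A t y)

/-- The virtual Jacobi field `Z_t = (A_t^*)⁻¹ v` (meaningful at regular points). -/
def virtualField (A : ∀ t, normalSpace E c J t₀ →ₗ[ℝ] normalSpace E c J t)
    (v : normalSpace E c J t₀) (t : ℝ) : normalSpace E c J t :=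
  Function.invFun (LinearMap.adjoint (A t)) v

open scoped Classical in
/-- The function `g_v(t) = |v|² / |Z_t|` at regular points, and its limit along regular points at
the other points. -/
def virtualLength (A : ∀ t, normalSpace E c J t₀ →ₗ[ℝ] normalSpace E c J t)
    (v : normalSpace E c J t₀) (t : ℝ) : ℝ :=
  if IsRegularPt A t then ‖v‖ ^ 2 / ‖virtualField A v t‖
  else limUnder (𝓝[{s | s ∈ J ∧ IsRegularPt A s}] t) (fun s ↦ ‖v‖ ^ 2 / ‖virtualField A v s‖)

end Lagrange

end VirtualJacobi

end

open VirtualJacobi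

/-! The dual field `Z = (A^*)⁻¹ v` satisfies `Z' = -S Z`, so `A'' + R A = 0` and the symmetry of `S`
determine the first two derivatives of `g_v = |v|² / |Z|`.

Near a singular point `t` write `A_s = B_s ∘ D_s`, where `D_s` multiplies `ker A_t` by `s - t` and
is the identity on its orthogonal complement. Hadamard's lemma makes `B` smooth. Uniqueness for the
Jacobi equation makes `A'_t` injective on `ker A_t`, and by the symmetry of `S` the spaces
`A'_t (ker A_t)` and `A_t E_{t₀}` are orthogonal, so `B_t` is invertible. Thus singular points are
isolated. If `v ⟂ ker A_t`, then `(B_s^*)⁻¹ v` extends `Z` smoothly across `t`;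
otherwise `(s - t) Z` has a nonzero limit and `g_v` behaves like a multiple of `|s - t|`.

If `g_v` is constant and the curvatures are nonnegative, the formula for `g''` forces `Z' = 0` and
`⟨R Z, Z⟩ = 0`, hence `R Z = 0` because `R` is positive semidefinite. -/

section

set_option maxSynthPendingDepth 3

noncomputable section

namespace VirtualJacobi

section Calculus

variable {F : Type*} [NormedAddCommGroup F] [NormedSpace ℝ F] {J : Set ℝ} {t : ℝ}

theorem uniqueDiffOn_of_ordConnected (hJ : J.OrdConnected) (hJ' : J.Nontrivial) :
    UniqueDiffOn ℝ J := fun t ht ↦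
  uniqueDiffWithinAt_iff_accPt.2 (hJ.isPreconnected.preperfect_of_nontrivial hJ' t ht)

theorem exists_Ici_mem_nhdsWithin (hJ : J.OrdConnected) (ht : t ∈ J) {a : ℝ} (hat : a < t) :
    ∃ b ∈ J, a ≤ b ∧ b ≤ t ∧ Ici b ∈ 𝓝[J] t := by
  by_cases h : ∃ x ∈ J, x < t
  · obtain ⟨x, hx, hxt⟩ := h
    exact ⟨max x a, hJ.out hx ht ⟨le_max_left _ _, max_le hxt.le hat.le⟩, le_max_right _ _,
      max_le hxt.le hat.le, mem_nhdsWithin_of_mem_nhds (Ici_mem_nhds (max_lt hxt hat))⟩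
  · push Not at h
    exact ⟨t, ht, hat.le, le_rfl, mem_of_superset self_mem_nhdsWithin h⟩

theorem exists_Iic_mem_nhdsWithin (hJ : J.OrdConnected) (ht : t ∈ J) {a : ℝ} (hta : t < a) :
    ∃ b ∈ J, b ≤ a ∧ t ≤ b ∧ Iic b ∈ 𝓝[J] t := by
  by_cases h : ∃ x ∈ J, t < x
  · obtain ⟨x, hx, htx⟩ := h
    exact ⟨min x a, hJ.out ht hx ⟨le_min htx.le hta.le, min_le_left _ _⟩, min_le_right _ _,
      le_min htx.le hta.le, mem_nhdsWithin_of_mem_nhds (Iic_mem_nhds (lt_min htx hta))⟩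
  · push Not at h
    exact ⟨t, ht, hta.le, le_rfl, mem_of_superset self_mem_nhdsWithin h⟩

theorem exists_Icc_mem_nhdsWithin (hJ : J.OrdConnected) (hJ' : J.Nontrivial) (ht : t ∈ J)
    {u : Set ℝ} (hu : u ∈ 𝓝[J] t) :
    ∃ a b, a < b ∧ t ∈ Icc a b ∧ Icc a b ⊆ u ∧ Icc a b ⊆ J ∧ Icc a b ∈ 𝓝[J] t := by
  obtain ⟨ε, hε, hεu⟩ := Metric.mem_nhdsWithin_iff.1 hu
  obtain ⟨a, ha, hεa, hat, hna⟩ := exists_Ici_mem_nhdsWithin hJ ht (sub_lt_self t (half_pos hε))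
  obtain ⟨b, hb, hbε, htb, hnb⟩ :=
    exists_Iic_mem_nhdsWithin hJ ht (lt_add_of_pos_right t (half_pos hε))
  have hnhds : Icc a b ∈ 𝓝[J] t := inter_mem hna hnb
  refine ⟨a, b, (hat.trans htb).lt_of_ne ?_, ⟨hat, htb⟩, fun x hx ↦ hεu ⟨?_, hJ.out ha hb hx⟩,
    hJ.out ha hb, hnhds⟩
  · rintro rfl
    obtain rfl : a = t := hat.antisymm htb
    rw [Icc_self] at hnhds
    obtain ⟨y, ⟨hya, hyJ⟩, hy⟩ := ((accPt_iff_frequently.1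
      (hJ.isPreconnected.preperfect_of_nontrivial hJ' a ht)).and_eventually
      (mem_nhdsWithin_iff_eventually.1 hnhds)).exists
    exact hya (hy hyJ)
  · rw [Real.ball_eq_Ioo]
    constructor <;> linarith [hx.1, hx.2]

theorem eq_zero_of_norm_deriv_le_of_le {a b C : ℝ} {y y' : ℝ → F}
    (hy : ∀ s ∈ Icc a b, HasDerivWithinAt y (y' s) (Icc a b) s)
    (hC : ∀ s ∈ Icc a b, ‖y' s‖ ≤ C * ‖y s‖) (h0 : y a = 0) : ∀ s ∈ Icc a b, y s = 0 :=
  eq_zero_of_abs_deriv_le_mul_abs_self_of_eq_zero_right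
    (fun s hs ↦ (hy s hs).continuousWithinAt)
    (fun s hs ↦ ((hy s (Ico_subset_Icc_self hs)).mono
      (Icc_subset_Icc_left hs.1)).mono_of_mem_nhdsWithin (Icc_mem_nhdsGE hs.2))
    h0 (fun s hs ↦ hC s (Ico_subset_Icc_self hs))

theorem eq_zero_of_norm_deriv_le (hJ : J.OrdConnected) {C : ℝ} {y y' : ℝ → F}
    (hy : ∀ s ∈ J, HasDerivWithinAt y (y' s) J s) (hC : ∀ s ∈ J, ‖y' s‖ ≤ C * ‖y s‖)
    (ht : t ∈ J) (h0 : y t = 0) : ∀ s ∈ J, y s = 0 := by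
  intro s hs
  rcases le_total t s with h | h
  · have hsub : Icc t s ⊆ J := hJ.out ht hs
    exact eq_zero_of_norm_deriv_le_of_le (fun x hx ↦ (hy x (hsub hx)).mono hsub)
      (fun x hx ↦ hC x (hsub hx)) h0 s ⟨h, le_rfl⟩
  · have hsub : MapsTo Neg.neg (Icc (-t) (-s)) J := fun x hx ↦
      hJ.out hs ht ⟨le_neg_of_le_neg hx.2, neg_le_of_neg_le hx.1⟩
    have hy_neg : ∀ x ∈ Icc (-t) (-s),
        HasDerivWithinAt (fun x ↦ y (-x)) (-y' (-x)) (Icc (-t) (-s)) x := fun x hx ↦ by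
      simpa [Function.comp_def] using
        (hy (-x) (hsub hx)).scomp x (hasDerivAt_neg x).hasDerivWithinAt hsub
    simpa using eq_zero_of_norm_deriv_le_of_le hy_neg
      (fun x hx ↦ by simpa using hC (-x) (hsub hx)) (by simpa using h0) (-s)
      ⟨neg_le_neg h, le_rfl⟩

theorem eq_zero_of_eventuallyEq_const {y : ℝ → F} {y' a : F} (hJ : UniqueDiffWithinAt ℝ J t)
    (ht : t ∈ J) (hy : HasDerivWithinAt y y' J t) (hconst : y =ᶠ[𝓝[J] t] fun _ ↦ a) : y' = 0 :=
  hJ.eq_deriv _ hy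
    ((hasDerivWithinAt_const t J a).congr_of_eventuallyEq_of_mem hconst ht)

theorem exists_contDiff_eqOn_Icc [CompleteSpace F] {a b : ℝ} (hab : a < b) (n : ℕ) {f : ℝ → F}
    (hf : ContDiffOn ℝ n f (Icc a b)) : ∃ g : ℝ → F, ContDiff ℝ n g ∧ EqOn f g (Icc a b) := by
  induction n generalizing f with
  | zero =>
    refine ⟨IccExtend hab.le ((Icc a b).domRestrict f), ?_, fun x hx ↦ ?_⟩
    · rw [Nat.cast_zero, contDiff_zero]
      exact (continuousOn_iff_continuous_domRestrict.1 hf.continuousOn).Icc_extend'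
    · rw [IccExtend_of_mem _ _ hx, domRestrict_apply]
  | succ n ih =>
    rw [Nat.cast_succ, contDiffOn_succ_iff_derivWithin (uniqueDiffOn_Icc hab)] at hf
    obtain ⟨g, hg, hfg⟩ := ih hf.2.2
    have hd : ∀ x, HasDerivAt (fun x ↦ f a + ∫ y in a..x, g y) (g x) x := fun x ↦
      (hg.continuous.integral_hasStrictDerivAt a x).hasDerivAt.const_add _
    refine ⟨fun x ↦ f a + ∫ y in a..x, g y, ?_, fun x hx ↦ ?_⟩
    · rw [Nat.cast_succ, contDiff_succ_iff_deriv, funext fun x ↦ (hd x).deriv]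
      exact ⟨fun x ↦ (hd x).differentiableAt, by simp, hg⟩
    · have hderiv : ∀ y ∈ Ioo a x, HasDerivWithinAt f (g y) (Ioi y) y := fun y hy ↦ by
        have hyb := hy.2.trans_le hx.2
        rw [← hfg ⟨hy.1.le, hyb.le⟩]
        exact (hf.1 y ⟨hy.1.le, hyb.le⟩).hasDerivWithinAt.mono_of_mem_nhdsWithin
          (mem_of_superset (Icc_mem_nhdsGT hyb) (Icc_subset_Icc_left hy.1.le))
      simp [intervalIntegral.integral_eq_sub_of_hasDeriv_right_of_le hx.1
        (hf.1.continuousOn.mono (Icc_subset_Icc_right hx.2)) hderiv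
        (hg.continuous.intervalIntegrable _ _)]

theorem hasDerivAt_integral_pow_smul_comp (k : ℕ) (t : ℝ) {f : ℝ → F} (hf : ContDiff ℝ 1 f)
    (x : ℝ) :
    HasDerivAt (fun x ↦ ∫ s in (0 : ℝ)..1, s ^ k • f (t + s * (x - t)))
      (∫ s in (0 : ℝ)..1, s ^ (k + 1) • deriv f (t + s * (x - t))) x := by
  have : Continuous f := hf.continuous
  have : Continuous (deriv f) := hf.continuous_deriv le_rfl
  have hjoint : Continuous (fun p : ℝ × ℝ ↦ p.2 ^ (k + 1) • deriv f (t + p.2 * (p.1 - t))) := by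
    fun_prop
  obtain ⟨C, hC⟩ := ((isCompact_closedBall x 1).prod (isCompact_Icc (a := (0 : ℝ))
    (b := 1))).exists_bound_of_continuousOn hjoint.continuousOn
  have hpointwise : ∀ s y : ℝ, HasDerivAt (fun y ↦ s ^ k • f (t + s * (y - t)))
      (s ^ (k + 1) • deriv f (t + s * (y - t))) y := fun s y ↦ by
    have haffine : HasDerivAt (fun y ↦ t + s * (y - t)) s y := by
      simpa using (((hasDerivAt_id y).sub_const t).const_mul s).const_add t
    have hf' := (hf.differentiable one_ne_zero (t + s * (y - t))).hasDerivAt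
    simpa [pow_succ, mul_smul] using! (hf'.scomp y haffine).const_smul (s ^ k)
  refine (intervalIntegral.hasDerivAt_integral_of_dominated_loc_of_deriv_le (bound := fun _ ↦ C)
    (F' := fun x s ↦ s ^ (k + 1) • deriv f (t + s * (x - t)))
    (Metric.closedBall_mem_nhds x one_pos) (.of_forall fun y ↦ ?_) ?_ ?_
    (.of_forall fun s hs y hy ↦ hC (y, s) ⟨hy, ?_⟩) intervalIntegrable_const
    (.of_forall fun s _ y _ ↦ hpointwise s y)).2
  · exact Continuous.aestronglyMeasurable (by fun_prop)
  · exact Continuous.intervalIntegrable (by fun_prop) _ _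
  · exact Continuous.aestronglyMeasurable (by fun_prop)
  · rw [uIoc_of_le zero_le_one] at hs
    exact ⟨hs.1.le, hs.2⟩

theorem contDiff_integral_pow_smul_comp (n k : ℕ) (t : ℝ) {f : ℝ → F} (hf : ContDiff ℝ n f) :
    ContDiff ℝ n (fun x ↦ ∫ s in (0 : ℝ)..1, s ^ k • f (t + s * (x - t))) := by
  induction n generalizing k f with
  | zero =>
    rw [Nat.cast_zero, contDiff_zero] at hf ⊢
    refine intervalIntegral.continuous_parametric_intervalIntegral_of_continuous' ?_ _ _
    simp only [Function.uncurry_def]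
    fun_prop
  | succ n ih =>
    have hd := hasDerivAt_integral_pow_smul_comp k t
      (hf.of_le (by exact_mod_cast Nat.le_add_left 1 n))
    rw [Nat.cast_succ, contDiff_succ_iff_deriv] at hf ⊢
    rw [funext fun x ↦ (hd x).deriv]
    exact ⟨fun x ↦ (hd x).differentiableAt, by simp, ih (k + 1) hf.2.2⟩

theorem smul_integral_deriv_comp [CompleteSpace F] {g : ℝ → F} (hg : ContDiff ℝ 1 g) (t x : ℝ) :
    (x - t) • ∫ s in (0 : ℝ)..1, deriv g (t + s * (x - t)) = g x - g t := by
  simp only [mul_comm _ (x - t)]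
  rw [intervalIntegral.smul_integral_comp_add_mul,
    intervalIntegral.integral_deriv_eq_sub (fun y _ ↦ hg.differentiable one_ne_zero y)
      ((hg.continuous_deriv le_rfl).intervalIntegrable _ _)]
  simp

theorem contDiff_dslope [CompleteSpace F] {n : ℕ} {g : ℝ → F} (hg : ContDiff ℝ (n + 1) g) (t : ℝ) :
    ContDiff ℝ n (dslope g t) := by
  have hint := contDiff_integral_pow_smul_comp n 0 t (contDiff_succ_iff_deriv.1 hg).2.2
  simp only [pow_zero, one_smul] at hint
  convert hint using 1
  ext x
  rcases eq_or_ne x t with rfl | hxt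
  · simp
  · rw [dslope_of_ne _ hxt, slope_def_module, ← smul_integral_deriv_comp (hg.of_le (by simp)) t x,
      inv_smul_smul₀ (sub_ne_zero.2 hxt)]

/-- Hadamard's lemma at a point of an interval, which may be an end point. -/
theorem contDiffWithinAt_update_slope [CompleteSpace F] (hJ : J.OrdConnected) (hJ' : J.Nontrivial)
    (ht : t ∈ J) {f : ℝ → F} (hf : ContDiffWithinAt ℝ ∞ f J t) :
    ContDiffWithinAt ℝ ∞ (Function.update (slope f t) t (derivWithin f J t)) J t := by
  refine contDiffWithinAt_infty.2 fun n ↦ ?_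
  obtain ⟨u, hu, -, hfu⟩ := (hf.of_le (m := ((n + 1 : ℕ) : WithTop ℕ∞)) (by exact_mod_cast le_top)
    ).contDiffOn le_rfl (by simp)
  rw [insert_eq_of_mem ht] at hu
  obtain ⟨a, b, hab, htab, habu, -, hnhds⟩ := exists_Icc_mem_nhdsWithin hJ hJ' ht hu
  obtain ⟨g, hg, hfg⟩ := exists_contDiff_eqOn_Icc hab (n + 1) (hfu.mono habu)
  have hderiv : derivWithin f J t = deriv g t := by
    rw [(hfg.eventuallyEq_of_mem hnhds).derivWithin_eq (hfg htab),
      (hg.differentiable (by simp) t).derivWithin (uniqueDiffOn_of_ordConnected hJ hJ' t ht)]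
  refine (contDiff_dslope hg t).contDiffWithinAt.congr_of_eventuallyEq_of_mem ?_ ht
  filter_upwards [hnhds] with x hx
  rw [dslope, hderiv]
  rcases eq_or_ne x t with rfl | hxt
  · simp
  · simp [hxt, slope_def_module, hfg hx, hfg htab]

end Calculus

section LocalGeometry

variable {E F : Type*} [NormedAddCommGroup E] [NormedSpace ℝ E] [NormedAddCommGroup F]
  [NormedSpace ℝ F]

theorem fderiv_fderiv_comm {f : E → F} {y : E} (hf : ContDiffAt ℝ 2 f y) (a b : E) :
    fderiv ℝ (fderiv ℝ f) y a b = fderiv ℝ (fderiv ℝ f) y b a :=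
  (hf.isSymmSndFDerivAt (by simp)).eq a b

theorem fderiv_clm_apply₂_const {f : E → E →L[ℝ] E →L[ℝ] F} {y : E} (hf : DifferentiableAt ℝ f y)
    (a b z : E) : fderiv ℝ (fun x ↦ f x b z) y a = fderiv ℝ f y a b z := by
  have hd := (hf.hasFDerivAt.clm_apply (hasFDerivAt_const b y)).clm_apply (hasFDerivAt_const z y)
  simp [hd.fderiv]

theorem fderiv_clm_apply₃_const {f : E → E →L[ℝ] E →L[ℝ] E →L[ℝ] F} {y : E}
    (hf : DifferentiableAt ℝ f y) (a b z w : E) :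
    fderiv ℝ (fun x ↦ f x b z w) y a = fderiv ℝ f y a b z w := by
  have hd := ((hf.hasFDerivAt.clm_apply (hasFDerivAt_const b y)).clm_apply
    (hasFDerivAt_const z y)).clm_apply (hasFDerivAt_const w y)
  simp [hd.fderiv]

/-- The Christoffel symbols of the first kind of a metric `g` on `E`, as a trilinear map. -/
def lowerGamma (g : E → E →L[ℝ] E →L[ℝ] ℝ) (y : E) : E →L[ℝ] E →L[ℝ] E →L[ℝ] ℝ :=
  (1 / 2 : ℝ) • (fderiv ℝ g y + (fderiv ℝ g y).flip
    - (ContinuousLinearMap.flipₗᵢ ℝ E E ℝ).toLinearIsometry.toContinuousLinearMap ∘L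
      (fderiv ℝ g y).flip)

theorem lowerGamma_apply (g : E → E →L[ℝ] E →L[ℝ] ℝ) (y a b z : E) :
    lowerGamma g y a b z
      = (1 / 2) * (fderiv ℝ g y a b z + fderiv ℝ g y b a z - fderiv ℝ g y z a b) := by
  simp [lowerGamma]

/-- The Christoffel symbols of a metric `g` on `E`, as a bilinear map. -/
def gamma (g : E → E →L[ℝ] E →L[ℝ] ℝ) (y : E) : E →L[ℝ] E →L[ℝ] E :=
  ContinuousLinearMap.compL ℝ E (E →L[ℝ] ℝ) E (g y).inverse ∘L lowerGamma g y

theorem gamma_apply (g : E → E →L[ℝ] E →L[ℝ] ℝ) (y a b : E) :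
    gamma g y a b = (g y).inverse (lowerGamma g y a b) := rfl

/-- The curvature tensor of a metric `g` on `E`. -/
def curv (g : E → E →L[ℝ] E →L[ℝ] ℝ) (y a b z : E) : E :=
  fderiv ℝ (gamma g) y a b z - fderiv ℝ (gamma g) y b a z
    + gamma g y a (gamma g y b z) - gamma g y b (gamma g y a z)

theorem curv_add_left (g : E → E →L[ℝ] E →L[ℝ] ℝ) (y a a' b z : E) :
    curv g y (a + a') b z = curv g y a b z + curv g y a' b z := by
  simp only [curv, map_add, add_apply]
  abel

theorem curv_smul_left (g : E → E →L[ℝ] E →L[ℝ] ℝ) (y : E) (r : ℝ) (a b z : E) :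
    curv g y (r • a) b z = r • curv g y a b z := by
  simp only [curv, map_smul, smul_apply, smul_sub, smul_add]

/-- `g` is a smooth Riemannian metric on the open subset `U` of `E`. -/
structure IsMetricOn (g : E → E →L[ℝ] E →L[ℝ] ℝ) (U : Set E) : Prop where
  isOpen : IsOpen U
  smooth : ContDiffOn ℝ ∞ g U
  symm : ∀ y ∈ U, ∀ a b, g y a b = g y b a
  pos : ∀ y ∈ U, ∀ a, a ≠ 0 → 0 < g y a a

namespace IsMetricOn

variable {g : E → E →L[ℝ] E →L[ℝ] ℝ} {U : Set E} {y : E}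

theorem contDiffAt (h : IsMetricOn g U) (hy : y ∈ U) : ContDiffAt ℝ ∞ g y :=
  h.smooth.contDiffAt (h.isOpen.mem_nhds hy)

theorem differentiableAt (h : IsMetricOn g U) (hy : y ∈ U) : DifferentiableAt ℝ g y :=
  (h.contDiffAt hy).differentiableAt (by simp)

theorem differentiableAt_fderiv (h : IsMetricOn g U) (hy : y ∈ U) :
    DifferentiableAt ℝ (fderiv ℝ g) y :=
  ((h.contDiffAt hy).fderiv_right (m := ∞) (by simp)).differentiableAt (by simp)

theorem fderiv_symm (h : IsMetricOn g U) (hy : y ∈ U) (a b z : E) :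
    fderiv ℝ g y a b z = fderiv ℝ g y a z b := by
  have hsymm : (fun x ↦ g x b z) =ᶠ[𝓝 y] fun x ↦ g x z b := by
    filter_upwards [h.isOpen.mem_nhds hy] with x hx using h.symm x hx b z
  rw [← fderiv_clm_apply₂_const (h.differentiableAt hy), hsymm.fderiv_eq,
    fderiv_clm_apply₂_const (h.differentiableAt hy)]

protected theorem fderiv_fderiv_comm (h : IsMetricOn g U) (hy : y ∈ U) (a b : E) :
    fderiv ℝ (fderiv ℝ g) y a b = fderiv ℝ (fderiv ℝ g) y b a :=
  fderiv_fderiv_comm ((h.contDiffAt hy).of_le ENat.LEInfty.out) a b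

theorem fderiv_fderiv_symm (h : IsMetricOn g U) (hy : y ∈ U) (a b z w : E) :
    fderiv ℝ (fderiv ℝ g) y a b z w = fderiv ℝ (fderiv ℝ g) y a b w z := by
  have hsymm : (fun x ↦ fderiv ℝ g x b z w) =ᶠ[𝓝 y] fun x ↦ fderiv ℝ g x b w z := by
    filter_upwards [h.isOpen.mem_nhds hy] with x hx using h.fderiv_symm hx b z w
  rw [← fderiv_clm_apply₃_const (h.differentiableAt_fderiv hy), hsymm.fderiv_eq,
    fderiv_clm_apply₃_const (h.differentiableAt_fderiv hy)]

theorem contDiffAt_lowerGamma (h : IsMetricOn g U) (hy : y ∈ U) :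
    ContDiffAt ℝ ∞ (lowerGamma g) y := by
  have hd : ContDiffAt ℝ ∞ (fderiv ℝ g) y := (h.contDiffAt hy).fderiv_right (by simp)
  have hflip : ContDiffAt ℝ ∞ (fun y ↦ (fderiv ℝ g y).flip) y :=
    ((ContinuousLinearMap.flipₗᵢ ℝ E E (E →L[ℝ] ℝ)).toLinearIsometry.toContinuousLinearMap
      ).contDiff.contDiffAt.comp y hd
  exact ((hd.add hflip).sub (contDiffAt_const.clm_comp hflip)).const_smul (1 / 2 : ℝ)

theorem differentiableAt_lowerGamma (h : IsMetricOn g U) (hy : y ∈ U) :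
    DifferentiableAt ℝ (lowerGamma g) y :=
  (h.contDiffAt_lowerGamma hy).differentiableAt (by simp)

theorem fderiv_lowerGamma (h : IsMetricOn g U) (hy : y ∈ U) (a b z w : E) :
    fderiv ℝ (lowerGamma g) y a b z w
      = (1 / 2) * (fderiv ℝ (fderiv ℝ g) y a b z w + fderiv ℝ (fderiv ℝ g) y a z b w
        - fderiv ℝ (fderiv ℝ g) y a w b z) := by
  have hd := h.differentiableAt_fderiv hy
  have hdiff : ∀ b z w, DifferentiableAt ℝ (fun x ↦ fderiv ℝ g x b z w) y := fun b z w ↦ by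
    fun_prop
  rw [← fderiv_clm_apply₃_const (h.differentiableAt_lowerGamma hy)]
  simp only [lowerGamma_apply]
  rw [fderiv_const_mul (((hdiff b z w).fun_add (hdiff z b w)).fun_sub (hdiff w b z)),
    fderiv_fun_sub ((hdiff b z w).fun_add (hdiff z b w)) (hdiff w b z),
    fderiv_fun_add (hdiff b z w) (hdiff z b w)]
  simp only [smul_apply, sub_apply, add_apply, smul_eq_mul, fderiv_clm_apply₃_const hd]

variable [FiniteDimensional ℝ E]

theorem exists_equiv (h : IsMetricOn g U) (hy : y ∈ U) :
    ∃ e : E ≃L[ℝ] (E →L[ℝ] ℝ), (e : E →L[ℝ] (E →L[ℝ] ℝ)) = g y := by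
  have hinj : Function.Injective (g y : E →ₗ[ℝ] (E →L[ℝ] ℝ)) := by
    refine (injective_iff_map_eq_zero _).2 fun a ha ↦ by_contra fun hne ↦ ?_
    exact (h.pos y hy a hne).ne' congr($ha a)
  have hrank : Module.finrank ℝ E = Module.finrank ℝ (E →L[ℝ] ℝ) := by
    rw [← (LinearMap.toContinuousLinearMap (𝕜 := ℝ) (E := E) (F' := ℝ)).finrank_eq]
    exact (Subspace.dual_finrank_eq (K := ℝ) (V := E)).symm
  exact ⟨(LinearEquiv.ofBijective _ ⟨hinj,
    (LinearMap.injective_iff_surjective_of_finrank_eq_finrank hrank).1 hinj⟩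
    ).toContinuousLinearEquiv, rfl⟩

theorem apply_gamma (h : IsMetricOn g U) (hy : y ∈ U) (a b z : E) :
    g y (gamma g y a b) z = lowerGamma g y a b z := by
  obtain ⟨e, he⟩ := h.exists_equiv hy
  rw [gamma_apply, ← he, ContinuousLinearMap.inverse_equiv]
  simp

theorem eq_of_forall (h : IsMetricOn g U) (hy : y ∈ U) {a b : E} (hab : ∀ z, g y a z = g y b z) :
    a = b := by
  obtain ⟨e, he⟩ := h.exists_equiv hy
  refine e.injective (ContinuousLinearMap.ext fun z ↦ ?_)
  simpa only [← he] using! hab z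

theorem gamma_comm (h : IsMetricOn g U) (hy : y ∈ U) (a b : E) :
    gamma g y a b = gamma g y b a := by
  refine h.eq_of_forall hy fun z ↦ ?_
  rw [h.apply_gamma hy, h.apply_gamma hy, lowerGamma_apply, lowerGamma_apply,
    h.fderiv_symm hy z a b]
  ring

theorem fderiv_eq (h : IsMetricOn g U) (hy : y ∈ U) (a b z : E) :
    fderiv ℝ g y a b z = g y (gamma g y a b) z + g y b (gamma g y a z) := by
  rw [h.symm y hy b, h.apply_gamma hy, h.apply_gamma hy, lowerGamma_apply, lowerGamma_apply,
    h.fderiv_symm hy a z b, h.fderiv_symm hy b a z, h.fderiv_symm hy z a b]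
  ring

theorem contDiffAt_gamma (h : IsMetricOn g U) (hy : y ∈ U) : ContDiffAt ℝ ∞ (gamma g) y := by
  obtain ⟨e, he⟩ := h.exists_equiv hy
  have hinv : ContDiffAt ℝ ∞ (fun y ↦ (g y).inverse) y := by
    have hinv := contDiffAt_map_inverse (n := ∞) e
    rw [he] at hinv
    exact hinv.comp y (h.contDiffAt hy)
  exact ((ContinuousLinearMap.compL ℝ E (E →L[ℝ] ℝ) E).contDiff.contDiffAt.comp y hinv).clm_comp
    (h.contDiffAt_lowerGamma hy)

theorem differentiableAt_gamma (h : IsMetricOn g U) (hy : y ∈ U) :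
    DifferentiableAt ℝ (gamma g) y :=
  (h.contDiffAt_gamma hy).differentiableAt (by simp)

theorem apply_fderiv_gamma (h : IsMetricOn g U) (hy : y ∈ U) (a b z w : E) :
    g y (fderiv ℝ (gamma g) y a b z) w
      = fderiv ℝ (lowerGamma g) y a b z w - fderiv ℝ g y a (gamma g y b z) w := by
  have hΓ : HasFDerivAt (fun x ↦ g x (gamma g x b z) w) _ y :=
    ((h.differentiableAt hy).hasFDerivAt.clm_apply (((h.differentiableAt_gamma
      hy).hasFDerivAt.clm_apply (hasFDerivAt_const b y)).clm_apply
      (hasFDerivAt_const z y))).clm_apply (hasFDerivAt_const w y)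
  have hlower : (fun x ↦ g x (gamma g x b z) w) =ᶠ[𝓝 y] fun x ↦ lowerGamma g x b z w := by
    filter_upwards [h.isOpen.mem_nhds hy] with x hx using h.apply_gamma hx b z w
  rw [← fderiv_clm_apply₃_const (h.differentiableAt_lowerGamma hy), ← hlower.fderiv_eq, hΓ.fderiv]
  simp

theorem apply_curv (h : IsMetricOn g U) (hy : y ∈ U) (a b z w : E) :
    g y (curv g y a b z) w = fderiv ℝ (lowerGamma g) y a b z w - fderiv ℝ (lowerGamma g) y b a z w
      - g y (gamma g y a w) (gamma g y b z) + g y (gamma g y b w) (gamma g y a z) := by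
  simp only [curv, map_add, map_sub, add_apply, sub_apply]
  rw [h.apply_fderiv_gamma hy, h.apply_fderiv_gamma hy, h.fderiv_eq hy a, h.fderiv_eq hy b,
    h.symm y hy (gamma g y b z), h.symm y hy (gamma g y a z)]
  ring

theorem hasDerivWithinAt_apply (h : IsMetricOn g U) {J : Set ℝ} {t : ℝ} {x X Y : ℝ → E}
    (hx : x t ∈ U) (hxd : DifferentiableWithinAt ℝ x J t) (hX : DifferentiableWithinAt ℝ X J t)
    (hY : DifferentiableWithinAt ℝ Y J t) :
    HasDerivWithinAt (fun s ↦ g (x s) (X s) (Y s))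
      (g (x t) (derivWithin X J t + gamma g (x t) (derivWithin x J t) (X t)) (Y t)
        + g (x t) (X t) (derivWithin Y J t + gamma g (x t) (derivWithin x J t) (Y t))) J t := by
  have hd := (((h.differentiableAt hx).hasFDerivAt.comp_hasDerivWithinAt t
    hxd.hasDerivWithinAt).clm_apply hX.hasDerivWithinAt).clm_apply hY.hasDerivWithinAt
  refine HasDerivWithinAt.congr_deriv hd ?_
  simp only [Function.comp_apply, add_apply, map_add]
  rw [h.fderiv_eq hx]
  ring

theorem apply_curv_symm (h : IsMetricOn g U) (hy : y ∈ U) (a b w : E) :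
    g y (curv g y a b b) w = g y (curv g y w b b) a := by
  rw [h.apply_curv hy, h.apply_curv hy]
  simp only [h.fderiv_lowerGamma hy]
  rw [h.gamma_comm hy w a, h.gamma_comm hy w b, h.gamma_comm hy b a,
    h.symm y hy (gamma g y b w), h.fderiv_fderiv_comm hy w b,
    h.fderiv_fderiv_comm hy w a, h.fderiv_fderiv_comm hy b a, h.fderiv_fderiv_symm hy b b w a,
    h.fderiv_fderiv_symm hy b w a b, h.fderiv_fderiv_symm hy a b w b]
  ring

theorem apply_curv_self (h : IsMetricOn g U) (hy : y ∈ U) (a b : E) :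
    g y (curv g y a b b) b = 0 := by
  rw [h.apply_curv hy]
  simp only [h.fderiv_lowerGamma hy]
  rw [h.symm y hy (gamma g y b b), h.fderiv_fderiv_comm hy b a,
    h.fderiv_fderiv_symm hy b b a b]
  ring

end IsMetricOn

/-- `φ` is an isometry from `U` with the metric `g` to `V` with the metric `h`. -/
structure IsLocalIsometry (g h : E → E →L[ℝ] E →L[ℝ] ℝ) (U V : Set E) (φ : E → E) : Prop where
  source : IsMetricOn g U
  target : IsMetricOn h V
  mapsTo : MapsTo φ U V
  smooth : ContDiffOn ℝ ∞ φ U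
  pullback : ∀ y ∈ U, ∀ a b, g y a b = h (φ y) (fderiv ℝ φ y a) (fderiv ℝ φ y b)

namespace IsLocalIsometry

variable {g h : E → E →L[ℝ] E →L[ℝ] ℝ} {U V : Set E} {φ : E → E} {y : E}

theorem contDiffAt (H : IsLocalIsometry g h U V φ) (hy : y ∈ U) : ContDiffAt ℝ ∞ φ y :=
  H.smooth.contDiffAt (H.source.isOpen.mem_nhds hy)

theorem differentiableAt (H : IsLocalIsometry g h U V φ) (hy : y ∈ U) : DifferentiableAt ℝ φ y :=
  (H.contDiffAt hy).differentiableAt (by simp)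

theorem contDiffAt_fderiv (H : IsLocalIsometry g h U V φ) (hy : y ∈ U) :
    ContDiffAt ℝ ∞ (fderiv ℝ φ) y :=
  (H.contDiffAt hy).fderiv_right (by simp)

theorem differentiableAt_fderiv (H : IsLocalIsometry g h U V φ) (hy : y ∈ U) :
    DifferentiableAt ℝ (fderiv ℝ φ) y :=
  (H.contDiffAt_fderiv hy).differentiableAt (by simp)

theorem fderiv_surjective [FiniteDimensional ℝ E] (H : IsLocalIsometry g h U V φ) (hy : y ∈ U) :
    Function.Surjective (fderiv ℝ φ y) := by
  refine (LinearMap.injective_iff_surjective (f := (fderiv ℝ φ y : E →ₗ[ℝ] E))).1 ?_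
  refine (injective_iff_map_eq_zero _).2 fun a ha ↦ by_contra fun hne ↦
    (H.source.pos y hy a hne).ne' ?_
  rw [H.pullback y hy, show fderiv ℝ φ y a = 0 from ha, map_zero]

theorem fderiv_metric (H : IsLocalIsometry g h U V φ) (hy : y ∈ U) (z a b : E) :
    fderiv ℝ g y z a b = fderiv ℝ h (φ y) (fderiv ℝ φ y z) (fderiv ℝ φ y a) (fderiv ℝ φ y b)
      + h (φ y) (fderiv ℝ (fderiv ℝ φ) y z a) (fderiv ℝ φ y b)
      + h (φ y) (fderiv ℝ φ y a) (fderiv ℝ (fderiv ℝ φ) y z b) := by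
  have hφ' := (H.differentiableAt_fderiv hy).hasFDerivAt
  have hpullback : HasFDerivAt (fun x ↦ h (φ x) (fderiv ℝ φ x a) (fderiv ℝ φ x b)) _ y :=
    (((H.target.differentiableAt (H.mapsTo hy)).hasFDerivAt.comp y
      (H.differentiableAt hy).hasFDerivAt).clm_apply
      (hφ'.clm_apply (hasFDerivAt_const a y))).clm_apply (hφ'.clm_apply (hasFDerivAt_const b y))
  have heq : (fun x ↦ g x a b) =ᶠ[𝓝 y] fun x ↦ h (φ x) (fderiv ℝ φ x a) (fderiv ℝ φ x b) := by
    filter_upwards [H.source.isOpen.mem_nhds hy] with x hx using H.pullback x hx a b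
  rw [← fderiv_clm_apply₂_const (H.source.differentiableAt hy), heq.fderiv_eq, hpullback.fderiv]
  simp only [add_apply, ContinuousLinearMap.comp_apply, ContinuousLinearMap.flip_apply,
    ContinuousLinearMap.comp_zero, Function.comp_apply, zero_add]
  ring

protected theorem fderiv_fderiv_comm (H : IsLocalIsometry g h U V φ) (hy : y ∈ U) (a b : E) :
    fderiv ℝ (fderiv ℝ φ) y a b = fderiv ℝ (fderiv ℝ φ) y b a :=
  fderiv_fderiv_comm ((H.contDiffAt hy).of_le ENat.LEInfty.out) a b

theorem fderiv_gamma [FiniteDimensional ℝ E] (H : IsLocalIsometry g h U V φ) (hy : y ∈ U)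
    (a b : E) :
    fderiv ℝ φ y (gamma g y a b)
      = gamma h (φ y) (fderiv ℝ φ y a) (fderiv ℝ φ y b) + fderiv ℝ (fderiv ℝ φ) y a b := by
  refine H.target.eq_of_forall (H.mapsTo hy) fun z' ↦ ?_
  obtain ⟨z, rfl⟩ := H.fderiv_surjective hy z'
  rw [← H.pullback y hy, H.source.apply_gamma hy, map_add, add_apply,
    H.target.apply_gamma (H.mapsTo hy), lowerGamma_apply, lowerGamma_apply, H.fderiv_metric hy,
    H.fderiv_metric hy, H.fderiv_metric hy, H.fderiv_fderiv_comm hy z a,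
    H.fderiv_fderiv_comm hy z b, H.fderiv_fderiv_comm hy b a,
    H.target.symm _ (H.mapsTo hy) (fderiv ℝ φ y b), H.target.symm _ (H.mapsTo hy) (fderiv ℝ φ y a)]
  ring

theorem fderiv_apply_fderiv_gamma [FiniteDimensional ℝ E] (H : IsLocalIsometry g h U V φ)
    (hy : y ∈ U) (a b z : E) :
    fderiv ℝ φ y (fderiv ℝ (gamma g) y a b z)
      = fderiv ℝ (gamma h) (φ y) (fderiv ℝ φ y a) (fderiv ℝ φ y b) (fderiv ℝ φ y z)
        + gamma h (φ y) (fderiv ℝ (fderiv ℝ φ) y a b) (fderiv ℝ φ y z)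
        + gamma h (φ y) (fderiv ℝ φ y b) (fderiv ℝ (fderiv ℝ φ) y a z)
        + fderiv ℝ (fderiv ℝ (fderiv ℝ φ)) y a b z
        - fderiv ℝ (fderiv ℝ φ) y a (gamma g y b z) := by
  have hφ' := (H.differentiableAt_fderiv hy).hasFDerivAt
  have hφ'' : HasFDerivAt (fderiv ℝ (fderiv ℝ φ)) _ y :=
    (((H.contDiffAt_fderiv hy).fderiv_right (m := ∞) (by simp)).differentiableAt
      (by simp)).hasFDerivAt
  have hleft := hφ'.clm_apply (((H.source.differentiableAt_gamma hy).hasFDerivAt.clm_apply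
    (hasFDerivAt_const b y)).clm_apply (hasFDerivAt_const z y))
  have hright := ((((H.target.differentiableAt_gamma (H.mapsTo hy)).hasFDerivAt.comp y
    (H.differentiableAt hy).hasFDerivAt).clm_apply
    (hφ'.clm_apply (hasFDerivAt_const b y))).clm_apply
    (hφ'.clm_apply (hasFDerivAt_const z y))).add
    ((hφ''.clm_apply (hasFDerivAt_const b y)).clm_apply (hasFDerivAt_const z y))
  have heq : (fun x ↦ fderiv ℝ φ x (gamma g x b z)) =ᶠ[𝓝 y] fun x ↦
      gamma h (φ x) (fderiv ℝ φ x b) (fderiv ℝ φ x z) + fderiv ℝ (fderiv ℝ φ) x b z := by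
    filter_upwards [H.source.isOpen.mem_nhds hy] with x hx using H.fderiv_gamma hx b z
  have hderiv := congr($(hleft.unique (hright.congr_of_eventuallyEq heq)) a)
  simp only [add_apply, ContinuousLinearMap.comp_apply, ContinuousLinearMap.flip_apply,
    ContinuousLinearMap.comp_zero, Function.comp_apply, zero_add] at hderiv
  rw [eq_sub_iff_add_eq, hderiv]
  abel

theorem fderiv_curv [FiniteDimensional ℝ E] (H : IsLocalIsometry g h U V φ) (hy : y ∈ U)
    (a b z : E) :
    fderiv ℝ φ y (curv g y a b z)
      = curv h (φ y) (fderiv ℝ φ y a) (fderiv ℝ φ y b) (fderiv ℝ φ y z) := by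
  have hthird : fderiv ℝ (fderiv ℝ (fderiv ℝ φ)) y a b z
      = fderiv ℝ (fderiv ℝ (fderiv ℝ φ)) y b a z :=
    congr($(fderiv_fderiv_comm
      ((H.contDiffAt_fderiv hy).of_le ENat.LEInfty.out) a b) z)
  simp only [curv, map_add, map_sub]
  rw [H.fderiv_apply_fderiv_gamma hy a b, H.fderiv_apply_fderiv_gamma hy b a,
    H.fderiv_gamma hy a (gamma g y b z), H.fderiv_gamma hy b (gamma g y a z),
    H.fderiv_gamma hy b z, H.fderiv_gamma hy a z, hthird, H.fderiv_fderiv_comm hy a b]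
  simp only [map_add]
  abel

theorem fderiv_covariant [FiniteDimensional ℝ E] (H : IsLocalIsometry g h U V φ) {J : Set ℝ}
    {t : ℝ} (hJ : UniqueDiffWithinAt ℝ J t) {x X : ℝ → E} (hx : x t ∈ U)
    (hxd : DifferentiableWithinAt ℝ x J t) (hXd : DifferentiableWithinAt ℝ X J t) :
    derivWithin (fun s ↦ fderiv ℝ φ (x s) (X s)) J t + gamma h (φ (x t))
        (derivWithin (fun s ↦ φ (x s)) J t) (fderiv ℝ φ (x t) (X t))
      = fderiv ℝ φ (x t) (derivWithin X J t + gamma g (x t) (derivWithin x J t) (X t)) := by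
  have hφx := (H.differentiableAt hx).hasFDerivAt.comp_hasDerivWithinAt t hxd.hasDerivWithinAt
  have hφX := ((H.differentiableAt_fderiv hx).hasFDerivAt.comp_hasDerivWithinAt t
    hxd.hasDerivWithinAt).clm_apply hXd.hasDerivWithinAt
  rw [show derivWithin (fun s ↦ φ (x s)) J t = _ from hφx.derivWithin hJ,
    show derivWithin (fun s ↦ fderiv ℝ φ (x s) (X s)) J t = _ from hφX.derivWithin hJ, map_add,
    H.fderiv_gamma hx]
  simp only [Function.comp_apply]
  abel

end IsLocalIsometry

end LocalGeometry

section Charts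

variable {E : Type*} [NormedAddCommGroup E] [NormedSpace ℝ E]
  {M : Type*} [TopologicalSpace M] [ChartedSpace E M]

omit [NormedSpace ℝ E] in
theorem eventually_mem_chart {c : ℝ → M} {J : Set ℝ} {t : ℝ} {x₀ : M}
    (hc : ContinuousWithinAt c J t) (hx : c t ∈ (chartAt E x₀).source) :
    ∀ᶠ s in 𝓝[J] t, c s ∈ (chartAt E x₀).source :=
  hc ((chartAt E x₀).open_source.mem_nhds hx)

theorem symm_mem_chart_source {x₀ : M} {y : E} (hy : y ∈ (extChartAt 𝓘(ℝ, E) x₀).target) :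
    (extChartAt 𝓘(ℝ, E) x₀).symm y ∈ (chartAt E x₀).source := by
  simpa using (extChartAt 𝓘(ℝ, E) x₀).map_target hy

theorem mem_target {x₀ p : M} (hp : p ∈ (chartAt E x₀).source) :
    extChartAt 𝓘(ℝ, E) x₀ p ∈ (extChartAt 𝓘(ℝ, E) x₀).target :=
  (extChartAt 𝓘(ℝ, E) x₀).map_source (by simpa using hp)

/-- The change of coordinates from the chart at `p` to the chart at `x₀`. -/
def transition (p x₀ : M) : E → E := extChartAt 𝓘(ℝ, E) x₀ ∘ (extChartAt 𝓘(ℝ, E) p).symm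

/-- The domain of the change of coordinates `transition p x₀`. -/
def transitionSource (p x₀ : M) : Set E :=
  ((extChartAt 𝓘(ℝ, E) p).symm ≫ extChartAt 𝓘(ℝ, E) x₀).source

theorem mem_transitionSource {p x₀ q : M} (hp : q ∈ (chartAt E p).source)
    (hx : q ∈ (chartAt E x₀).source) :
    extChartAt 𝓘(ℝ, E) p q ∈ transitionSource (E := E) p x₀ := by
  rw [transitionSource, PartialEquiv.trans_source'', PartialEquiv.symm_symm,
    PartialEquiv.symm_target]
  exact mem_image_of_mem _ ⟨by simpa using hp, by simpa using hx⟩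

theorem transition_apply {p x₀ q : M} (hp : q ∈ (chartAt E p).source) :
    transition p x₀ (extChartAt 𝓘(ℝ, E) p q) = extChartAt 𝓘(ℝ, E) x₀ q := by
  rw [transition, Function.comp_apply, (extChartAt 𝓘(ℝ, E) p).left_inv (by simpa using hp)]

theorem isOpen_transitionSource (p x₀ : M) : IsOpen (transitionSource (E := E) p x₀) := by
  rw [transitionSource, PartialEquiv.trans_source]
  exact (continuousOn_extChartAt_symm p).isOpen_inter_preimage (isOpen_extChartAt_target p)
    (isOpen_extChartAt_source x₀)

variable [IsManifold 𝓘(ℝ, E) ∞ M]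

theorem toCoord_ofCoord {x₀ p : M} (hp : p ∈ (chartAt E x₀).source) (a : E) :
    toCoord x₀ p (ofCoord x₀ p a) = a :=
  Trivialization.continuousLinearMapAt_symmL _ hp a

theorem ofCoord_toCoord {x₀ p : M} (hp : p ∈ (chartAt E x₀).source) (v : TangentSpace 𝓘(ℝ, E) p) :
    ofCoord x₀ p (toCoord x₀ p v) = v :=
  Trivialization.symmL_continuousLinearMapAt _ hp v

theorem toCoord_injective {x₀ p : M} (hp : p ∈ (chartAt E x₀).source) :
    Function.Injective (toCoord (E := E) x₀ p) :=
  Function.LeftInverse.injective (ofCoord_toCoord hp)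

theorem toCoord_add (x₀ p : M) (v w : TangentSpace 𝓘(ℝ, E) p) :
    toCoord x₀ p (v + w) = toCoord x₀ p v + toCoord x₀ p w := map_add _ v w

theorem toCoord_sub (x₀ p : M) (v w : TangentSpace 𝓘(ℝ, E) p) :
    toCoord x₀ p (v - w) = toCoord x₀ p v - toCoord x₀ p w := map_sub _ v w

theorem toCoord_neg (x₀ p : M) (v : TangentSpace 𝓘(ℝ, E) p) :
    toCoord x₀ p (-v) = -toCoord x₀ p v := map_neg _ v

theorem toCoord_smul (x₀ p : M) (r : ℝ) (v : TangentSpace 𝓘(ℝ, E) p) :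
    toCoord x₀ p (r • v) = r • toCoord x₀ p v := map_smul _ r v

theorem toCoord_zero (x₀ p : M) : toCoord x₀ p (0 : TangentSpace 𝓘(ℝ, E) p) = 0 := map_zero _

theorem contDiffOn_transition (p x₀ : M) :
    ContDiffOn ℝ ∞ (transition (E := E) p x₀) (transitionSource p x₀) :=
  contDiffOn_ext_coord_change x₀ p

theorem toCoord_eq_fderiv_transition {p x₀ q : M} (hp : q ∈ (chartAt E p).source)
    (hx : q ∈ (chartAt E x₀).source) (v : TangentSpace 𝓘(ℝ, E) q) :
    toCoord x₀ q v
      = fderiv ℝ (transition p x₀) (extChartAt 𝓘(ℝ, E) p q) (toCoord p q v) := by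
  have hfderiv : fderiv ℝ (transition p x₀) (extChartAt 𝓘(ℝ, E) p q)
      = tangentCoordChange 𝓘(ℝ, E) p x₀ q := by
    rw [tangentCoordChange_def]
    simp [transition, fderivWithin_univ]
  rw [hfderiv, toCoord, toCoord, TangentBundle.continuousLinearMapAt_trivializationAt_eq_core hp,
    TangentBundle.continuousLinearMapAt_trivializationAt_eq_core hx]
  refine (tangentCoordChange_comp (I := 𝓘(ℝ, E)) ?_).symm
  simp [hp, hx]

theorem toCoord_velocity {c : ℝ → M} {J : Set ℝ} {t : ℝ} {x₀ : M} (hJ : UniqueDiffWithinAt ℝ J t)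
    (hc : MDifferentiableWithinAt 𝓘(ℝ, ℝ) 𝓘(ℝ, E) c J t) (hx : c t ∈ (chartAt E x₀).source) :
    toCoord x₀ (c t) (velocity c J t)
      = derivWithin (fun s ↦ extChartAt 𝓘(ℝ, E) x₀ (c s)) J t := by
  rw [toCoord, TangentBundle.continuousLinearMapAt_trivializationAt hx, velocity]
  have hchain := mfderiv_comp_mfderivWithin t (mdifferentiableAt_extChartAt hx) hc
    hJ.uniqueMDiffWithinAt
  rw [mfderivWithin_eq_fderivWithin] at hchain
  rw [← fderivWithin_derivWithin]
  exact congr($hchain.symm (1 : ℝ))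

/-- The vector field `X` along `c` is smooth at `t`. -/
def SmoothAt (c : ℝ → M) (J : Set ℝ) (X : ∀ t, TangentSpace 𝓘(ℝ, E) (c t)) (t : ℝ) : Prop :=
  ContMDiffWithinAt 𝓘(ℝ, ℝ) (𝓘(ℝ, E).tangent) ∞
    (fun s ↦ (⟨c s, X s⟩ : TangentBundle 𝓘(ℝ, E) M)) J t

theorem smoothAt_iff {c : ℝ → M} {J : Set ℝ} {X : ∀ t, TangentSpace 𝓘(ℝ, E) (c t)} {t : ℝ}
    {x₀ : M} (ht : t ∈ J)
    (hc : ContMDiffWithinAt 𝓘(ℝ, ℝ) 𝓘(ℝ, E) ∞ c J t) (hx : c t ∈ (chartAt E x₀).source) :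
    SmoothAt c J X t ↔ ContDiffWithinAt ℝ ∞ (fun s ↦ toCoord x₀ (c s) (X s)) J t := by
  rw [SmoothAt, Trivialization.contMDiffWithinAt_iff
    (e := trivializationAt E (TangentSpace 𝓘(ℝ, E) : M → Type _) x₀) (by simpa using hx)]
  have heq : (fun s ↦ ((trivializationAt E (TangentSpace 𝓘(ℝ, E) : M → Type _) x₀)
      (⟨c s, X s⟩ : TangentBundle 𝓘(ℝ, E) M)).2) =ᶠ[𝓝[J] t] fun s ↦ toCoord x₀ (c s) (X s) := by
    filter_upwards [eventually_mem_chart hc.continuousWithinAt hx] with s hs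
    rw [toCoord, Trivialization.continuousLinearMapAt_apply,
      Trivialization.coe_linearMapAt_of_mem _ hs]
  rw [← contMDiffWithinAt_iff_contDiffWithinAt]
  exact ⟨fun hX ↦ hX.2.congr_of_eventuallyEq heq.symm (heq.self_of_nhdsWithin ht).symm,
    fun hX ↦ ⟨hc, hX.congr_of_eventuallyEq heq (heq.self_of_nhdsWithin ht)⟩⟩

theorem smoothAt_ofCoord {c : ℝ → M} {J : Set ℝ} {t : ℝ} {x₀ : M} (ht : t ∈ J)
    (hc : ContMDiffWithinAt 𝓘(ℝ, ℝ) 𝓘(ℝ, E) ∞ c J t) (hx : c t ∈ (chartAt E x₀).source)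
    {y : ℝ → E} (hy : ContDiffWithinAt ℝ ∞ y J t) :
    SmoothAt c J (fun s ↦ ofCoord x₀ (c s) (y s)) t := by
  rw [smoothAt_iff ht hc hx]
  have heq : ∀ᶠ s in 𝓝[J] t, toCoord x₀ (c s) (ofCoord x₀ (c s) (y s)) = y s := by
    filter_upwards [eventually_mem_chart hc.continuousWithinAt hx] with s hs
      using toCoord_ofCoord hs _
  exact hy.congr_of_eventuallyEq heq (heq.self_of_nhdsWithin ht)

theorem contDiffWithinAt_extChartAt {c : ℝ → M} {J : Set ℝ} {t : ℝ} {x₀ : M}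
    (hc : ContMDiffWithinAt 𝓘(ℝ, ℝ) 𝓘(ℝ, E) ∞ c J t) (hx : c t ∈ (chartAt E x₀).source) :
    ContDiffWithinAt ℝ ∞ (fun s ↦ extChartAt 𝓘(ℝ, E) x₀ (c s)) J t := by
  rw [← contMDiffWithinAt_iff_contDiffWithinAt]
  exact (contMDiffAt_extChartAt' hx).comp_contMDiffWithinAt t hc

theorem contMDiffOn_ofCoord (x₀ : M) (a : E) :
    ContMDiffOn 𝓘(ℝ, E) (𝓘(ℝ, E).tangent) ∞
      (fun y : E ↦ (⟨(extChartAt 𝓘(ℝ, E) x₀).symm y,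
        ofCoord x₀ ((extChartAt 𝓘(ℝ, E) x₀).symm y) a⟩ : TangentBundle 𝓘(ℝ, E) M))
      (extChartAt 𝓘(ℝ, E) x₀).target := by
  refine (Trivialization.contMDiffOn_iff
    (e := trivializationAt E (TangentSpace 𝓘(ℝ, E) : M → Type _) x₀) fun y hy ↦ ?_).2
    ⟨contMDiffOn_extChartAt_symm x₀, (contMDiffOn_const (c := a)).congr fun y hy ↦ ?_⟩
  · simpa using symm_mem_chart_source hy
  · have hcoord := toCoord_ofCoord (symm_mem_chart_source hy) a
    rwa [toCoord, Trivialization.continuousLinearMapAt_apply,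
      Trivialization.coe_linearMapAt_of_mem _ (symm_mem_chart_source hy)] at hcoord

variable [RiemannianBundle (fun x : M ↦ TangentSpace 𝓘(ℝ, E) x)]

theorem chartMetric_apply {x₀ p : M} (hp : p ∈ (chartAt E x₀).source) (a b : E) :
    chartMetric x₀ (extChartAt 𝓘(ℝ, E) x₀ p) a b
      = inner ℝ (ofCoord x₀ p a) (ofCoord x₀ p b) := by
  have hleft : (extChartAt 𝓘(ℝ, E) x₀).symm (extChartAt 𝓘(ℝ, E) x₀ p) = p :=
    (extChartAt 𝓘(ℝ, E) x₀).left_inv (by simpa using hp)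
  simp only [chartMetric, ofCoord]
  rw [hleft]
  rfl

theorem inner_eq_chartMetric {x₀ p : M} (hp : p ∈ (chartAt E x₀).source)
    (v w : TangentSpace 𝓘(ℝ, E) p) :
    inner ℝ v w = chartMetric x₀ (extChartAt 𝓘(ℝ, E) x₀ p) (toCoord x₀ p v) (toCoord x₀ p w) := by
  rw [chartMetric_apply hp, ofCoord_toCoord hp, ofCoord_toCoord hp]

theorem christoffel_eq_gamma (x₀ : M) (y a b : E) :
    christoffel x₀ y a b = gamma (chartMetric x₀) y a b := by
  rw [christoffel, gamma_apply]
  congr 1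

variable [FiniteDimensional ℝ E]
  [IsContMDiffRiemannianBundle 𝓘(ℝ, E) ∞ E (fun x : M ↦ TangentSpace 𝓘(ℝ, E) x)]

theorem isMetricOn_chartMetric (x₀ : M) :
    IsMetricOn (chartMetric (E := E) x₀) (extChartAt 𝓘(ℝ, E) x₀).target where
  isOpen := isOpen_extChartAt_target x₀
  smooth := by
    refine contDiffOn_clm_apply.2 fun a ↦ contDiffOn_clm_apply.2 fun b ↦ ?_
    rw [← contMDiffOn_iff_contDiffOn]
    exact ContMDiffOn.inner_bundle (F := E) (E := fun x : M ↦ TangentSpace 𝓘(ℝ, E) x)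
      (contMDiffOn_ofCoord x₀ a) (contMDiffOn_ofCoord x₀ b)
  symm y _ a b := by
    simp only [chartMetric, ContinuousLinearMap.bilinearComp_apply, innerSL_apply_apply]
    exact real_inner_comm _ _
  pos y hy a ha := by
    have hp := symm_mem_chart_source hy
    have hne : ofCoord x₀ ((extChartAt 𝓘(ℝ, E) x₀).symm y) a ≠ 0 := fun h0 ↦ ha (by
      rw [← toCoord_ofCoord hp a, h0, toCoord_zero])
    rw [← (extChartAt 𝓘(ℝ, E) x₀).right_inv hy, chartMetric_apply hp]
    exact real_inner_self_pos.2 hne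

theorem contDiffWithinAt_chartMetric {c : ℝ → M} {J : Set ℝ} {t : ℝ} {x₀ : M}
    (hc : ContMDiffWithinAt 𝓘(ℝ, ℝ) 𝓘(ℝ, E) ∞ c J t) (hx : c t ∈ (chartAt E x₀).source) :
    ContDiffWithinAt ℝ ∞ (fun s ↦ chartMetric x₀ (extChartAt 𝓘(ℝ, E) x₀ (c s))) J t :=
  ContDiffAt.comp_contDiffWithinAt (g := chartMetric (E := E) x₀) t
    ((isMetricOn_chartMetric x₀).contDiffAt (mem_target hx)) (contDiffWithinAt_extChartAt hc hx)

theorem chartCurvature_eq_curv {x₀ : M} {y : E} (hy : y ∈ (extChartAt 𝓘(ℝ, E) x₀).target)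
    (a b z : E) :
    chartCurvature x₀ y a b z = curv (chartMetric x₀) y a b z := by
  have hΓ := (isMetricOn_chartMetric x₀).differentiableAt_gamma hy
  simp only [chartCurvature, christoffel_eq_gamma, fderiv_clm_apply₂_const hΓ, curv]

theorem isLocalIsometry_transition (p x₀ : M) :
    IsLocalIsometry (chartMetric (E := E) p) (chartMetric x₀) (transitionSource p x₀)
      (extChartAt 𝓘(ℝ, E) x₀).target (transition p x₀) := by
  have hsub : transitionSource (E := E) p x₀ ⊆ (extChartAt 𝓘(ℝ, E) p).target :=
    inter_subset_left
  have hx₀ : ∀ y ∈ transitionSource (E := E) p x₀,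
      (extChartAt 𝓘(ℝ, E) p).symm y ∈ (chartAt E x₀).source := fun y hy ↦ by
    simpa using hy.2
  have hg := isMetricOn_chartMetric (E := E) p
  refine ⟨⟨isOpen_transitionSource p x₀, hg.smooth.mono hsub, fun y hy ↦ hg.symm y (hsub hy),
    fun y hy ↦ hg.pos y (hsub hy)⟩, isMetricOn_chartMetric x₀,
    fun y hy ↦ mem_target (hx₀ y hy), contDiffOn_transition p x₀, fun y hy a b ↦ ?_⟩
  obtain ⟨q, hp, rfl⟩ : ∃ q, q ∈ (chartAt E p).source ∧ extChartAt 𝓘(ℝ, E) p q = y :=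
    ⟨_, symm_mem_chart_source (hsub hy), (extChartAt 𝓘(ℝ, E) p).right_inv (hsub hy)⟩
  have hq : q ∈ (chartAt E x₀).source := by
    have hq := hx₀ _ hy
    rwa [(extChartAt 𝓘(ℝ, E) p).left_inv (by simpa using hp)] at hq
  rw [chartMetric_apply hp, inner_eq_chartMetric hq, toCoord_eq_fderiv_transition hp hq,
    toCoord_eq_fderiv_transition hp hq, toCoord_ofCoord hp, toCoord_ofCoord hp,
    transition_apply hp]

theorem toCoord_curvature {x₀ p : M} (hp : p ∈ (chartAt E x₀).source)
    (u v w : TangentSpace 𝓘(ℝ, E) p) :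
    toCoord x₀ p (curvature p u v w) = curv (chartMetric x₀) (extChartAt 𝓘(ℝ, E) x₀ p)
      (toCoord x₀ p u) (toCoord x₀ p v) (toCoord x₀ p w) := by
  have hpp := mem_chart_source E p
  rw [toCoord_eq_fderiv_transition hpp hp, curvature, toCoord_ofCoord hpp,
    chartCurvature_eq_curv (mem_target hpp),
    (isLocalIsometry_transition p x₀).fderiv_curv (mem_transitionSource hpp hp),
    transition_apply hpp]
  simp only [← toCoord_eq_fderiv_transition hpp hp]

theorem differentiableWithinAt_toCoord_of_chart {c : ℝ → M} {J : Set ℝ}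
    {X : ∀ t, TangentSpace 𝓘(ℝ, E) (c t)} {t : ℝ} {x₀ x₁ : M} (ht : t ∈ J)
    (hc : ContMDiffWithinAt 𝓘(ℝ, ℝ) 𝓘(ℝ, E) ∞ c J t) (hx₀ : c t ∈ (chartAt E x₀).source)
    (hx₁ : c t ∈ (chartAt E x₁).source)
    (hX : DifferentiableWithinAt ℝ (fun s ↦ toCoord x₀ (c s) (X s)) J t) :
    DifferentiableWithinAt ℝ (fun s ↦ toCoord x₁ (c s) (X s)) J t := by
  have hφ := (isLocalIsometry_transition x₀ x₁).differentiableAt_fderiv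
    (mem_transitionSource hx₀ hx₁)
  have hφX := (hφ.comp_differentiableWithinAt t
    ((contDiffWithinAt_extChartAt hc hx₀).differentiableWithinAt (by simp))).clm_apply hX
  have heq : ∀ᶠ s in 𝓝[J] t, toCoord x₁ (c s) (X s) = fderiv ℝ (transition x₀ x₁)
      (extChartAt 𝓘(ℝ, E) x₀ (c s)) (toCoord x₀ (c s) (X s)) := by
    filter_upwards [eventually_mem_chart hc.continuousWithinAt hx₀,
      eventually_mem_chart hc.continuousWithinAt hx₁] with s hs₀ hs₁
    exact toCoord_eq_fderiv_transition hs₀ hs₁ _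
  exact hφX.congr_of_eventuallyEq heq (heq.self_of_nhdsWithin ht)

theorem toCoord_covDeriv {c : ℝ → M} {J : Set ℝ} {X : ∀ t, TangentSpace 𝓘(ℝ, E) (c t)} {t : ℝ}
    {x₀ : M} (ht : t ∈ J) (hJ : UniqueDiffWithinAt ℝ J t)
    (hc : ContMDiffWithinAt 𝓘(ℝ, ℝ) 𝓘(ℝ, E) ∞ c J t) (hx : c t ∈ (chartAt E x₀).source)
    (hX : DifferentiableWithinAt ℝ (fun s ↦ toCoord x₀ (c s) (X s)) J t) :
    toCoord x₀ (c t) (covDeriv c J X t)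
      = derivWithin (fun s ↦ toCoord x₀ (c s) (X s)) J t
        + gamma (chartMetric x₀) (extChartAt 𝓘(ℝ, E) x₀ (c t))
          (derivWithin (fun s ↦ extChartAt 𝓘(ℝ, E) x₀ (c s)) J t) (toCoord x₀ (c t) (X t)) := by
  have hpp := mem_chart_source E (c t)
  have hXd := differentiableWithinAt_toCoord_of_chart ht hc hx hpp hX
  have hxd := (contDiffWithinAt_extChartAt hc hpp).differentiableWithinAt (n := ∞) (by simp)
  have hX' : (fun s ↦ toCoord x₀ (c s) (X s)) =ᶠ[𝓝[J] t] fun s ↦ fderiv ℝ (transition (c t) x₀)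
      (extChartAt 𝓘(ℝ, E) (c t) (c s)) (toCoord (c t) (c s) (X s)) := by
    filter_upwards [eventually_mem_chart hc.continuousWithinAt hx,
      eventually_mem_chart hc.continuousWithinAt hpp] with s hs hst
    exact toCoord_eq_fderiv_transition hst hs _
  have hc' : (fun s ↦ extChartAt 𝓘(ℝ, E) x₀ (c s)) =ᶠ[𝓝[J] t] fun s ↦ transition (c t) x₀
      (extChartAt 𝓘(ℝ, E) (c t) (c s)) := by
    filter_upwards [eventually_mem_chart hc.continuousWithinAt hpp] with s hst
    exact (transition_apply hst).symm
  have hcov := (isLocalIsometry_transition (E := E) (c t) x₀).fderiv_covariant hJ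
    (mem_transitionSource hpp hx) hxd hXd
  rw [hX'.derivWithin_eq (hX'.self_of_nhdsWithin ht),
    hc'.derivWithin_eq (hc'.self_of_nhdsWithin ht), toCoord_eq_fderiv_transition hpp hx,
    toCoord_eq_fderiv_transition hpp hx, covDeriv, toCoord_ofCoord hpp, christoffel_eq_gamma,
    ← hcov, transition_apply hpp]

end Charts

section Fields

variable {E : Type*} [NormedAddCommGroup E] [NormedSpace ℝ E]
  {M : Type*} [TopologicalSpace M] [ChartedSpace E M] [IsManifold 𝓘(ℝ, E) ∞ M]
  {c : ℝ → M} {J : Set ℝ} {t : ℝ} {X Y : ∀ t, TangentSpace 𝓘(ℝ, E) (c t)}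

theorem smoothAt_velocity (hJ : UniqueDiffOn ℝ J) (hc : ContMDiffOn 𝓘(ℝ, ℝ) 𝓘(ℝ, E) ∞ c J)
    (ht : t ∈ J) : SmoothAt c J (velocity (E := E) c J) t := by
  have hpp := mem_chart_source E (c t)
  rw [smoothAt_iff ht (hc t ht) hpp]
  have hderiv := (contDiffWithinAt_extChartAt (hc t ht) hpp).derivWithin hJ (m := ∞) (by simp) ht
  have heq : ∀ᶠ s in 𝓝[J] t, toCoord (c t) (c s) (velocity (E := E) c J s)
      = derivWithin (fun s ↦ extChartAt 𝓘(ℝ, E) (c t) (c s)) J s := by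
    filter_upwards [eventually_mem_chart (hc t ht).continuousWithinAt hpp, self_mem_nhdsWithin]
      with s hs hsJ
    exact toCoord_velocity (hJ s hsJ) ((hc s hsJ).mdifferentiableWithinAt (by simp)) hs
  exact hderiv.congr_of_eventuallyEq heq (heq.self_of_nhdsWithin ht)

theorem SmoothAt.add (hc : ContMDiffOn 𝓘(ℝ, ℝ) 𝓘(ℝ, E) ∞ c J) (ht : t ∈ J)
    (hX : SmoothAt c J X t) (hY : SmoothAt c J Y t) : SmoothAt c J (fun s ↦ X s + Y s) t := by
  have hpp := mem_chart_source E (c t)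
  rw [smoothAt_iff ht (hc t ht) hpp] at hX hY ⊢
  simpa only [toCoord_add] using hX.add hY

theorem SmoothAt.sub (hc : ContMDiffOn 𝓘(ℝ, ℝ) 𝓘(ℝ, E) ∞ c J) (ht : t ∈ J)
    (hX : SmoothAt c J X t) (hY : SmoothAt c J Y t) : SmoothAt c J (fun s ↦ X s - Y s) t := by
  have hpp := mem_chart_source E (c t)
  rw [smoothAt_iff ht (hc t ht) hpp] at hX hY ⊢
  simpa only [toCoord_sub] using hX.sub hY

theorem SmoothAt.smul (hc : ContMDiffOn 𝓘(ℝ, ℝ) 𝓘(ℝ, E) ∞ c J) (ht : t ∈ J) {f : ℝ → ℝ}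
    (hf : ContDiffWithinAt ℝ ∞ f J t) (hX : SmoothAt c J X t) :
    SmoothAt c J (fun s ↦ f s • X s) t := by
  have hpp := mem_chart_source E (c t)
  rw [smoothAt_iff ht (hc t ht) hpp] at hX ⊢
  simp only [toCoord_smul]
  exact hf.smul hX

theorem SmoothAt.congr (hX : SmoothAt c J X t) (ht : t ∈ J) (h : ∀ᶠ s in 𝓝[J] t, Y s = X s) :
    SmoothAt c J Y t := by
  have heq : ∀ᶠ s in 𝓝[J] t, (⟨c s, Y s⟩ : TangentBundle 𝓘(ℝ, E) M) = ⟨c s, X s⟩ := by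
    filter_upwards [h] with s hs
    rw [hs]
  exact ContMDiffWithinAt.congr_of_eventuallyEq hX heq (heq.self_of_nhdsWithin ht)

theorem SmoothAt.differentiableWithinAt_toCoord {x₀ : M} (hX : SmoothAt c J X t)
    (hc : ContMDiffOn 𝓘(ℝ, ℝ) 𝓘(ℝ, E) ∞ c J) (ht : t ∈ J) (hx : c t ∈ (chartAt E x₀).source) :
    DifferentiableWithinAt ℝ (fun s ↦ toCoord x₀ (c s) (X s)) J t :=
  ((smoothAt_iff ht (hc t ht) hx).1 hX).differentiableWithinAt (by simp)

theorem SmoothAt.eventually_differentiableWithinAt_toCoord {x₀ : M} (hX : SmoothAt c J X t)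
    (hc : ContMDiffOn 𝓘(ℝ, ℝ) 𝓘(ℝ, E) ∞ c J) (ht : t ∈ J) (hx : c t ∈ (chartAt E x₀).source) :
    ∀ᶠ s in 𝓝[J] t, DifferentiableWithinAt ℝ (fun r ↦ toCoord x₀ (c r) (X r)) J s := by
  rw [smoothAt_iff ht (hc t ht) hx] at hX
  have hcd := (hX.of_le (m := 1) (by simp)).eventually (by simp)
  rw [insert_eq_of_mem ht] at hcd
  filter_upwards [hcd] with s hs using hs.differentiableWithinAt (by simp)

variable [RiemannianBundle (fun x : M ↦ TangentSpace 𝓘(ℝ, E) x)]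

theorem covDeriv_congr (ht : t ∈ J) (h : ∀ᶠ s in 𝓝[J] t, Y s = X s) :
    covDeriv c J Y t = covDeriv c J X t := by
  have heq : (fun s ↦ toCoord (c t) (c s) (Y s)) =ᶠ[𝓝[J] t] fun s ↦ toCoord (c t) (c s) (X s) := by
    filter_upwards [h] with s hs
    rw [hs]
  rw [covDeriv, covDeriv, heq.derivWithin_eq (heq.self_of_nhdsWithin ht), h.self_of_nhdsWithin ht]

theorem covDeriv_add (hc : ContMDiffOn 𝓘(ℝ, ℝ) 𝓘(ℝ, E) ∞ c J)
    (ht : t ∈ J) (hX : SmoothAt c J X t) (hY : SmoothAt c J Y t) :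
    covDeriv c J (fun s ↦ X s + Y s) t = covDeriv c J X t + covDeriv c J Y t := by
  have hpp := mem_chart_source E (c t)
  apply toCoord_injective hpp
  simp only [covDeriv, toCoord_ofCoord hpp, toCoord_add, christoffel_eq_gamma]
  rw [derivWithin_fun_add (hX.differentiableWithinAt_toCoord hc ht hpp)
    (hY.differentiableWithinAt_toCoord hc ht hpp), map_add]
  abel

theorem covDeriv_sub (hc : ContMDiffOn 𝓘(ℝ, ℝ) 𝓘(ℝ, E) ∞ c J)
    (ht : t ∈ J) (hX : SmoothAt c J X t) (hY : SmoothAt c J Y t) :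
    covDeriv c J (fun s ↦ X s - Y s) t = covDeriv c J X t - covDeriv c J Y t := by
  have hpp := mem_chart_source E (c t)
  apply toCoord_injective hpp
  simp only [covDeriv, toCoord_ofCoord hpp, toCoord_sub, christoffel_eq_gamma]
  rw [derivWithin_fun_sub (hX.differentiableWithinAt_toCoord hc ht hpp)
    (hY.differentiableWithinAt_toCoord hc ht hpp), map_sub]
  abel

theorem covDeriv_const_smul (hc : ContMDiffOn 𝓘(ℝ, ℝ) 𝓘(ℝ, E) ∞ c J)
    (ht : t ∈ J) (r : ℝ) (hX : SmoothAt c J X t) :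
    covDeriv c J (fun s ↦ r • X s) t = r • covDeriv c J X t := by
  have hpp := mem_chart_source E (c t)
  apply toCoord_injective hpp
  simp only [covDeriv, toCoord_ofCoord hpp, toCoord_smul, christoffel_eq_gamma]
  rw [derivWithin_fun_const_smul _ (hX.differentiableWithinAt_toCoord hc ht hpp), map_smul,
    smul_add]

theorem covDeriv_zero : covDeriv (E := E) c J (fun _ ↦ 0) t = 0 := by
  have hpp := mem_chart_source E (c t)
  apply toCoord_injective hpp
  simp only [covDeriv, toCoord_ofCoord hpp, toCoord_zero, christoffel_eq_gamma, map_zero,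
    derivWithin_fun_const, Pi.zero_apply, add_zero]

/-- The curvature operator `x ↦ R(x, ċ) ċ` along `c`. -/
def tidal (c : ℝ → M) (J : Set ℝ) (t : ℝ) (x : TangentSpace 𝓘(ℝ, E) (c t)) :
    TangentSpace 𝓘(ℝ, E) (c t) :=
  curvature (c t) x (velocity c J t) (velocity c J t)

theorem isJacobiField_of_covDeriv_eq_zero (hX : ∀ s ∈ J, SmoothAt c J X s)
    (hpar : ∀ s ∈ J, covDeriv c J X s = 0) (htidal : ∀ s ∈ J, tidal c J s (X s) = 0) :
    IsJacobiField c J X where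
  smooth := hX
  jacobi s hs := by
    have hzero : ∀ᶠ r in 𝓝[J] s, covDeriv c J X r = 0 := by
      filter_upwards [self_mem_nhdsWithin] with r hr using hpar r hr
    rw [covDeriv_congr hs hzero, covDeriv_zero, zero_add]
    exact htidal s hs

variable [IsContMDiffRiemannianBundle 𝓘(ℝ, E) ∞ E (fun x : M ↦ TangentSpace 𝓘(ℝ, E) x)]

theorem SmoothAt.contDiffWithinAt_inner (hX : SmoothAt c J X t) (hY : SmoothAt c J Y t) :
    ContDiffWithinAt ℝ ∞ (fun s ↦ inner ℝ (X s) (Y s)) J t := by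
  rw [← contMDiffWithinAt_iff_contDiffWithinAt]
  exact ContMDiffWithinAt.inner_bundle (F := E) (E := fun x : M ↦ TangentSpace 𝓘(ℝ, E) x) hX hY

theorem SmoothAt.continuousWithinAt_norm (hX : SmoothAt c J X t) :
    ContinuousWithinAt (fun s ↦ ‖X s‖) J t := by
  simp only [norm_eq_sqrt_real_inner (X _)]
  exact (hX.contDiffWithinAt_inner hX).continuousWithinAt.sqrt

variable [FiniteDimensional ℝ E]

protected theorem SmoothAt.covDeriv (hJ : UniqueDiffOn ℝ J)
    (hc : ContMDiffOn 𝓘(ℝ, ℝ) 𝓘(ℝ, E) ∞ c J) (ht : t ∈ J) (hX : SmoothAt c J X t) :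
    SmoothAt c J (covDeriv c J X) t := by
  have hpp := mem_chart_source E (c t)
  have hXdiff := hX.eventually_differentiableWithinAt_toCoord hc ht hpp
  rw [smoothAt_iff ht (hc t ht) hpp] at hX ⊢
  have hx := contDiffWithinAt_extChartAt (hc t ht) hpp
  have hΓ : ContDiffWithinAt ℝ ∞
      (fun s ↦ gamma (chartMetric (c t)) (extChartAt 𝓘(ℝ, E) (c t) (c s))) J t :=
    ContDiffAt.comp_contDiffWithinAt (g := gamma (chartMetric (E := E) (c t))) t
      ((isMetricOn_chartMetric (c t)).contDiffAt_gamma (mem_target hpp)) hx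
  have hsmooth := (hX.derivWithin hJ (m := ∞) (by simp) ht).add
    ((hΓ.clm_apply (hx.derivWithin hJ (m := ∞) (by simp) ht)).clm_apply hX)
  have heq : ∀ᶠ s in 𝓝[J] t, toCoord (c t) (c s) (covDeriv c J X s)
      = derivWithin (fun s ↦ toCoord (c t) (c s) (X s)) J s
        + gamma (chartMetric (c t)) (extChartAt 𝓘(ℝ, E) (c t) (c s))
          (derivWithin (fun s ↦ extChartAt 𝓘(ℝ, E) (c t) (c s)) J s)
            (toCoord (c t) (c s) (X s)) := by
    filter_upwards [eventually_mem_chart (hc t ht).continuousWithinAt hpp, self_mem_nhdsWithin,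
      hXdiff] with s hs hsJ hd
    exact toCoord_covDeriv hsJ (hJ s hsJ) (hc s hsJ) hs hd
  exact hsmooth.congr_of_eventuallyEq heq (heq.self_of_nhdsWithin ht)

theorem hasDerivWithinAt_inner_of_differentiableWithinAt (hc : ContMDiffOn 𝓘(ℝ, ℝ) 𝓘(ℝ, E) ∞ c J)
    (ht : t ∈ J) (hX : DifferentiableWithinAt ℝ (fun s ↦ toCoord (c t) (c s) (X s)) J t)
    (hY : DifferentiableWithinAt ℝ (fun s ↦ toCoord (c t) (c s) (Y s)) J t) :
    HasDerivWithinAt (fun s ↦ inner ℝ (X s) (Y s))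
      (inner ℝ (covDeriv c J X t) (Y t) + inner ℝ (X t) (covDeriv c J Y t)) J t := by
  have hpp := mem_chart_source E (c t)
  have hinner := (isMetricOn_chartMetric (E := E) (c t)).hasDerivWithinAt_apply (mem_target hpp)
    ((contDiffWithinAt_extChartAt (hc t ht) hpp).differentiableWithinAt (n := ∞) (by simp)) hX hY
  have heq : ∀ᶠ s in 𝓝[J] t, inner ℝ (X s) (Y s) = chartMetric (c t)
      (extChartAt 𝓘(ℝ, E) (c t) (c s)) (toCoord (c t) (c s) (X s)) (toCoord (c t) (c s) (Y s)) := by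
    filter_upwards [eventually_mem_chart (hc t ht).continuousWithinAt hpp] with s hs
    exact inner_eq_chartMetric hs _ _
  have hX' : toCoord (c t) (c t) (covDeriv c J X t) = _ := toCoord_ofCoord hpp _
  have hY' : toCoord (c t) (c t) (covDeriv c J Y t) = _ := toCoord_ofCoord hpp _
  rw [christoffel_eq_gamma] at hX' hY'
  rw [inner_eq_chartMetric hpp, inner_eq_chartMetric hpp, hX', hY']
  exact hinner.congr_of_eventuallyEq heq (heq.self_of_nhdsWithin ht)

theorem SmoothAt.hasDerivWithinAt_inner (hc : ContMDiffOn 𝓘(ℝ, ℝ) 𝓘(ℝ, E) ∞ c J)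
    (ht : t ∈ J) (hX : SmoothAt c J X t) (hY : SmoothAt c J Y t) :
    HasDerivWithinAt (fun r ↦ inner ℝ (X r) (Y r))
      (inner ℝ (covDeriv c J X t) (Y t) + inner ℝ (X t) (covDeriv c J Y t)) J t :=
  hasDerivWithinAt_inner_of_differentiableWithinAt hc ht
    (hX.differentiableWithinAt_toCoord hc ht (mem_chart_source E (c t)))
    (hY.differentiableWithinAt_toCoord hc ht (mem_chart_source E (c t)))

theorem SmoothAt.eventually_hasDerivWithinAt_inner (hc : ContMDiffOn 𝓘(ℝ, ℝ) 𝓘(ℝ, E) ∞ c J)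
    (ht : t ∈ J) (hX : SmoothAt c J X t) (hY : SmoothAt c J Y t) :
    ∀ᶠ s in 𝓝[J] t, HasDerivWithinAt (fun r ↦ inner ℝ (X r) (Y r))
      (inner ℝ (covDeriv c J X s) (Y s) + inner ℝ (X s) (covDeriv c J Y s)) J s := by
  have hpp := mem_chart_source E (c t)
  filter_upwards [hX.eventually_differentiableWithinAt_toCoord hc ht hpp,
    hY.eventually_differentiableWithinAt_toCoord hc ht hpp, self_mem_nhdsWithin,
    eventually_mem_chart (hc t ht).continuousWithinAt hpp] with s hXs hYs hsJ hs
  have hss := mem_chart_source E (c s)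
  exact hasDerivWithinAt_inner_of_differentiableWithinAt hc hsJ
    (differentiableWithinAt_toCoord_of_chart hsJ (hc s hsJ) hs hss hXs)
    (differentiableWithinAt_toCoord_of_chart hsJ (hc s hsJ) hs hss hYs)

theorem tidal_add (x y : TangentSpace 𝓘(ℝ, E) (c t)) :
    tidal c J t (x + y) = tidal c J t x + tidal c J t y := by
  have hpp := mem_chart_source E (c t)
  apply toCoord_injective hpp
  simp only [tidal, toCoord_add, toCoord_curvature hpp, curv_add_left]

theorem tidal_smul (r : ℝ) (x : TangentSpace 𝓘(ℝ, E) (c t)) :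
    tidal c J t (r • x) = r • tidal c J t x := by
  have hpp := mem_chart_source E (c t)
  apply toCoord_injective hpp
  simp only [tidal, toCoord_smul, toCoord_curvature hpp, curv_smul_left]

theorem tidal_sub (x y : TangentSpace 𝓘(ℝ, E) (c t)) :
    tidal c J t (x - y) = tidal c J t x - tidal c J t y := by
  rw [sub_eq_add_neg, ← neg_one_smul ℝ y, tidal_add, tidal_smul, neg_one_smul, sub_eq_add_neg]

theorem inner_tidal_comm (x y : TangentSpace 𝓘(ℝ, E) (c t)) :
    inner ℝ (tidal c J t x) y = inner ℝ (tidal c J t y) x := by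
  have hpp := mem_chart_source E (c t)
  simp only [inner_eq_chartMetric hpp, tidal, toCoord_curvature hpp]
  exact (isMetricOn_chartMetric (c t)).apply_curv_symm (mem_target hpp) _ _ _

theorem inner_tidal_velocity (x : TangentSpace 𝓘(ℝ, E) (c t)) :
    inner ℝ (tidal c J t x) (velocity c J t) = 0 := by
  have hpp := mem_chart_source E (c t)
  simp only [inner_eq_chartMetric hpp, tidal, toCoord_curvature hpp]
  exact (isMetricOn_chartMetric (c t)).apply_curv_self (mem_target hpp) _ _

/-- The coefficients, in the chart at `x₀`, of the Jacobi equation along `c`, written as a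
first-order system for the pair `(X, X')`. -/
def jacobiSystem (c : ℝ → M) (J : Set ℝ) (x₀ : M) (s : ℝ) : E × E →L[ℝ] E × E :=
  let x := fun s ↦ extChartAt 𝓘(ℝ, E) x₀ (c s)
  let Γ := gamma (chartMetric x₀) (x s) (derivWithin x J s)
  LinearMap.toContinuousLinearMap
    { toFun := fun p ↦ (p.2 - Γ p.1,
        -curv (chartMetric x₀) (x s) p.1 (derivWithin x J s) (derivWithin x J s) - Γ p.2)
      map_add' := fun p q ↦ by
        ext <;> simp only [Prod.fst_add, Prod.snd_add, map_add, curv_add_left] <;> abel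
      map_smul' := fun r p ↦ by
        ext <;> simp [curv_smul_left, smul_sub] }

theorem IsMetricOn.continuousWithinAt_curv {g : E → E →L[ℝ] E →L[ℝ] ℝ} {U : Set E} {x y : ℝ → E}
    (h : IsMetricOn g U) (hxU : x t ∈ U) (hx : ContinuousWithinAt x J t)
    (hy : ContinuousWithinAt y J t) (a : E) :
    ContinuousWithinAt (fun s ↦ curv g (x s) a (y s) (y s)) J t := by
  have hΓ : ContinuousWithinAt (fun s ↦ gamma g (x s)) J t :=
    (h.contDiffAt_gamma hxU).continuousAt.comp_continuousWithinAt hx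
  have hdΓ : ContinuousWithinAt (fun s ↦ fderiv ℝ (gamma g) (x s)) J t :=
    ((h.contDiffAt_gamma hxU).fderiv_right (m := ∞)
      (by simp)).continuousAt.comp_continuousWithinAt hx
  unfold curv
  fun_prop

theorem continuousWithinAt_jacobiSystem (hJ : UniqueDiffOn ℝ J)
    (hc : ContMDiffOn 𝓘(ℝ, ℝ) 𝓘(ℝ, E) ∞ c J) {x₀ : M} (ht : t ∈ J)
    (hx₀ : c t ∈ (chartAt E x₀).source) :
    ContinuousWithinAt (jacobiSystem (E := E) c J x₀) J t := by
  have hg := isMetricOn_chartMetric (E := E) x₀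
  have hx := contDiffWithinAt_extChartAt (hc t ht) hx₀
  have hx' := (hx.derivWithin hJ (m := ∞) (by simp) ht).continuousWithinAt
  have hΓ : ContinuousWithinAt
      (fun s ↦ gamma (chartMetric x₀) (extChartAt 𝓘(ℝ, E) x₀ (c s))) J t :=
    (hg.contDiffAt_gamma (mem_target hx₀)).continuousAt.comp_continuousWithinAt
      (f := fun s ↦ extChartAt 𝓘(ℝ, E) x₀ (c s)) hx.continuousWithinAt
  refine continuousWithinAt_clm_apply.2 fun p ↦ ?_
  have hR := hg.continuousWithinAt_curv (mem_target hx₀) hx.continuousWithinAt hx' p.1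
  have hΓ' := hΓ.clm_apply hx'
  exact (continuousWithinAt_const.sub (hΓ'.clm_apply continuousWithinAt_const)).prodMk
    (hR.neg.sub (hΓ'.clm_apply continuousWithinAt_const))

theorem IsJacobiField.hasDerivWithinAt_toCoord (hJ : UniqueDiffOn ℝ J)
    (hc : ContMDiffOn 𝓘(ℝ, ℝ) 𝓘(ℝ, E) ∞ c J) (hX : IsJacobiField c J X) {x₀ : M} (ht : t ∈ J)
    (hx₀ : c t ∈ (chartAt E x₀).source) :
    HasDerivWithinAt (fun s ↦ (toCoord x₀ (c s) (X s), toCoord x₀ (c s) (covDeriv c J X s)))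
      (jacobiSystem c J x₀ t (toCoord x₀ (c t) (X t), toCoord x₀ (c t) (covDeriv c J X t)))
      J t := by
  have hXt : SmoothAt c J X t := hX.smooth t ht
  have ha := hXt.differentiableWithinAt_toCoord hc ht hx₀
  have hb := (hXt.covDeriv hJ hc ht).differentiableWithinAt_toCoord hc ht hx₀
  have ha' := toCoord_covDeriv ht (hJ t ht) (hc t ht) hx₀ ha
  have hb' := toCoord_covDeriv ht (hJ t ht) (hc t ht) hx₀ hb
  rw [eq_neg_of_add_eq_zero_left (hX.jacobi t ht), toCoord_neg, toCoord_curvature hx₀,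
    toCoord_velocity (hJ t ht) ((hc t ht).mdifferentiableWithinAt (by simp)) hx₀] at hb'
  refine (ha.hasDerivWithinAt.prodMk hb.hasDerivWithinAt).congr_deriv ?_
  rw [eq_sub_of_add_eq ha'.symm, eq_sub_of_add_eq hb'.symm]
  rfl

theorem IsJacobiField.eventually_eq_zero_iff (hJ : J.OrdConnected) (hJ' : J.Nontrivial)
    (hc : ContMDiffOn 𝓘(ℝ, ℝ) 𝓘(ℝ, E) ∞ c J) (hX : IsJacobiField c J X) (ht : t ∈ J) :
    ∀ᶠ s in 𝓝[J] t, X s = 0 ∧ covDeriv c J X s = 0 ↔ X t = 0 ∧ covDeriv c J X t = 0 := by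
  have hu := uniqueDiffOn_of_ordConnected hJ hJ'
  have hpp := mem_chart_source E (c t)
  let F : ℝ → E × E →L[ℝ] E × E := jacobiSystem c J (c t)
  have hF : ContinuousWithinAt F J t := continuousWithinAt_jacobiSystem hu hc ht hpp
  have hbound : ∀ᶠ s in 𝓝[J] t, ‖F s‖ < ‖F t‖ + 1 := hF.norm.eventually_lt_const (lt_add_one _)
  obtain ⟨a, b, -, htab, hsub, hJab, hnhds⟩ := exists_Icc_mem_nhdsWithin hJ hJ' ht
    (hbound.and (eventually_mem_chart (hc t ht).continuousWithinAt hpp))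
  let y : ℝ → E × E := fun s ↦ (toCoord (c t) (c s) (X s), toCoord (c t) (c s) (covDeriv c J X s))
  have hy : ∀ s ∈ Icc a b, HasDerivWithinAt y (F s (y s)) (Icc a b) s := fun s hs ↦
    (hX.hasDerivWithinAt_toCoord hu hc (hJab hs) (hsub hs).2).mono hJab
  have hFy : ∀ s ∈ Icc a b, ‖F s (y s)‖ ≤ (‖F t‖ + 1) * ‖y s‖ := fun s hs ↦
    (F s).le_of_opNorm_le (hsub hs).1.le _
  have hzero : ∀ s ∈ Icc a b, y s = 0 ↔ X s = 0 ∧ covDeriv c J X s = 0 := fun s hs ↦ by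
    have hinj : ∀ x : TangentSpace 𝓘(ℝ, E) (c s), toCoord (c t) (c s) x = 0 ↔ x = 0 := fun x ↦ by
      rw [← (toCoord_injective (hsub hs).2).eq_iff (b := 0), toCoord_zero]
    simp only [y, Prod.mk_eq_zero, hinj]
  have hpropagate : ∀ r ∈ Icc a b, y r = 0 → ∀ s ∈ Icc a b, y s = 0 := fun r hr h0 ↦
    eq_zero_of_norm_deriv_le ordConnected_Icc hy hFy hr h0
  filter_upwards [hnhds] with s hs
  rw [← hzero s hs, ← hzero t htab]
  exact ⟨fun h ↦ hpropagate s hs h t htab, fun h ↦ hpropagate t htab h s hs⟩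

theorem IsJacobiField.eq_zero (hJ : J.OrdConnected) (hJ' : J.Nontrivial)
    (hc : ContMDiffOn 𝓘(ℝ, ℝ) 𝓘(ℝ, E) ∞ c J) (hX : IsJacobiField c J X) (ht : t ∈ J)
    (h0 : X t = 0) (h1 : covDeriv c J X t = 0) {s : ℝ} (hs : s ∈ J) : X s = 0 :=
  (hJ.isPreconnected.induction₂'
    (fun r s ↦ X r = 0 ∧ covDeriv c J X r = 0 → X s = 0 ∧ covDeriv c J X s = 0)
    (fun _ hr ↦ (hX.eventually_eq_zero_iff hJ hJ' hc hr).mono fun _ h ↦ ⟨h.2, h.1⟩)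
    (fun _ _ _ _ _ _ hrs hsu ↦ hsu ∘ hrs) ht hs ⟨h0, h1⟩).1

protected theorem IsJacobiField.sub (hJ : UniqueDiffOn ℝ J)
    (hc : ContMDiffOn 𝓘(ℝ, ℝ) 𝓘(ℝ, E) ∞ c J) (hX : IsJacobiField c J X)
    (hY : IsJacobiField c J Y) : IsJacobiField c J fun s ↦ X s - Y s where
  smooth s hs := SmoothAt.sub hc hs (hX.smooth s hs) (hY.smooth s hs)
  jacobi s hs := by
    have hX' : SmoothAt c J (covDeriv c J X) s := SmoothAt.covDeriv hJ hc hs (hX.smooth s hs)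
    have hY' : SmoothAt c J (covDeriv c J Y) s := SmoothAt.covDeriv hJ hc hs (hY.smooth s hs)
    have hsub : ∀ᶠ r in 𝓝[J] s, covDeriv c J (fun r ↦ X r - Y r) r
        = covDeriv c J X r - covDeriv c J Y r := by
      filter_upwards [self_mem_nhdsWithin] with r hr
      exact covDeriv_sub hc hr (hX.smooth r hr) (hY.smooth r hr)
    rw [covDeriv_congr hs hsub, covDeriv_sub hc hs hX' hY']
    change _ + tidal c J s (X s - Y s) = 0
    rw [tidal_sub, sub_add_sub_comm]
    exact sub_eq_zero.2 ((hX.jacobi s hs).trans (hY.jacobi s hs).symm)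

theorem IsJacobiField.eq_of_eq (hJ : J.OrdConnected) (hJ' : J.Nontrivial)
    (hc : ContMDiffOn 𝓘(ℝ, ℝ) 𝓘(ℝ, E) ∞ c J) (hX : IsJacobiField c J X)
    (hY : IsJacobiField c J Y) (ht : t ∈ J) (h0 : X t = Y t)
    (h1 : covDeriv c J X t = covDeriv c J Y t) {s : ℝ} (hs : s ∈ J) : X s = Y s := by
  refine sub_eq_zero.1 ((hX.sub (uniqueDiffOn_of_ordConnected hJ hJ') hc hY).eq_zero hJ hJ' hc ht
    (sub_eq_zero.2 h0) ?_ hs)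
  rw [covDeriv_sub hc ht (hX.smooth t ht) (hY.smooth t ht), h1, sub_self]

end Fields

section LinearFamilies

variable {W E : Type*} [NormedAddCommGroup W] [InnerProductSpace ℝ W]
  [NormedAddCommGroup E] [NormedSpace ℝ E]

/-- Multiplication by `r` on the subspace `K` and by `1` on its orthogonal complement. -/
def stretch (K : Submodule ℝ W) [K.HasOrthogonalProjection] (r : ℝ) : W →L[ℝ] W :=
  ContinuousLinearMap.id ℝ W - K.starProjection + r • K.starProjection

section Stretch

variable (K : Submodule ℝ W) [K.HasOrthogonalProjection]

theorem stretch_apply (r : ℝ) (w : W) :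
    stretch K r w = w - K.starProjection w + r • K.starProjection w := rfl

theorem starProjection_stretch (r : ℝ) (w : W) :
    K.starProjection (stretch K r w) = r • K.starProjection w := by
  have hidem : K.starProjection (K.starProjection w) = K.starProjection w :=
    Submodule.starProjection_eq_self_iff.2 (Submodule.starProjection_apply_mem K w)
  rw [stretch_apply, map_add, map_sub, map_smul, hidem, sub_self, zero_add]

theorem inner_stretch_comm (r : ℝ) (u w : W) :
    inner ℝ u (stretch K r w) = inner ℝ (stretch K r u) w := by
  simp only [stretch_apply, inner_add_left, inner_sub_left, inner_add_right, inner_sub_right,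
    real_inner_smul_left, real_inner_smul_right, K.inner_starProjection_left_eq_right]

variable {K}

theorem stretch_of_mem_orthogonal (r : ℝ) {w : W} (hw : w ∈ Kᗮ) : stretch K r w = w := by
  rw [stretch_apply, (Submodule.starProjection_apply_eq_zero_iff K).2 hw, smul_zero,
    sub_zero, add_zero]

theorem stretch_of_mem (r : ℝ) {w : W} (hw : w ∈ K) : stretch K r w = r • w := by
  rw [stretch_apply, Submodule.starProjection_eq_self_iff.2 hw, sub_self, zero_add]

theorem eq_zero_of_stretch_eq_zero {r : ℝ} (hr : r ≠ 0) {w : W} (h : stretch K r w = 0) :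
    w = 0 := by
  have hproj : K.starProjection w = 0 := by
    have hsmul := starProjection_stretch K r w
    rw [h, map_zero] at hsmul
    exact (smul_eq_zero.1 hsmul.symm).resolve_left hr
  rwa [stretch_apply, hproj, sub_zero, smul_zero, add_zero] at h

end Stretch

theorem contDiffWithinAt_of_forall_clm_apply {V D : Type*} [NormedAddCommGroup V] [NormedSpace ℝ V]
    [FiniteDimensional ℝ V] [NormedAddCommGroup D] [NormedSpace ℝ D] {n : WithTop ℕ∞}
    {f : D → V →L[ℝ] E} {s : Set D} {t : D}
    (h : ∀ w, ContDiffWithinAt ℝ n (fun x ↦ f x w) s t) : ContDiffWithinAt ℝ n f s t := by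
  let d := Module.finrank ℝ V
  have hd : d = Module.finrank ℝ (Fin d → ℝ) := (Module.finrank_fin_fun ℝ).symm
  let coords := ContinuousLinearEquiv.ofFinrankEq hd
  let columns := (coords.arrowCongr (1 : E ≃L[ℝ] E)).trans (ContinuousLinearEquiv.piRing (Fin d))
  rw [← Function.id_comp f, ← columns.symm_comp_self]
  exact columns.symm.contDiff.contDiffAt.comp_contDiffWithinAt t
    (contDiffWithinAt_pi.2 fun i ↦ h _)

theorem exists_factorization_stretch [CompleteSpace E] {J : Set ℝ} (hJ : J.OrdConnected)
    (hJ' : J.Nontrivial) {t : ℝ} (ht : t ∈ J) {F : ℝ → W →L[ℝ] E}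
    (hF : ContDiffWithinAt ℝ ∞ F J t) {K : Submodule ℝ W} [K.HasOrthogonalProjection]
    (hK : ∀ k ∈ K, F t k = 0) :
    ∃ B : ℝ → W →L[ℝ] E, ContDiffWithinAt ℝ ∞ B J t ∧
      (∀ s w, B s (stretch K (s - t) w) = F s w) ∧
      ∀ w, B t w = F t w + derivWithin F J t (K.starProjection w) := by
  let P := K.starProjection
  have hP : ∀ w, F t (P w) = 0 := fun w ↦ hK _ (Submodule.starProjection_apply_mem K w)
  let Q : ℝ → W →L[ℝ] E := Function.update (slope F t) t (derivWithin F J t)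
  have hQ : ∀ s w, (s - t) • Q s (P w) = F s (P w) := fun s w ↦ by
    rcases eq_or_ne s t with rfl | hst
    · rw [sub_self, zero_smul, hP]
    · simp only [Q, Function.update_of_ne hst]
      rw [← smul_apply, sub_smul_slope, vsub_eq_sub, sub_apply, hP, sub_zero]
  refine ⟨fun s ↦ F s ∘L (ContinuousLinearMap.id ℝ W - P) + Q s ∘L P,
    (hF.clm_comp contDiffWithinAt_const).add
      ((contDiffWithinAt_update_slope hJ hJ' ht hF).clm_comp contDiffWithinAt_const),
    fun s w ↦ ?_, fun w ↦ ?_⟩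
  · change F s (stretch K (s - t) w - P (stretch K (s - t) w)) + Q s (P (stretch K (s - t) w)) = _
    rw [starProjection_stretch, stretch_apply, add_sub_cancel_right, map_smul, hQ, ← map_add,
      sub_add_cancel]
  · change F t (w - P w) + Q t (P w) = _
    rw [map_sub, hP, sub_zero]
    simp only [Q, Function.update_self, P]

theorem exists_eq_add_starProjection [FiniteDimensional ℝ W] {V : Type*} [NormedAddCommGroup V]
    [InnerProductSpace ℝ V] [FiniteDimensional ℝ V] (A D : W →ₗ[ℝ] V)
    (hrank : Module.finrank ℝ W = Module.finrank ℝ V)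
    (hsymm : ∀ x y, inner ℝ (D x) (A y) = inner ℝ (A x) (D y))
    (hinj : ∀ w, A w = 0 → D w = 0 → w = 0) (z : V) :
    ∃ w, z = A w + D ((LinearMap.ker A).starProjection w) := by
  let P := (LinearMap.ker A).starProjection
  have hAP : ∀ w, A (P w) = 0 := Submodule.starProjection_apply_mem (LinearMap.ker A)
  let β : W →ₗ[ℝ] V := A + D ∘ₗ (P : W →ₗ[ℝ] W)
  have hβinj : Function.Injective β := by
    refine (injective_iff_map_eq_zero β).2 fun w (hw : A w + D (P w) = 0) ↦ ?_
    -- the ranges of `A` and of `D ∘ P` are orthogonal, because `D` is symmetric relative to `A`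
    have hAw : A w = 0 := by
      have horth : inner ℝ (A w + D (P w)) (A w) = 0 := by rw [hw, inner_zero_left]
      rwa [inner_add_left, hsymm, hAP, inner_zero_left, add_zero, inner_self_eq_zero] at horth
    have hPw : P w = w := Submodule.starProjection_eq_self_iff.2 hAw
    rw [hAw, zero_add, hPw] at hw
    exact hinj w hAw hw
  obtain ⟨w, hw⟩ := (LinearMap.injective_iff_surjective_of_finrank_eq_finrank hrank).1 hβinj z
  exact ⟨w, hw.symm⟩

theorem isInvertible_of_injective {V : Type*} [NormedAddCommGroup V] [NormedSpace ℝ V]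
    [FiniteDimensional ℝ E] [FiniteDimensional ℝ V] (f : E →L[ℝ] V)
    (hrank : Module.finrank ℝ E = Module.finrank ℝ V) (hf : ∀ z, f z = 0 → z = 0) :
    f.IsInvertible := by
  have hinj : Function.Injective (f : E →ₗ[ℝ] V) := (injective_iff_map_eq_zero _).2 hf
  exact ⟨(LinearEquiv.ofBijective (f : E →ₗ[ℝ] V) ⟨hinj,
    (LinearMap.injective_iff_surjective_of_finrank_eq_finrank hrank).1 hinj⟩
    ).toContinuousLinearEquiv, rfl⟩

theorem eventually_isInvertible {V X : Type*} [NormedAddCommGroup V] [NormedSpace ℝ V]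
    [CompleteSpace E] {l : Filter X} {f : X → E →L[ℝ] V} {f₀ : E →L[ℝ] V}
    (hf₀ : f₀.IsInvertible) (hf : Tendsto f l (𝓝 f₀)) : ∀ᶠ x in l, (f x).IsInvertible := by
  obtain ⟨e, rfl⟩ := hf₀
  exact hf e.nhds

/-- The map `z ↦ (w ↦ g(z, b w), g(z, n))` attached to a bilinear form `g`, a linear map `b` and a
vector `n`. -/
def pairing (g : E →L[ℝ] E →L[ℝ] ℝ) (b : W →L[ℝ] E) (n : E) : E →L[ℝ] (W →L[ℝ] ℝ) × ℝ :=
  ((ContinuousLinearMap.compL ℝ W E ℝ).flip b ∘L g).prod (g.flip n)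

theorem contDiffWithinAt_pairing {G : ℝ → E →L[ℝ] E →L[ℝ] ℝ} {B : ℝ → W →L[ℝ] E} {n : ℝ → E}
    {J : Set ℝ} {t : ℝ} (hG : ContDiffWithinAt ℝ ∞ G J t) (hB : ContDiffWithinAt ℝ ∞ B J t)
    (hn : ContDiffWithinAt ℝ ∞ n J t) :
    ContDiffWithinAt ℝ ∞ (fun s ↦ pairing (G s) (B s) (n s)) J t := by
  have hflip : ContDiffWithinAt ℝ ∞ (fun s ↦ (G s).flip) J t :=
    hG.continuousLinearMap_comp (ContinuousLinearMap.flipₗᵢ ℝ E E ℝ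
      ).toLinearIsometry.toContinuousLinearMap
  have hcomp := (hB.continuousLinearMap_comp (ContinuousLinearMap.compL ℝ W E ℝ).flip).clm_comp hG
  exact (hcomp.prodMk (hflip.clm_apply hn)).continuousLinearMap_comp
    (ContinuousLinearMap.prodₗᵢ ℝ).toLinearIsometry.toContinuousLinearMap

theorem isInvertible_pairing [FiniteDimensional ℝ W] [FiniteDimensional ℝ E]
    {g : E →L[ℝ] E →L[ℝ] ℝ} {b : W →L[ℝ] E} {n : E}
    (hrank : Module.finrank ℝ E = Module.finrank ℝ W + 1)
    (hinj : ∀ z, (∀ w, g z (b w) = 0) → g z n = 0 → z = 0) : (pairing g b n).IsInvertible := by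
  have hdual : Module.finrank ℝ (W →L[ℝ] ℝ) = Module.finrank ℝ W :=
    (LinearMap.toContinuousLinearMap (𝕜 := ℝ) (E := W) (F' := ℝ)).finrank_eq.symm.trans
      Subspace.dual_finrank_eq
  have hrank' : Module.finrank ℝ E = Module.finrank ℝ ((W →L[ℝ] ℝ) × ℝ) := by
    rw [Module.finrank_prod, Module.finrank_self, hdual, hrank]
  exact isInvertible_of_injective _ hrank' fun z hz ↦
    hinj z (fun w ↦ congr(($hz).1 w)) congr(($hz).2)

theorem exists_smooth_dual [FiniteDimensional ℝ W] [FiniteDimensional ℝ E] {J : Set ℝ} {t : ℝ}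
    {G : ℝ → E →L[ℝ] E →L[ℝ] ℝ} {B : ℝ → W →L[ℝ] E} {n : ℝ → E}
    (hG : ContDiffWithinAt ℝ ∞ G J t) (hB : ContDiffWithinAt ℝ ∞ B J t)
    (hn : ContDiffWithinAt ℝ ∞ n J t) (hrank : Module.finrank ℝ E = Module.finrank ℝ W + 1)
    (hinj : ∀ z, (∀ w, G t z (B t w) = 0) → G t z (n t) = 0 → z = 0) :
    ∃ y : W → ℝ → E, (∀ u, ContDiffWithinAt ℝ ∞ (y u) J t) ∧ ∀ᶠ s in 𝓝[J] t, ∀ u,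
      (∀ w, G s (y u s) (B s w) = inner ℝ u w) ∧ G s (y u s) (n s) = 0 := by
  have hΦ := contDiffWithinAt_pairing hG hB hn
  have hinv := isInvertible_pairing hrank hinj
  refine ⟨fun u s ↦ (pairing (G s) (B s) (n s)).inverse (innerSL ℝ u, 0), fun u ↦
    (hinv.contDiffAt_map_inverse.comp_contDiffWithinAt t hΦ).clm_apply contDiffWithinAt_const, ?_⟩
  filter_upwards [eventually_isInvertible hinv hΦ.continuousWithinAt] with s hs u
  have hsol := hs.self_apply_inverse (innerSL ℝ u, 0)
  exact ⟨fun w ↦ congr(($hsol).1 w), congr(($hsol).2)⟩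

end LinearFamilies

section Lagrange

variable {E : Type*} [NormedAddCommGroup E] [NormedSpace ℝ E]
  {M : Type*} [TopologicalSpace M] [ChartedSpace E M]
  [RiemannianBundle (fun x : M ↦ TangentSpace 𝓘(ℝ, E) x)]
  {c : ℝ → M} {J : Set ℝ} {t₀ t : ℝ}

theorem mem_normalSpace_iff {x : TangentSpace 𝓘(ℝ, E) (c t)} :
    x ∈ normalSpace E c J t ↔ inner ℝ x (velocity c J t) = 0 := by
  rw [real_inner_comm]
  exact Submodule.mem_orthogonal_singleton_iff_inner_right

theorem inner_velocity_of_mem (x : normalSpace E c J t) :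
    inner ℝ (x : TangentSpace 𝓘(ℝ, E) (c t)) (velocity c J t) = 0 :=
  mem_normalSpace_iff.1 x.2

variable [IsManifold 𝓘(ℝ, E) ∞ M] {A : ∀ t, normalSpace E c J t₀ →ₗ[ℝ] normalSpace E c J t}

theorem IsUnitGeodesicOn.sec_velocity (hc : IsUnitGeodesicOn (E := E) c J) (ht : t ∈ J)
    {x : TangentSpace 𝓘(ℝ, E) (c t)} (hx : inner ℝ x (velocity c J t) = 0) :
    sec (E := E) (c t) (velocity c J t) x = inner ℝ (tidal c J t x) x / ‖x‖ ^ 2 := by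
  rw [sec, hc.unit_speed t ht, real_inner_comm x (velocity c J t), hx, tidal, one_pow, one_mul,
    zero_pow two_ne_zero, sub_zero]

theorem IsLagrangeTensor.smoothAt (hA : IsLagrangeTensor A) (w : normalSpace E c J t₀)
    (ht : t ∈ J) : SmoothAt c J (fun s ↦ (A s w : TangentSpace 𝓘(ℝ, E) (c s))) t :=
  (hA.jacobi w).smooth t ht

theorem IsLagrangeTensor.covDeriv_tensorDeriv (hA : IsLagrangeTensor A) (w : normalSpace E c J t₀)
    (ht : t ∈ J) :
    covDeriv c J (fun s ↦ tensorDeriv A s w) t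
      = - tidal c J t (A t w : TangentSpace 𝓘(ℝ, E) (c t)) :=
  eq_neg_of_add_eq_zero_left ((hA.jacobi w).jacobi t ht)

variable [FiniteDimensional ℝ E]

theorem finrank_normalSpace (hc : IsUnitGeodesicOn (E := E) c J) (ht : t ∈ J) :
    Module.finrank ℝ E = Module.finrank ℝ (normalSpace E c J t) + 1 := by
  have hne : velocity (E := E) c J t ≠ 0 := by
    rw [← norm_ne_zero_iff, hc.unit_speed t ht]
    exact one_ne_zero
  have hsum := Submodule.finrank_add_finrank_orthogonal (ℝ ∙ velocity (E := E) c J t)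
  rw [finrank_span_singleton hne, add_comm] at hsum
  exact hsum.symm

theorem finrank_normalSpace_eq (hc : IsUnitGeodesicOn (E := E) c J) (ht₀ : t₀ ∈ J) (ht : t ∈ J) :
    Module.finrank ℝ (normalSpace E c J t₀) = Module.finrank ℝ (normalSpace E c J t) :=
  Nat.succ_injective ((finrank_normalSpace hc ht₀).symm.trans (finrank_normalSpace hc ht))

variable [IsContMDiffRiemannianBundle 𝓘(ℝ, E) ∞ E (fun x : M ↦ TangentSpace 𝓘(ℝ, E) x)]

theorem IsLagrangeTensor.smoothAt_tensorDeriv (hJ : UniqueDiffOn ℝ J)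
    (hc : IsUnitGeodesicOn (E := E) c J) (hA : IsLagrangeTensor A) (w : normalSpace E c J t₀)
    (ht : t ∈ J) : SmoothAt c J (fun s ↦ tensorDeriv A s w) t :=
  (hA.smoothAt w ht).covDeriv hJ hc.smooth ht

/-- The covariant derivative `A'_t` of a Lagrange tensor, as a linear map. -/
def tensorDerivLinear (hc : IsUnitGeodesicOn (E := E) c J) (hA : IsLagrangeTensor A) (ht : t ∈ J) :
    normalSpace E c J t₀ →ₗ[ℝ] TangentSpace 𝓘(ℝ, E) (c t) where
  toFun := tensorDeriv A t
  map_add' x y := by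
    simp only [tensorDeriv, map_add, Submodule.coe_add]
    exact covDeriv_add hc.smooth ht (hA.smoothAt x ht) (hA.smoothAt y ht)
  map_smul' r x := by
    simp only [tensorDeriv, map_smul, Submodule.coe_smul]
    exact covDeriv_const_smul hc.smooth ht r (hA.smoothAt x ht)

theorem IsLagrangeTensor.inner_tensorDeriv_velocity (hJ : UniqueDiffOn ℝ J)
    (hc : IsUnitGeodesicOn (E := E) c J) (hA : IsLagrangeTensor A) (w : normalSpace E c J t₀)
    (ht : t ∈ J) : inner ℝ (tensorDeriv A t w) (velocity c J t) = 0 := by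
  have hderiv := eq_zero_of_eventuallyEq_const (a := 0) (hJ t ht) ht
    ((hA.smoothAt w ht).hasDerivWithinAt_inner hc.smooth ht (smoothAt_velocity hJ hc.smooth ht))
    (Eventually.of_forall fun s ↦ inner_velocity_of_mem (A s w))
  rwa [hc.geodesic t ht, inner_zero_right, add_zero] at hderiv

theorem IsLagrangeTensor.inner_tensorDeriv_comm (hJ : J.OrdConnected) (hJ' : J.Nontrivial)
    (hc : IsUnitGeodesicOn (E := E) c J) (hA : IsLagrangeTensor A) (x y : normalSpace E c J t₀)
    (ht : t ∈ J) :
    inner ℝ (tensorDeriv A t x) (A t y : TangentSpace 𝓘(ℝ, E) (c t))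
      = inner ℝ (A t x : TangentSpace 𝓘(ℝ, E) (c t)) (tensorDeriv A t y) := by
  have hu := uniqueDiffOn_of_ordConnected hJ hJ'
  let W : ℝ → ℝ := fun s ↦ inner ℝ (tensorDeriv A s x) (A s y : TangentSpace 𝓘(ℝ, E) (c s))
    - inner ℝ (A s x : TangentSpace 𝓘(ℝ, E) (c s)) (tensorDeriv A s y)
  have hW : ∀ s ∈ J, HasDerivWithinAt W 0 J s := fun s hs ↦ by
    have hleft := (hA.smoothAt_tensorDeriv hu hc x hs).hasDerivWithinAt_inner hc.smooth hs
      (hA.smoothAt y hs)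
    have hright := (hA.smoothAt x hs).hasDerivWithinAt_inner hc.smooth hs
      (hA.smoothAt_tensorDeriv hu hc y hs)
    refine (hleft.sub hright).congr_deriv ?_
    rw [hA.covDeriv_tensorDeriv x hs, hA.covDeriv_tensorDeriv y hs, inner_neg_left, inner_neg_right,
      inner_tidal_comm, real_inner_comm _ (tidal c J s _)]
    simp only [tensorDeriv]
    ring
  obtain ⟨r, hr, hreg⟩ := hA.exists_regular
  have hWr : W r = 0 := by
    have hsymm := hA.symmetric r hr hreg (A r x) (A r y)
    simp only [riccati, Function.leftInverse_invFun hreg.1 x,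
      Function.leftInverse_invFun hreg.1 y] at hsymm
    exact sub_eq_zero.2 hsymm
  exact sub_eq_zero.1 (eq_zero_of_norm_deriv_le hJ hW (C := 0) (by simp) hr hWr t ht)

theorem IsLagrangeTensor.eq_zero (hJ : J.OrdConnected) (hJ' : J.Nontrivial)
    (hc : IsUnitGeodesicOn (E := E) c J) (hA : IsLagrangeTensor A) {w : normalSpace E c J t₀}
    (ht : t ∈ J) (h0 : A t w = 0) (h1 : tensorDeriv A t w = 0) : w = 0 := by
  by_contra hne
  obtain ⟨s, hs, hsw⟩ := hA.nondegenerate w hne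
  exact hsw (Subtype.ext
    ((hA.jacobi w).eq_zero hJ hJ' hc.smooth ht (congrArg Subtype.val h0) h1 hs))

theorem IsLagrangeTensor.exists_eq_add (hJ : J.OrdConnected) (hJ' : J.Nontrivial)
    (hc : IsUnitGeodesicOn (E := E) c J) (hA : IsLagrangeTensor A) (ht₀ : t₀ ∈ J) (ht : t ∈ J)
    {z : TangentSpace 𝓘(ℝ, E) (c t)} (hz : inner ℝ z (velocity c J t) = 0) :
    ∃ w, z = (A t w : TangentSpace 𝓘(ℝ, E) (c t))
      + tensorDeriv A t ((LinearMap.ker (A t)).starProjection w) := by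
  have hu := uniqueDiffOn_of_ordConnected hJ hJ'
  let D : normalSpace E c J t₀ →ₗ[ℝ] normalSpace E c J t :=
    (tensorDerivLinear hc hA ht).codRestrict _ fun w ↦
      mem_normalSpace_iff.2 (hA.inner_tensorDeriv_velocity hu hc w ht)
  obtain ⟨w, hw⟩ := exists_eq_add_starProjection (A t) D
    (finrank_normalSpace_eq hc ht₀ ht)
    (fun x y ↦ hA.inner_tensorDeriv_comm hJ hJ' hc x y ht)
    (fun w h0 h1 ↦ hA.eq_zero hJ hJ' hc ht h0 (congrArg Subtype.val h1))
    ⟨z, mem_normalSpace_iff.2 hz⟩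
  exact ⟨w, congrArg Subtype.val hw⟩

theorem IsLagrangeTensor.inner_apply_tensorDeriv_eq_zero (hJ : J.OrdConnected) (hJ' : J.Nontrivial)
    (hc : IsUnitGeodesicOn (E := E) c J) (hA : IsLagrangeTensor A) (ht : t ∈ J)
    (w : normalSpace E c J t₀) {k : normalSpace E c J t₀} (hk : k ∈ LinearMap.ker (A t)) :
    inner ℝ (A t w : TangentSpace 𝓘(ℝ, E) (c t)) (tensorDeriv A t k) = 0 := by
  rw [← hA.inner_tensorDeriv_comm hJ hJ' hc w k ht, LinearMap.mem_ker.1 hk, Submodule.coe_zero,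
    inner_zero_right]

theorem IsLagrangeTensor.exists_apply_eq_of_inner_tensorDeriv (hJ : J.OrdConnected)
    (hJ' : J.Nontrivial) (hc : IsUnitGeodesicOn (E := E) c J) (hA : IsLagrangeTensor A)
    (ht₀ : t₀ ∈ J) (ht : t ∈ J) {z : TangentSpace 𝓘(ℝ, E) (c t)}
    (hz : inner ℝ z (velocity c J t) = 0)
    (hker : ∀ k ∈ LinearMap.ker (A t), inner ℝ z (tensorDeriv A t k) = 0) :
    ∃ w, (A t w : TangentSpace 𝓘(ℝ, E) (c t)) = z := by
  obtain ⟨w, hw⟩ := hA.exists_eq_add hJ hJ' hc ht₀ ht hz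
  have hmem := Submodule.starProjection_apply_mem (LinearMap.ker (A t)) w
  have hself := hker _ hmem
  rw [hw, inner_add_left, hA.inner_apply_tensorDeriv_eq_zero hJ hJ' hc ht w hmem, zero_add,
    inner_self_eq_zero] at hself
  exact ⟨w, by rw [hw, hself, add_zero]⟩

theorem IsLagrangeTensor.exists_tensorDeriv_eq_of_inner_apply (hJ : J.OrdConnected)
    (hJ' : J.Nontrivial) (hc : IsUnitGeodesicOn (E := E) c J) (hA : IsLagrangeTensor A)
    (ht₀ : t₀ ∈ J) (ht : t ∈ J) {z : TangentSpace 𝓘(ℝ, E) (c t)}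
    (hz : inner ℝ z (velocity c J t) = 0)
    (hrange : ∀ w, inner ℝ z (A t w : TangentSpace 𝓘(ℝ, E) (c t)) = 0) :
    ∃ k ∈ LinearMap.ker (A t), tensorDeriv A t k = z := by
  obtain ⟨w, hw⟩ := hA.exists_eq_add hJ hJ' hc ht₀ ht hz
  have hmem := Submodule.starProjection_apply_mem (LinearMap.ker (A t)) w
  have hself := hrange w
  rw [hw, inner_add_left, real_inner_comm _ (tensorDeriv A t _),
    hA.inner_apply_tensorDeriv_eq_zero hJ hJ' hc ht w hmem, add_zero, inner_self_eq_zero] at hself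
  exact ⟨_, hmem, by rw [hw, hself, zero_add]⟩

end Lagrange

section DualFields

variable {E : Type*} [NormedAddCommGroup E] [NormedSpace ℝ E] [FiniteDimensional ℝ E]
  {M : Type*} [TopologicalSpace M] [ChartedSpace E M] [IsManifold 𝓘(ℝ, E) ∞ M]
  [RiemannianBundle (fun x : M ↦ TangentSpace 𝓘(ℝ, E) x)]
  {c : ℝ → M} {J : Set ℝ} {t₀ t : ℝ}
  {A : ∀ t, normalSpace E c J t₀ →ₗ[ℝ] normalSpace E c J t}

/-- The family `A` in the coordinates of the chart at `x₀`. -/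
def coordFamily (A : ∀ t, normalSpace E c J t₀ →ₗ[ℝ] normalSpace E c J t) (x₀ : M) (s : ℝ) :
    normalSpace E c J t₀ →L[ℝ] E :=
  LinearMap.toContinuousLinearMap
    { toFun := fun w ↦ toCoord x₀ (c s) (A s w)
      map_add' := fun x y ↦ by
        rw [map_add, Submodule.coe_add, toCoord_add]
      map_smul' := fun r x ↦ by
        rw [map_smul, Submodule.coe_smul, toCoord_smul]
        rfl }

theorem coordFamily_apply (x₀ : M) (s : ℝ) (w : normalSpace E c J t₀) :
    coordFamily A x₀ s w = toCoord x₀ (c s) (A s w : TangentSpace 𝓘(ℝ, E) (c s)) := rfl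

theorem IsLagrangeTensor.contDiffWithinAt_coordFamily (hc : IsUnitGeodesicOn (E := E) c J)
    (hA : IsLagrangeTensor A) (ht : t ∈ J) :
    ContDiffWithinAt ℝ ∞ (coordFamily A (c t)) J t :=
  contDiffWithinAt_of_forall_clm_apply fun w ↦
    (smoothAt_iff ht (hc.smooth t ht) (mem_chart_source E (c t))).1 (hA.smoothAt w ht)

variable [IsContMDiffRiemannianBundle 𝓘(ℝ, E) ∞ E (fun x : M ↦ TangentSpace 𝓘(ℝ, E) x)]

theorem IsLagrangeTensor.derivWithin_coordFamily_apply (hJ : UniqueDiffOn ℝ J)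
    (hc : IsUnitGeodesicOn (E := E) c J) (hA : IsLagrangeTensor A) (ht : t ∈ J)
    {w : normalSpace E c J t₀} (hw : A t w = 0) :
    derivWithin (coordFamily A (c t)) J t w = toCoord (c t) (c t) (tensorDeriv A t w) := by
  have hpp := mem_chart_source E (c t)
  have hderiv := ((((hA.contDiffWithinAt_coordFamily hc ht).differentiableWithinAt
    (by simp)).hasDerivWithinAt).clm_apply (hasDerivWithinAt_const t J w)).derivWithin (hJ t ht)
  rw [map_zero, add_zero] at hderiv
  have hcov := toCoord_covDeriv ht (hJ t ht) (hc.smooth t ht) hpp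
    ((hA.smoothAt w ht).differentiableWithinAt_toCoord hc.smooth ht hpp)
  rw [hw, Submodule.coe_zero, toCoord_zero, map_zero, add_zero] at hcov
  exact hderiv.symm.trans hcov.symm

theorem IsLagrangeTensor.exists_factorization (hJ : J.OrdConnected) (hJ' : J.Nontrivial)
    (hc : IsUnitGeodesicOn (E := E) c J) (hA : IsLagrangeTensor A) (ht : t ∈ J) :
    ∃ B : ℝ → normalSpace E c J t₀ →L[ℝ] E, ContDiffWithinAt ℝ ∞ B J t ∧
      (∀ s w, B s (stretch (LinearMap.ker (A t)) (s - t) w)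
        = toCoord (c t) (c s) (A s w : TangentSpace 𝓘(ℝ, E) (c s))) ∧
      ∀ w, B t w = toCoord (c t) (c t) ((A t w : TangentSpace 𝓘(ℝ, E) (c t))
        + tensorDeriv A t ((LinearMap.ker (A t)).starProjection w)) := by
  have hker : ∀ k ∈ LinearMap.ker (A t), coordFamily A (c t) t k = 0 :=
      fun k hk ↦ by
    rw [coordFamily_apply, LinearMap.mem_ker.1 hk, Submodule.coe_zero, toCoord_zero]
  obtain ⟨B, hB, hBs, hBt⟩ := exists_factorization_stretch (W := normalSpace E c J t₀) hJ hJ' ht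
    (hA.contDiffWithinAt_coordFamily hc ht) hker
  refine ⟨B, hB, hBs, fun w ↦ ?_⟩
  rw [hBt, toCoord_add, hA.derivWithin_coordFamily_apply (uniqueDiffOn_of_ordConnected hJ hJ') hc
    ht (Submodule.starProjection_apply_mem (LinearMap.ker (A t)) w)]
  rfl

-- With `A_s = B_s ∘ stretch (ker A_t) (s - t)`, the field `Y u` solves `B_s^* (Y u) = u`.
theorem IsLagrangeTensor.exists_dual_fields (hJ : J.OrdConnected) (hJ' : J.Nontrivial)
    (hc : IsUnitGeodesicOn (E := E) c J) (hA : IsLagrangeTensor A) (ht₀ : t₀ ∈ J) (ht : t ∈ J) :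
    ∃ Y : normalSpace E c J t₀ → ∀ s, TangentSpace 𝓘(ℝ, E) (c s),
      (∀ u, SmoothAt c J (Y u) t) ∧
      (∀ᶠ s in 𝓝[J] t, ∀ u, inner ℝ (Y u s) (velocity c J s) = 0 ∧
        ∀ w, inner ℝ (Y u s) (A s w : TangentSpace 𝓘(ℝ, E) (c s))
          = inner ℝ u (stretch (LinearMap.ker (A t)) (s - t) w)) ∧
      ∀ u, ∀ k ∈ LinearMap.ker (A t), inner ℝ (Y u t) (tensorDeriv A t k) = inner ℝ u k := by
  have hpp := mem_chart_source E (c t)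
  obtain ⟨B, hB, hBs, hBt⟩ := hA.exists_factorization hJ hJ' hc ht
  have hvel : ContDiffWithinAt ℝ ∞ (fun s ↦ toCoord (c t) (c s) (velocity (E := E) c J s)) J t :=
    (smoothAt_iff ht (hc.smooth t ht) hpp).1
      (smoothAt_velocity (uniqueDiffOn_of_ordConnected hJ hJ') hc.smooth ht)
  have hinj : ∀ z, (∀ w, chartMetric (c t) (extChartAt 𝓘(ℝ, E) (c t) (c t)) z (B t w) = 0) →
      chartMetric (c t) (extChartAt 𝓘(ℝ, E) (c t) (c t)) z
        (toCoord (c t) (c t) (velocity c J t)) = 0 → z = 0 := by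
    intro z horth hvel
    rw [← toCoord_ofCoord hpp z] at horth hvel ⊢
    rw [← inner_eq_chartMetric hpp] at hvel
    obtain ⟨w, hw⟩ := hA.exists_eq_add hJ hJ' hc ht₀ ht hvel
    have hself := horth w
    rw [hBt, ← inner_eq_chartMetric hpp, ← hw, inner_self_eq_zero] at hself
    rw [hself, toCoord_zero]
  obtain ⟨y, hy, hdual⟩ := exists_smooth_dual
    (contDiffWithinAt_chartMetric (hc.smooth t ht) hpp) hB hvel (finrank_normalSpace hc ht₀) hinj
  refine ⟨fun u s ↦ ofCoord (c t) (c s) (y u s),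
    fun u ↦ smoothAt_ofCoord ht (hc.smooth t ht) hpp (hy u), ?_, fun u k hk ↦ ?_⟩
  · filter_upwards [hdual, eventually_mem_chart (hc.smooth t ht).continuousWithinAt hpp]
      with s hs hmem u
    simp only [inner_eq_chartMetric hmem, toCoord_ofCoord hmem, ← hBs]
    exact ⟨(hs u).2, fun w ↦ (hs u).1 _⟩
  · have hpair := ((hdual.self_of_nhdsWithin ht) u).1 k
    rw [hBt, Submodule.starProjection_eq_self_iff.2 hk, LinearMap.mem_ker.1 hk, Submodule.coe_zero,
      zero_add] at hpair
    rwa [inner_eq_chartMetric hpp, toCoord_ofCoord hpp]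

end DualFields

section LocalStructure

variable {E : Type*} [NormedAddCommGroup E] [NormedSpace ℝ E]
  {M : Type*} [TopologicalSpace M] [ChartedSpace E M]
  [RiemannianBundle (fun x : M ↦ TangentSpace 𝓘(ℝ, E) x)]
  {c : ℝ → M} {J : Set ℝ} {t₀ t : ℝ}
  {A : ∀ t, normalSpace E c J t₀ →ₗ[ℝ] normalSpace E c J t} {v : normalSpace E c J t₀}

theorem IsRegularPt.mem_ker_orthogonal (h : IsRegularPt A t) (v : normalSpace E c J t₀) :
    v ∈ (LinearMap.ker (A t))ᗮ := by
  rw [LinearMap.ker_eq_bot.2 h.1, Submodule.bot_orthogonal_eq_top]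
  exact Submodule.mem_top

section FiniteDimensional

variable [FiniteDimensional ℝ E]

theorem IsRegularPt.virtualField_eq (h : IsRegularPt A t) {z : TangentSpace 𝓘(ℝ, E) (c t)}
    (hz : inner ℝ z (velocity c J t) = 0)
    (hzv : ∀ w, inner ℝ z (A t w : TangentSpace 𝓘(ℝ, E) (c t)) = inner ℝ v w) :
    (virtualField A v t : TangentSpace 𝓘(ℝ, E) (c t)) = z := by
  have hadj : LinearMap.adjoint (A t) ⟨z, mem_normalSpace_iff.2 hz⟩ = v :=
    ext_inner_right ℝ fun w ↦ (LinearMap.adjoint_inner_left (A t) _ _).trans (hzv w)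
  have hinj : Function.Injective (LinearMap.adjoint (A t)) := by
    rw [← LinearMap.ker_eq_bot, ← LinearMap.orthogonal_range, LinearMap.range_eq_top.2 h.2,
      Submodule.top_orthogonal_eq_bot]
  rw [virtualField, ← hadj, Function.leftInverse_invFun hinj]

theorem IsRegularPt.norm_virtualField_eq {z : TangentSpace 𝓘(ℝ, E) (c t)} {r : ℝ}
    (h : IsRegularPt A t) (hr : r ≠ 0) (hz : inner ℝ z (velocity c J t) = 0)
    (hzv : ∀ w, inner ℝ z (A t w : TangentSpace 𝓘(ℝ, E) (c t)) = r * inner ℝ v w) :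
    ‖virtualField A v t‖ = |r|⁻¹ * ‖z‖ := by
  have hfield : (virtualField A v t : TangentSpace 𝓘(ℝ, E) (c t)) = r⁻¹ • z := by
    refine h.virtualField_eq ?_ fun w ↦ ?_
    · rw [real_inner_smul_left, hz, mul_zero]
    · rw [real_inner_smul_left, hzv w, inv_mul_cancel_left₀ hr]
  change ‖(virtualField A v t : TangentSpace 𝓘(ℝ, E) (c t))‖ = _
  rw [hfield, norm_smul, norm_inv, Real.norm_eq_abs]

end FiniteDimensional

variable [IsManifold 𝓘(ℝ, E) ∞ M]

/-- `Y` is smooth at `t` and coincides near `t` with `(A^*)⁻¹ v`, also at a singular point `t`, in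
which case `Y t` is normalized to be orthogonal to `A'_t (ker A_t)`, the complement of the image of
`A_t`. -/
structure IsDualFieldAt (A : ∀ t, normalSpace E c J t₀ →ₗ[ℝ] normalSpace E c J t)
    (v : normalSpace E c J t₀) (t : ℝ) (Y : ∀ s, TangentSpace 𝓘(ℝ, E) (c s)) : Prop where
  smooth : SmoothAt c J Y t
  dual : ∀ᶠ s in 𝓝[J] t, inner ℝ (Y s) (velocity c J s) = 0 ∧
    ∀ w, inner ℝ (Y s) (A s w : TangentSpace 𝓘(ℝ, E) (c s)) = inner ℝ v w
  inner_ker : ∀ k ∈ LinearMap.ker (A t), inner ℝ (Y t) (tensorDeriv A t k) = 0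

section DualField

variable {Y : ∀ s, TangentSpace 𝓘(ℝ, E) (c s)}

theorem IsDualFieldAt.congr (hY : IsDualFieldAt A v t Y) (ht : t ∈ J)
    {X : ∀ s, TangentSpace 𝓘(ℝ, E) (c s)} (h : ∀ᶠ s in 𝓝[J] t, X s = Y s) :
    IsDualFieldAt A v t X where
  smooth := hY.smooth.congr ht h
  dual := by
    filter_upwards [hY.dual, h] with s hs hXs
    rwa [hXs]
  inner_ker := by
    rw [h.self_of_nhdsWithin ht]
    exact hY.inner_ker

theorem IsDualFieldAt.inner_velocity (hY : IsDualFieldAt A v t Y) (ht : t ∈ J) :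
    inner ℝ (Y t) (velocity c J t) = 0 :=
  (hY.dual.self_of_nhdsWithin ht).1

theorem IsDualFieldAt.inner_apply (hY : IsDualFieldAt A v t Y) (ht : t ∈ J)
    (w : normalSpace E c J t₀) :
    inner ℝ (Y t) (A t w : TangentSpace 𝓘(ℝ, E) (c t)) = inner ℝ v w :=
  (hY.dual.self_of_nhdsWithin ht).2 w

theorem IsDualFieldAt.ne_zero (hY : IsDualFieldAt A v t Y) (ht : t ∈ J) (hv : v ≠ 0) :
    Y t ≠ 0 := fun hzero ↦ by
  have hself := hY.inner_apply ht v
  rw [hzero, inner_zero_left] at hself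
  exact hv (inner_self_eq_zero.1 hself.symm)

variable [FiniteDimensional ℝ E]

theorem IsDualFieldAt.virtualField_eq (hY : IsDualFieldAt A v t Y) (ht : t ∈ J)
    (hreg : IsRegularPt A t) : (virtualField A v t : TangentSpace 𝓘(ℝ, E) (c t)) = Y t :=
  hreg.virtualField_eq (hY.inner_velocity ht) (hY.inner_apply ht)

end DualField

variable [FiniteDimensional ℝ E]

theorem isRegularPt_of_injective (hc : IsUnitGeodesicOn (E := E) c J) (ht₀ : t₀ ∈ J) (ht : t ∈ J)
    (h : ∀ w, A t w = 0 → w = 0) : IsRegularPt A t := by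
  have hinj : Function.Injective (A t) := (injective_iff_map_eq_zero (A t)).2 h
  exact ⟨hinj, (LinearMap.injective_iff_surjective_of_finrank_eq_finrank
    (finrank_normalSpace_eq hc ht₀ ht)).1 hinj⟩

variable [IsContMDiffRiemannianBundle 𝓘(ℝ, E) ∞ E (fun x : M ↦ TangentSpace 𝓘(ℝ, E) x)]

theorem IsLagrangeTensor.eventually_isRegularPt (hJ : J.OrdConnected) (hJ' : J.Nontrivial)
    (hc : IsUnitGeodesicOn (E := E) c J) (hA : IsLagrangeTensor A) (ht₀ : t₀ ∈ J) (ht : t ∈ J) :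
    ∀ᶠ s in 𝓝[J \ {t}] t, IsRegularPt A s := by
  obtain ⟨Y, -, hY, -⟩ := hA.exists_dual_fields hJ hJ' hc ht₀ ht
  filter_upwards [nhdsWithin_mono t sdiff_subset hY, self_mem_nhdsWithin] with s hs hsJ
  refine isRegularPt_of_injective hc ht₀ hsJ.1 fun w hw ↦
    eq_zero_of_stretch_eq_zero (K := LinearMap.ker (A t)) (sub_ne_zero.2 hsJ.2)
      (ext_inner_left ℝ fun u ↦ ?_)
  rw [← (hs u).2 w, hw, Submodule.coe_zero, inner_zero_right, inner_zero_right]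

theorem IsLagrangeTensor.eventually_isRegularPt_of_ne (hJ : J.OrdConnected) (hJ' : J.Nontrivial)
    (hc : IsUnitGeodesicOn (E := E) c J) (hA : IsLagrangeTensor A) (ht₀ : t₀ ∈ J) (ht : t ∈ J) :
    ∀ᶠ s in 𝓝[J] t, s ≠ t → IsRegularPt A s := by
  have hreg := hA.eventually_isRegularPt hJ hJ' hc ht₀ ht
  rwa [sdiff_eq, nhdsWithin_inter', eventually_inf_principal] at hreg

theorem IsLagrangeTensor.neBot_regular (hJ : J.OrdConnected) (hJ' : J.Nontrivial)
    (hc : IsUnitGeodesicOn (E := E) c J) (hA : IsLagrangeTensor A) (ht₀ : t₀ ∈ J) (ht : t ∈ J) :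
    NeBot (𝓝[{s | s ∈ J ∧ IsRegularPt A s}] t) := by
  have hne : NeBot (𝓝[J \ {t}] t) := accPt_principal_iff_nhdsWithin.1
    (uniqueDiffWithinAt_iff_accPt.1 (uniqueDiffOn_of_ordConnected hJ hJ' t ht))
  refine hne.mono (le_inf inf_le_left (le_principal_iff.2 ?_))
  filter_upwards [hA.eventually_isRegularPt hJ hJ' hc ht₀ ht, self_mem_nhdsWithin] with s hs hsJ
    using ⟨hsJ.1, hs⟩

theorem IsLagrangeTensor.virtualLength_eventuallyEq (hJ : J.OrdConnected) (hJ' : J.Nontrivial)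
    (hc : IsUnitGeodesicOn (E := E) c J) (hA : IsLagrangeTensor A) (ht₀ : t₀ ∈ J) (ht : t ∈ J)
    {h : ℝ → ℝ} (hcont : ContinuousWithinAt h J t)
    (heq : ∀ᶠ s in 𝓝[J] t, IsRegularPt A s → ‖v‖ ^ 2 / ‖virtualField A v s‖ = h s) :
    virtualLength A v =ᶠ[𝓝[J] t] h := by
  filter_upwards [heq, hA.eventually_isRegularPt_of_ne hJ hJ' hc ht₀ ht] with s hs hne
  by_cases hreg : IsRegularPt A s
  · rw [virtualLength, if_pos hreg, hs hreg]
  · obtain rfl : s = t := not_not.1 fun hst ↦ hreg (hne hst)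
    rw [virtualLength, if_neg hreg]
    have hbot := hA.neBot_regular hJ hJ' hc ht₀ ht
    have hle : 𝓝[{r | r ∈ J ∧ IsRegularPt A r}] s ≤ 𝓝[J] s := nhdsWithin_mono s fun r hr ↦ hr.1
    refine Tendsto.limUnder_eq (Tendsto.congr' ?_ (hcont.mono_left hle))
    filter_upwards [hle heq, self_mem_nhdsWithin] with r hr hreg
    exact (hr hreg.2).symm

theorem IsLagrangeTensor.exists_isDualFieldAt (hJ : J.OrdConnected) (hJ' : J.Nontrivial)
    (hc : IsUnitGeodesicOn (E := E) c J) (hA : IsLagrangeTensor A) (ht₀ : t₀ ∈ J) (ht : t ∈ J)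
    (hv : v ∈ (LinearMap.ker (A t))ᗮ) : ∃ Y, IsDualFieldAt A v t Y := by
  obtain ⟨Y, hsmooth, hdual, hker⟩ := hA.exists_dual_fields hJ hJ' hc ht₀ ht
  refine ⟨Y v, hsmooth v, ?_, fun k hk ↦
    (hker v k hk).trans (Submodule.inner_left_of_mem_orthogonal hk hv)⟩
  filter_upwards [hdual] with s hs
  refine ⟨(hs v).1, fun w ↦ ?_⟩
  rw [(hs v).2 w, inner_stretch_comm, stretch_of_mem_orthogonal _ hv]

theorem IsLagrangeTensor.exists_forall_isDualFieldAt (hJ : J.OrdConnected) (hJ' : J.Nontrivial)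
    (hc : IsUnitGeodesicOn (E := E) c J) (hA : IsLagrangeTensor A) (ht₀ : t₀ ∈ J)
    (hv : ∀ t ∈ J, v ∈ (LinearMap.ker (A t))ᗮ) : ∃ Y, ∀ t ∈ J, IsDualFieldAt A v t Y := by
  choose! Y hY using fun t ht ↦ hA.exists_isDualFieldAt hJ hJ' hc ht₀ ht (hv t ht)
  refine ⟨fun t ↦ Y t t, fun t ht ↦ (hY t ht).congr ht ?_⟩
  filter_upwards [hA.eventually_isRegularPt_of_ne hJ hJ' hc ht₀ ht, (hY t ht).dual,
    self_mem_nhdsWithin] with s hreg hdual hs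
  rcases eq_or_ne s t with rfl | hst
  · rfl
  · rw [← (hY s hs).virtualField_eq hs (hreg hst), (hreg hst).virtualField_eq hdual.1 hdual.2]

theorem IsLagrangeTensor.exists_field_of_notMem (hJ : J.OrdConnected) (hJ' : J.Nontrivial)
    (hc : IsUnitGeodesicOn (E := E) c J) (hA : IsLagrangeTensor A) (ht₀ : t₀ ∈ J) (ht : t ∈ J)
    (hv : v ∉ (LinearMap.ker (A t))ᗮ) :
    ∃ Y : ∀ s, TangentSpace 𝓘(ℝ, E) (c s), SmoothAt c J Y t ∧ Y t ≠ 0 ∧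
      ∀ᶠ s in 𝓝[J] t, inner ℝ (Y s) (velocity c J s) = 0 ∧
        ∀ w, inner ℝ (Y s) (A s w : TangentSpace 𝓘(ℝ, E) (c s)) = (s - t) * inner ℝ v w := by
  obtain ⟨Y, hsmooth, hdual, hker⟩ := hA.exists_dual_fields hJ hJ' hc ht₀ ht
  obtain ⟨p, hp, q, hq, rfl⟩ := (LinearMap.ker (A t)).exists_add_mem_mem_orthogonal v
  refine ⟨fun s ↦ (s - t) • Y q s + Y p s, ?_, fun hzero ↦ ?_, ?_⟩
  · exact .add hc.smooth ht (.smul hc.smooth ht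
      (contDiff_id.sub contDiff_const).contDiffWithinAt (hsmooth q)) (hsmooth p)
  · beta_reduce at hzero
    rw [sub_self, zero_smul, zero_add] at hzero
    have hp0 := hker p p hp
    rw [hzero, inner_zero_left] at hp0
    rw [inner_self_eq_zero.1 hp0.symm, zero_add] at hv
    exact hv hq
  · filter_upwards [hdual] with s hs
    refine ⟨?_, fun w ↦ ?_⟩
    · rw [inner_add_left, real_inner_smul_left, (hs q).1, (hs p).1, mul_zero, add_zero]
    · rw [inner_add_left, real_inner_smul_left, (hs q).2, (hs p).2, inner_stretch_comm,
        inner_stretch_comm, stretch_of_mem_orthogonal _ hq, stretch_of_mem _ hp,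
        real_inner_smul_left, inner_add_left]
      ring

theorem IsDualFieldAt.virtualLength_eventuallyEq {Y : ∀ s, TangentSpace 𝓘(ℝ, E) (c s)}
    (hJ : J.OrdConnected) (hJ' : J.Nontrivial) (hc : IsUnitGeodesicOn (E := E) c J)
    (hA : IsLagrangeTensor A) (hY : IsDualFieldAt A v t Y) (ht₀ : t₀ ∈ J) (ht : t ∈ J)
    (hv : v ≠ 0) : virtualLength A v =ᶠ[𝓝[J] t] fun s ↦ ‖v‖ ^ 2 / ‖Y s‖ := by
  refine hA.virtualLength_eventuallyEq hJ hJ' hc ht₀ ht (continuousWithinAt_const.div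
    hY.smooth.continuousWithinAt_norm (norm_ne_zero_iff.2 (hY.ne_zero ht hv))) ?_
  filter_upwards [hY.dual] with s hs hreg
  rw [← hreg.virtualField_eq hs.1 hs.2]
  rfl

theorem IsLagrangeTensor.virtualLength_of_notMem (hJ : J.OrdConnected) (hJ' : J.Nontrivial)
    (hc : IsUnitGeodesicOn (E := E) c J) (hA : IsLagrangeTensor A) (ht₀ : t₀ ∈ J) (ht : t ∈ J)
    (hv : v ∉ (LinearMap.ker (A t))ᗮ) :
    ∃ h : ℝ → ℝ, ContinuousWithinAt h J t ∧ 0 < h t ∧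
      virtualLength A v =ᶠ[𝓝[J] t] fun s ↦ |s - t| * h s := by
  obtain ⟨Y, hY, hne, hYv⟩ := hA.exists_field_of_notMem hJ hJ' hc ht₀ ht hv
  have hv0 : v ≠ 0 := fun hzero ↦ hv (hzero ▸ zero_mem _)
  have hcont : ContinuousWithinAt (fun s ↦ ‖v‖ ^ 2 / ‖Y s‖) J t :=
    continuousWithinAt_const.div hY.continuousWithinAt_norm (norm_ne_zero_iff.2 hne)
  refine ⟨fun s ↦ ‖v‖ ^ 2 / ‖Y s‖, hcont,
    div_pos (pow_pos (norm_pos_iff.2 hv0) 2) (norm_pos_iff.2 hne),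
    hA.virtualLength_eventuallyEq hJ hJ' hc ht₀ ht
      ((continuous_id.sub continuous_const).abs.continuousWithinAt.mul hcont) ?_⟩
  filter_upwards [hYv] with s hs hreg
  have hst : s - t ≠ 0 := sub_ne_zero.2 fun heq ↦ hv (heq ▸ hreg.mem_ker_orthogonal v)
  rw [hreg.norm_virtualField_eq hst hs.1 hs.2, div_mul_eq_div_div, div_inv_eq_mul]
  ring

end LocalStructure

section RealFunctions

variable {f : ℝ → ℝ} {a t : ℝ} {J : Set ℝ}

theorem hasDerivWithinAt_div_sqrt {f₁ : ℝ} (hf : HasDerivWithinAt f f₁ J t) (hpos : 0 < f t) :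
    HasDerivWithinAt (fun s ↦ a / √(f s)) (-(a * f₁) / (2 * √(f t) ^ 3)) J t := by
  have hr : 0 < √(f t) := Real.sqrt_pos.2 hpos
  refine ((hasDerivWithinAt_const t J a).fun_div (hf.sqrt hpos.ne') hr.ne').congr_deriv ?_
  field_simp
  ring

theorem hasDerivWithinAt_div_sqrt_pow_three {f₁ : ℝ → ℝ} {f₂ : ℝ}
    (hf : HasDerivWithinAt f (f₁ t) J t) (hf₁ : HasDerivWithinAt f₁ f₂ J t) (hpos : 0 < f t) :
    HasDerivWithinAt (fun s ↦ -(a * f₁ s) / (2 * √(f s) ^ 3))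
      (a / √(f t) * (-(f₂ / (2 * f t)) + 3 * f₁ t ^ 2 / (4 * f t ^ 2))) J t := by
  have hr : 0 < √(f t) := Real.sqrt_pos.2 hpos
  refine ((hf₁.const_mul a).fun_neg.fun_div (((hf.sqrt hpos.ne').fun_pow 3).const_mul 2)
    (by positivity)).congr_deriv ?_
  have hsq : f t = √(f t) ^ 2 := (Real.sq_sqrt hpos.le).symm
  generalize √(f t) = r at *
  rw [hsq]
  field_simp
  ring

-- The zero of `g` at `t` is a local minimum, but the slopes there have absolute value near `h t`.
theorem not_differentiableAt_of_eventuallyEq_abs_mul {g h : ℝ → ℝ} (hh : ContinuousAt h t)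
    (hpos : 0 < h t) (hg : ∀ᶠ s in 𝓝 t, g s = |s - t| * h s) : ¬ DifferentiableAt ℝ g t := by
  intro hd
  have hgt : g t = 0 := by simpa using hg.self_of_nhds
  have hmin : IsLocalMin g t := by
    filter_upwards [hg, hh.eventually (lt_mem_nhds hpos)] with s hs hhs
    rw [hgt, hs]
    exact mul_nonneg (abs_nonneg _) hhs.le
  have hderiv : HasDerivAt g 0 t := hmin.deriv_eq_zero ▸ hd.hasDerivAt
  have hslope_zero : Tendsto (fun s ↦ |slope g t s|) (𝓝[≠] t) (𝓝 0) := by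
    simpa using (hasDerivAt_iff_tendsto_slope.1 hderiv).abs
  have hslope_h : Tendsto (fun s ↦ |slope g t s|) (𝓝[≠] t) (𝓝 (h t)) := by
    refine (hh.mono_left nhdsWithin_le_nhds).congr' ?_
    filter_upwards [nhdsWithin_le_nhds hg, self_mem_nhdsWithin,
      nhdsWithin_le_nhds (hh.eventually (lt_mem_nhds hpos))] with s hs hst hhs
    have hne : |s - t| ≠ 0 := abs_ne_zero.2 (sub_ne_zero.2 hst)
    rw [slope_def_field, hgt, sub_zero, hs, abs_div, abs_mul, abs_abs, abs_of_pos hhs,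
      mul_div_cancel_left₀ _ hne]
  exact hpos.ne (tendsto_nhds_unique hslope_zero hslope_h)

end RealFunctions

section InnerProduct

variable {V : Type*} [NormedAddCommGroup V] [InnerProductSpace ℝ V]

theorem norm_sq_mul_sin_angle_sq (x y : V) :
    ‖x‖ ^ 2 * ‖y‖ ^ 2 * Real.sin (InnerProductGeometry.angle x y) ^ 2
      = ‖x‖ ^ 2 * ‖y‖ ^ 2 - inner ℝ x y ^ 2 := by
  rw [Real.sin_sq, ← InnerProductGeometry.cos_angle_mul_norm_mul_norm x y]
  ring

theorem apply_eq_zero_of_isPositive {T : V →ₗ[ℝ] V} (hT : T.IsPositive) {x : V}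
    (hx : inner ℝ (T x) x = 0) : T x = 0 := by
  let B : LinearMap.BilinForm ℝ V := (innerₗ V).comp T
  have hB : LinearMap.IsSymm B := ⟨fun y z ↦ (hT.isSymmetric y z).trans (real_inner_comm (T z) y)⟩
  have hcs : inner ℝ (T x) (T x) ^ 2 ≤ inner ℝ (T x) x * inner ℝ (T (T x)) (T x) :=
    B.apply_sq_le_of_symm (fun y ↦ hT.inner_nonneg_left y) hB x (T x)
  rw [hx, zero_mul] at hcs
  exact inner_self_eq_zero.1 (pow_eq_zero_iff two_ne_zero |>.1 (hcs.antisymm (sq_nonneg _)))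

theorem inner_sq_le_norm_sq_mul_norm_sq (x y : V) : inner ℝ x y ^ 2 ≤ ‖x‖ ^ 2 * ‖y‖ ^ 2 := by
  rw [← mul_pow]
  exact sq_le_sq' (neg_le_of_abs_le (abs_real_inner_le_norm x y)) (real_inner_le_norm x y)

end InnerProduct

section VirtualLength

variable {E : Type*} [NormedAddCommGroup E] [NormedSpace ℝ E] [FiniteDimensional ℝ E]
  {M : Type*} [TopologicalSpace M] [ChartedSpace E M] [IsManifold 𝓘(ℝ, E) ∞ M]
  [RiemannianBundle (fun x : M ↦ TangentSpace 𝓘(ℝ, E) x)]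
  [IsContMDiffRiemannianBundle 𝓘(ℝ, E) ∞ E (fun x : M ↦ TangentSpace 𝓘(ℝ, E) x)]
  {c : ℝ → M} {J : Set ℝ} {t₀ t : ℝ}
  {A : ∀ t, normalSpace E c J t₀ →ₗ[ℝ] normalSpace E c J t} {v : normalSpace E c J t₀}
  {Y : ∀ s, TangentSpace 𝓘(ℝ, E) (c s)}

theorem IsDualFieldAt.inner_covDeriv_velocity (hJ : UniqueDiffOn ℝ J)
    (hc : IsUnitGeodesicOn (E := E) c J) (hY : IsDualFieldAt A v t Y) (ht : t ∈ J) :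
    inner ℝ (covDeriv c J Y t) (velocity c J t) = 0 := by
  have hderiv := eq_zero_of_eventuallyEq_const (hJ t ht) ht
    (hY.smooth.hasDerivWithinAt_inner hc.smooth ht (smoothAt_velocity hJ hc.smooth ht))
    (hY.dual.mono fun s hs ↦ hs.1)
  rwa [hc.geodesic t ht, inner_zero_right, add_zero] at hderiv

theorem IsDualFieldAt.eventually_inner_covDeriv (hJ : UniqueDiffOn ℝ J)
    (hc : IsUnitGeodesicOn (E := E) c J) (hA : IsLagrangeTensor A) (hY : IsDualFieldAt A v t Y)
    (ht : t ∈ J) (w : normalSpace E c J t₀) :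
    ∀ᶠ s in 𝓝[J] t, inner ℝ (covDeriv c J Y s) (A s w : TangentSpace 𝓘(ℝ, E) (c s))
      + inner ℝ (Y s) (tensorDeriv A s w) = 0 := by
  filter_upwards [hY.smooth.eventually_hasDerivWithinAt_inner hc.smooth ht (hA.smoothAt w ht),
    eventually_eventually_nhdsWithin.2 hY.dual, self_mem_nhdsWithin] with s hderiv hdual hs
  exact eq_zero_of_eventuallyEq_const (hJ s hs) hs hderiv (hdual.mono fun r hr ↦ hr.2 w)

-- `Z' = -S Z`, in a form that makes sense at singular points too.
theorem IsDualFieldAt.exists_apply_eq (hJ : J.OrdConnected) (hJ' : J.Nontrivial)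
    (hc : IsUnitGeodesicOn (E := E) c J) (hA : IsLagrangeTensor A) (hY : IsDualFieldAt A v t Y)
    (ht₀ : t₀ ∈ J) (ht : t ∈ J) :
    ∃ u, (A t u : TangentSpace 𝓘(ℝ, E) (c t)) = Y t ∧ tensorDeriv A t u = - covDeriv c J Y t := by
  have hu := uniqueDiffOn_of_ordConnected hJ hJ'
  obtain ⟨w, hw⟩ := hA.exists_apply_eq_of_inner_tensorDeriv hJ hJ' hc ht₀ ht
    (hY.inner_velocity ht) hY.inner_ker
  have hperp : ∀ x, inner ℝ (covDeriv c J Y t + tensorDeriv A t w)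
      (A t x : TangentSpace 𝓘(ℝ, E) (c t)) = 0 := fun x ↦ by
    rw [inner_add_left, hA.inner_tensorDeriv_comm hJ hJ' hc _ _ ht, hw]
    exact (hY.eventually_inner_covDeriv hu hc hA ht x).self_of_nhdsWithin ht
  have hnormal : inner ℝ (covDeriv c J Y t + tensorDeriv A t w) (velocity c J t) = 0 := by
    rw [inner_add_left, hY.inner_covDeriv_velocity hu hc ht,
      hA.inner_tensorDeriv_velocity hu hc w ht, add_zero]
  obtain ⟨k, hk, hkw⟩ := hA.exists_tensorDeriv_eq_of_inner_apply hJ hJ' hc ht₀ ht hnormal hperp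
  refine ⟨w - k, by rw [map_sub, LinearMap.mem_ker.1 hk, sub_zero, hw], ?_⟩
  refine ((tensorDerivLinear hc hA ht).map_sub w k).trans ?_
  change tensorDeriv A t w - tensorDeriv A t k = _
  rw [hkw]
  abel

theorem IsDualFieldAt.inner_covDeriv_covDeriv (hJ : J.OrdConnected) (hJ' : J.Nontrivial)
    (hc : IsUnitGeodesicOn (E := E) c J) (hA : IsLagrangeTensor A) (hY : IsDualFieldAt A v t Y)
    (ht₀ : t₀ ∈ J) (ht : t ∈ J) :
    inner ℝ (covDeriv c J (covDeriv c J Y) t) (Y t)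
      = 2 * ‖covDeriv c J Y t‖ ^ 2 + inner ℝ (tidal c J t (Y t)) (Y t) := by
  have hu := uniqueDiffOn_of_ordConnected hJ hJ'
  obtain ⟨u, hAu, hAu'⟩ := hY.exists_apply_eq hJ hJ' hc hA ht₀ ht
  have hderiv := eq_zero_of_eventuallyEq_const (hu t ht) ht
    (((hY.smooth.covDeriv hu hc.smooth ht).hasDerivWithinAt_inner hc.smooth ht
      (hA.smoothAt u ht)).fun_add
      (hY.smooth.hasDerivWithinAt_inner hc.smooth ht (hA.smoothAt_tensorDeriv hu hc u ht)))
    (hY.eventually_inner_covDeriv hu hc hA ht u)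
  change inner ℝ _ _ + inner ℝ _ (tensorDeriv A t u) + _ = _ at hderiv
  rw [hA.covDeriv_tensorDeriv u ht, hAu', hAu, inner_neg_right, inner_neg_right,
    real_inner_comm (tidal c J t (Y t)), real_inner_self_eq_norm_sq] at hderiv
  linarith

theorem IsDualFieldAt.virtualLength_eq (hJ : J.OrdConnected) (hJ' : J.Nontrivial)
    (hc : IsUnitGeodesicOn (E := E) c J) (hA : IsLagrangeTensor A) (hY : IsDualFieldAt A v t Y)
    (ht₀ : t₀ ∈ J) (ht : t ∈ J) (hv : v ≠ 0) : virtualLength A v t = ‖v‖ ^ 2 / ‖Y t‖ :=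
  (hY.virtualLength_eventuallyEq hJ hJ' hc hA ht₀ ht hv).self_of_nhdsWithin ht

theorem IsDualFieldAt.virtualLength_pos (hJ : J.OrdConnected) (hJ' : J.Nontrivial)
    (hc : IsUnitGeodesicOn (E := E) c J) (hA : IsLagrangeTensor A) (hY : IsDualFieldAt A v t Y)
    (ht₀ : t₀ ∈ J) (ht : t ∈ J) (hv : v ≠ 0) : 0 < virtualLength A v t := by
  rw [hY.virtualLength_eq hJ hJ' hc hA ht₀ ht hv]
  exact div_pos (pow_pos (norm_pos_iff.2 hv) 2) (norm_pos_iff.2 (hY.ne_zero ht hv))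

theorem IsDualFieldAt.virtualLength_eventuallyEq_div_sqrt (hJ : J.OrdConnected)
    (hJ' : J.Nontrivial) (hc : IsUnitGeodesicOn (E := E) c J) (hA : IsLagrangeTensor A)
    (hY : IsDualFieldAt A v t Y) (ht₀ : t₀ ∈ J) (ht : t ∈ J) (hv : v ≠ 0) :
    virtualLength A v =ᶠ[𝓝[J] t] fun s ↦ ‖v‖ ^ 2 / √(inner ℝ (Y s) (Y s)) := by
  simpa only [norm_eq_sqrt_real_inner (Y _)]
    using hY.virtualLength_eventuallyEq hJ hJ' hc hA ht₀ ht hv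

theorem IsDualFieldAt.contDiffWithinAt_virtualLength (hJ : J.OrdConnected) (hJ' : J.Nontrivial)
    (hc : IsUnitGeodesicOn (E := E) c J) (hA : IsLagrangeTensor A) (hY : IsDualFieldAt A v t Y)
    (ht₀ : t₀ ∈ J) (ht : t ∈ J) (hv : v ≠ 0) : ContDiffWithinAt ℝ ∞ (virtualLength A v) J t := by
  have hpos : 0 < inner ℝ (Y t) (Y t) := real_inner_self_pos.2 (hY.ne_zero ht hv)
  have heq := hY.virtualLength_eventuallyEq_div_sqrt hJ hJ' hc hA ht₀ ht hv
  exact (contDiffWithinAt_const.div ((hY.smooth.contDiffWithinAt_inner hY.smooth).sqrt hpos.ne')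
    (Real.sqrt_pos.2 hpos).ne').congr_of_eventuallyEq heq (heq.self_of_nhdsWithin ht)

theorem IsDualFieldAt.eventually_hasDerivWithinAt_inner_self
    (hc : IsUnitGeodesicOn (E := E) c J) (hY : IsDualFieldAt A v t Y) (ht : t ∈ J) :
    ∀ᶠ s in 𝓝[J] t, HasDerivWithinAt (fun r ↦ inner ℝ (Y r) (Y r))
      (2 * inner ℝ (covDeriv c J Y s) (Y s)) J s := by
  filter_upwards [hY.smooth.eventually_hasDerivWithinAt_inner hc.smooth ht hY.smooth] with s hs
  refine hs.congr_deriv ?_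
  rw [real_inner_comm (covDeriv c J Y s) (Y s)]
  ring

theorem IsDualFieldAt.eventually_hasDerivWithinAt_virtualLength (hJ : J.OrdConnected)
    (hJ' : J.Nontrivial) (hc : IsUnitGeodesicOn (E := E) c J) (hA : IsLagrangeTensor A)
    (hY : IsDualFieldAt A v t Y) (ht₀ : t₀ ∈ J) (ht : t ∈ J) (hv : v ≠ 0) :
    ∀ᶠ s in 𝓝[J] t, HasDerivWithinAt (virtualLength A v)
      (-(‖v‖ ^ 2 * (2 * inner ℝ (covDeriv c J Y s) (Y s))) / (2 * √(inner ℝ (Y s) (Y s)) ^ 3))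
      J s := by
  have hpos : ∀ᶠ s in 𝓝[J] t, 0 < inner ℝ (Y s) (Y s) :=
    (hY.smooth.contDiffWithinAt_inner hY.smooth).continuousWithinAt.eventually
      (lt_mem_nhds (real_inner_self_pos.2 (hY.ne_zero ht hv)))
  filter_upwards [hY.eventually_hasDerivWithinAt_inner_self hc ht, hpos,
    eventually_eventually_nhdsWithin.2
      (hY.virtualLength_eventuallyEq_div_sqrt hJ hJ' hc hA ht₀ ht hv),
    self_mem_nhdsWithin] with s hderiv hs heq hsJ
  exact (hasDerivWithinAt_div_sqrt hderiv hs).congr_of_eventuallyEq heq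
    (heq.self_of_nhdsWithin hsJ)

theorem IsDualFieldAt.hasDerivWithinAt_virtualLength (hJ : J.OrdConnected) (hJ' : J.Nontrivial)
    (hc : IsUnitGeodesicOn (E := E) c J) (hA : IsLagrangeTensor A) (hY : IsDualFieldAt A v t Y)
    (ht₀ : t₀ ∈ J) (ht : t ∈ J) (hv : v ≠ 0) :
    HasDerivWithinAt (virtualLength A v)
      (-(virtualLength A v t * (inner ℝ (covDeriv c J Y t) (Y t) / ‖Y t‖ ^ 2))) J t := by
  have hn : 0 < ‖Y t‖ := norm_pos_iff.2 (hY.ne_zero ht hv)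
  refine ((hY.eventually_hasDerivWithinAt_virtualLength hJ hJ' hc hA ht₀ ht
    hv).self_of_nhdsWithin ht).congr_deriv ?_
  rw [hY.virtualLength_eq hJ hJ' hc hA ht₀ ht hv, ← norm_eq_sqrt_real_inner]
  field_simp

theorem IsDualFieldAt.hasDerivWithinAt_derivWithin_virtualLength (hJ : J.OrdConnected)
    (hJ' : J.Nontrivial) (hc : IsUnitGeodesicOn (E := E) c J) (hA : IsLagrangeTensor A)
    (hY : IsDualFieldAt A v t Y) (ht₀ : t₀ ∈ J) (ht : t ∈ J) (hv : v ≠ 0) :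
    HasDerivWithinAt (derivWithin (virtualLength A v) J)
      (virtualLength A v t * (-(inner ℝ (tidal c J t (Y t)) (Y t) / ‖Y t‖ ^ 2)
        - 3 * ((‖covDeriv c J Y t‖ ^ 2 * ‖Y t‖ ^ 2 - inner ℝ (covDeriv c J Y t) (Y t) ^ 2)
          / ‖Y t‖ ^ 4))) J t := by
  have hu := uniqueDiffOn_of_ordConnected hJ hJ'
  have hderiv : derivWithin (virtualLength A v) J =ᶠ[𝓝[J] t] fun s ↦
      -(‖v‖ ^ 2 * (2 * inner ℝ (covDeriv c J Y s) (Y s))) / (2 * √(inner ℝ (Y s) (Y s)) ^ 3) := by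
    filter_upwards [hY.eventually_hasDerivWithinAt_virtualLength hJ hJ' hc hA ht₀ ht hv,
      self_mem_nhdsWithin] with s hs hsJ using hs.derivWithin (hu s hsJ)
  have hinner : HasDerivWithinAt (fun s ↦ 2 * inner ℝ (covDeriv c J Y s) (Y s))
      (6 * ‖covDeriv c J Y t‖ ^ 2 + 2 * inner ℝ (tidal c J t (Y t)) (Y t)) J t := by
    refine (((hY.smooth.covDeriv hu hc.smooth ht).hasDerivWithinAt_inner hc.smooth ht
      hY.smooth).const_mul 2).congr_deriv ?_
    rw [hY.inner_covDeriv_covDeriv hJ hJ' hc hA ht₀ ht, real_inner_self_eq_norm_sq]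
    ring
  have hpos : 0 < inner ℝ (Y t) (Y t) := real_inner_self_pos.2 (hY.ne_zero ht hv)
  have hself := (hY.eventually_hasDerivWithinAt_inner_self hc ht).self_of_nhdsWithin ht
  have hsecond := (hasDerivWithinAt_div_sqrt_pow_three (a := ‖v‖ ^ 2) hself hinner
    hpos).congr_of_eventuallyEq hderiv (hderiv.self_of_nhdsWithin ht)
  refine hsecond.congr_deriv ?_
  rw [hY.virtualLength_eq hJ hJ' hc hA ht₀ ht hv, ← norm_eq_sqrt_real_inner,
    real_inner_self_eq_norm_sq]
  field_simp
  ring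

theorem IsLagrangeTensor.virtualLength_eq_zero (hJ : J.OrdConnected) (hJ' : J.Nontrivial)
    (hc : IsUnitGeodesicOn (E := E) c J) (hA : IsLagrangeTensor A) (ht₀ : t₀ ∈ J) (ht : t ∈ J)
    (hv : v ∉ (LinearMap.ker (A t))ᗮ) : virtualLength A v t = 0 := by
  obtain ⟨h, -, -, heq⟩ := hA.virtualLength_of_notMem hJ hJ' hc ht₀ ht hv
  simpa using heq.self_of_nhdsWithin ht

theorem IsLagrangeTensor.virtualLength_pos_iff (hJ : J.OrdConnected) (hJ' : J.Nontrivial)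
    (hc : IsUnitGeodesicOn (E := E) c J) (hA : IsLagrangeTensor A) (ht₀ : t₀ ∈ J) (ht : t ∈ J)
    (hv : v ≠ 0) : 0 < virtualLength A v t ↔ v ∈ (LinearMap.ker (A t))ᗮ := by
  refine ⟨fun hpos ↦ ?_, fun hmem ↦ ?_⟩
  · by_contra hmem
    exact hpos.ne' (hA.virtualLength_eq_zero hJ hJ' hc ht₀ ht hmem)
  · obtain ⟨Y, hY⟩ := hA.exists_isDualFieldAt hJ hJ' hc ht₀ ht hmem
    exact hY.virtualLength_pos hJ hJ' hc hA ht₀ ht hv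

theorem IsLagrangeTensor.contDiffWithinAt_virtualLength (hJ : J.OrdConnected)
    (hJ' : J.Nontrivial) (hc : IsUnitGeodesicOn (E := E) c J) (hA : IsLagrangeTensor A)
    (ht₀ : t₀ ∈ J) (ht : t ∈ J) (hv : v ≠ 0) (hmem : v ∈ (LinearMap.ker (A t))ᗮ) :
    ContDiffWithinAt ℝ ∞ (virtualLength A v) J t := by
  obtain ⟨Y, hY⟩ := hA.exists_isDualFieldAt hJ hJ' hc ht₀ ht hmem
  exact hY.contDiffWithinAt_virtualLength hJ hJ' hc hA ht₀ ht hv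

theorem IsLagrangeTensor.contDiffWithinAt_and_virtualLength_pos_iff (hJ : J.OrdConnected)
    (hJ' : J.Nontrivial) (hc : IsUnitGeodesicOn (E := E) c J) (hA : IsLagrangeTensor A)
    (ht₀ : t₀ ∈ J) (ht : t ∈ J) (hv : v ≠ 0) :
    (ContDiffWithinAt ℝ ∞ (virtualLength A v) J t ∧ 0 < virtualLength A v t) ↔
      v ∈ (LinearMap.ker (A t))ᗮ := by
  rw [hA.virtualLength_pos_iff hJ hJ' hc ht₀ ht hv, and_iff_right_iff_imp]
  exact hA.contDiffWithinAt_virtualLength hJ hJ' hc ht₀ ht hv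

theorem IsLagrangeTensor.continuousOn_virtualLength (hJ : J.OrdConnected) (hJ' : J.Nontrivial)
    (hc : IsUnitGeodesicOn (E := E) c J) (hA : IsLagrangeTensor A) (ht₀ : t₀ ∈ J)
    (hv : v ≠ 0) : ContinuousOn (virtualLength A v) J := by
  intro t ht
  by_cases hmem : v ∈ (LinearMap.ker (A t))ᗮ
  · exact (hA.contDiffWithinAt_virtualLength hJ hJ' hc ht₀ ht hv hmem).continuousWithinAt
  · obtain ⟨h, hcont, -, heq⟩ := hA.virtualLength_of_notMem hJ hJ' hc ht₀ ht hmem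
    exact ((continuous_id.sub continuous_const).abs.continuousWithinAt.mul
      hcont).congr_of_eventuallyEq heq (heq.self_of_nhdsWithin ht)

theorem IsLagrangeTensor.virtualLength_le (hJ : J.OrdConnected) (hJ' : J.Nontrivial)
    (hc : IsUnitGeodesicOn (E := E) c J) (hA : IsLagrangeTensor A) (ht₀ : t₀ ∈ J) (ht : t ∈ J)
    (hv : v ≠ 0) : virtualLength A v t ≤ ‖A t v‖ := by
  by_cases hmem : v ∈ (LinearMap.ker (A t))ᗮ
  · obtain ⟨Y, hY⟩ := hA.exists_isDualFieldAt hJ hJ' hc ht₀ ht hmem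
    rw [hY.virtualLength_eq hJ hJ' hc hA ht₀ ht hv,
      div_le_iff₀ (norm_pos_iff.2 (hY.ne_zero ht hv)), ← real_inner_self_eq_norm_sq,
      ← hY.inner_apply ht v, mul_comm]
    exact real_inner_le_norm _ _
  · rw [hA.virtualLength_eq_zero hJ hJ' hc ht₀ ht hmem]
    exact norm_nonneg _

theorem IsLagrangeTensor.contDiffAt_virtualLength_iff (hJ : J.OrdConnected) (hJ' : J.Nontrivial)
    (hc : IsUnitGeodesicOn (E := E) c J) (hA : IsLagrangeTensor A) (ht₀ : t₀ ∈ J)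
    (ht : t ∈ interior J) (hv : v ≠ 0) :
    ContDiffAt ℝ ∞ (virtualLength A v) t ↔ v ∈ (LinearMap.ker (A t))ᗮ := by
  have hnhds : J ∈ 𝓝 t := mem_interior_iff_mem_nhds.1 ht
  have htJ := interior_subset ht
  refine ⟨fun hsmooth ↦ ?_, fun hmem ↦
    (hA.contDiffWithinAt_virtualLength hJ hJ' hc ht₀ htJ hv hmem).contDiffAt hnhds⟩
  by_contra hmem
  obtain ⟨h, hcont, hpos, heq⟩ := hA.virtualLength_of_notMem hJ hJ' hc ht₀ htJ hmem
  rw [nhdsWithin_eq_nhds.2 hnhds] at heq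
  exact not_differentiableAt_of_eventuallyEq_abs_mul (hcont.continuousAt hnhds) hpos heq
    (hsmooth.differentiableAt (by simp))

theorem IsDualFieldAt.riccati_eq (hJ : J.OrdConnected) (hJ' : J.Nontrivial)
    (hc : IsUnitGeodesicOn (E := E) c J) (hA : IsLagrangeTensor A) (hY : IsDualFieldAt A v t Y)
    (ht₀ : t₀ ∈ J) (ht : t ∈ J) (hreg : IsRegularPt A t) :
    riccati A t (virtualField A v t) = - covDeriv c J Y t := by
  obtain ⟨u, hAu, hAu'⟩ := hY.exists_apply_eq hJ hJ' hc hA ht₀ ht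
  have hfield : virtualField A v t = A t u :=
    Subtype.ext ((hY.virtualField_eq ht hreg).trans hAu.symm)
  rw [riccati, hfield, Function.leftInverse_invFun hreg.1, hAu']

theorem IsLagrangeTensor.iteratedDerivWithin_two_virtualLength (hJ : J.OrdConnected)
    (hJ' : J.Nontrivial) (hc : IsUnitGeodesicOn (E := E) c J) (hA : IsLagrangeTensor A)
    (ht₀ : t₀ ∈ J) (ht : t ∈ J) (hv : v ≠ 0) (hreg : IsRegularPt A t) :
    iteratedDerivWithin 2 (virtualLength A v) J t / virtualLength A v t
      = - sec (E := E) (c t) (velocity c J t) (virtualField A v t)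
        - 3 * (‖riccati A t (virtualField A v t)‖ ^ 2 / ‖virtualField A v t‖ ^ 2)
          * Real.sin (InnerProductGeometry.angle (riccati A t (virtualField A v t))
              (virtualField A v t : TangentSpace 𝓘(ℝ, E) (c t))) ^ 2 := by
  obtain ⟨Y, hY⟩ := hA.exists_isDualFieldAt hJ hJ' hc ht₀ ht (hreg.mem_ker_orthogonal v)
  have hn : 0 < ‖Y t‖ := norm_pos_iff.2 (hY.ne_zero ht hv)
  have hpos := hY.virtualLength_pos hJ hJ' hc hA ht₀ ht hv
  have hiter : iteratedDerivWithin 2 (virtualLength A v) J t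
      = derivWithin (derivWithin (virtualLength A v) J) J t := iteratedDerivWithin_eq_iterate
  have hsin := norm_sq_mul_sin_angle_sq (-covDeriv c J Y t) (Y t)
  have hfield : ‖virtualField A v t‖ = ‖Y t‖ := congrArg norm (hY.virtualField_eq ht hreg)
  rw [hiter, (hY.hasDerivWithinAt_derivWithin_virtualLength hJ hJ' hc hA ht₀ ht hv).derivWithin
      (uniqueDiffOn_of_ordConnected hJ hJ' t ht), hfield, hY.riccati_eq hJ hJ' hc hA ht₀ ht hreg,
    hY.virtualField_eq ht hreg, hc.sec_velocity ht (hY.inner_velocity ht)]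
  rw [norm_neg, inner_neg_left, neg_sq] at hsin
  rw [norm_neg, ← hsin]
  field_simp

end VirtualLength

section Concavity

variable {E : Type*} [NormedAddCommGroup E] [NormedSpace ℝ E] [FiniteDimensional ℝ E]
  {M : Type*} [TopologicalSpace M] [ChartedSpace E M] [IsManifold 𝓘(ℝ, E) ∞ M]
  [RiemannianBundle (fun x : M ↦ TangentSpace 𝓘(ℝ, E) x)]
  [IsContMDiffRiemannianBundle 𝓘(ℝ, E) ∞ E (fun x : M ↦ TangentSpace 𝓘(ℝ, E) x)]
  {c : ℝ → M} {J K : Set ℝ} {t₀ t : ℝ}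
  {A : ∀ t, normalSpace E c J t₀ →ₗ[ℝ] normalSpace E c J t} {v : normalSpace E c J t₀}
  {Y : ∀ s, TangentSpace 𝓘(ℝ, E) (c s)}

variable (E) in
/-- The curvature operator `R = R(·, ċ) ċ` as an endomorphism of the normal space `E_t`. -/
def normalTidal (c : ℝ → M) (J : Set ℝ) (t : ℝ) :
    normalSpace E c J t →ₗ[ℝ] normalSpace E c J t where
  toFun x := ⟨tidal c J t x, mem_normalSpace_iff.2 (inner_tidal_velocity _)⟩
  map_add' _ _ := Subtype.ext (tidal_add _ _)
  map_smul' r _ := Subtype.ext (tidal_smul r _)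

theorem inner_normalTidal (hc : IsUnitGeodesicOn (E := E) c J) (ht : t ∈ J)
    {x : normalSpace E c J t} (hx : x ≠ 0) :
    inner ℝ (normalTidal E c J t x) x
      = sec (E := E) (c t) (velocity c J t) x * ‖x‖ ^ 2 := by
  rw [hc.sec_velocity ht (inner_velocity_of_mem x)]
  exact (div_mul_cancel₀ _ (pow_pos (norm_pos_iff.2 hx) 2).ne').symm

theorem isPositive_normalTidal (hc : IsUnitGeodesicOn (E := E) c J) (ht : t ∈ J)
    (hsec : ∀ x : normalSpace E c J t, x ≠ 0 → 0 ≤ sec (E := E) (c t) (velocity c J t) x) :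
    (normalTidal E c J t).IsPositive := by
  refine ⟨fun x y ↦ (inner_tidal_comm _ _).trans (real_inner_comm _ _), fun x ↦ ?_⟩
  rcases eq_or_ne x 0 with rfl | hx
  · rw [inner_zero_right, map_zero]
  · change 0 ≤ inner ℝ (normalTidal E c J t x) x
    rw [inner_normalTidal hc ht hx]
    exact mul_nonneg (hsec x hx) (sq_nonneg _)

theorem IsLagrangeTensor.hasDerivAt_deriv_virtualLength (hJ : J.OrdConnected) (hJ' : J.Nontrivial)
    (hc : IsUnitGeodesicOn (E := E) c J) (hA : IsLagrangeTensor A) (ht₀ : t₀ ∈ J) (hv : v ≠ 0)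
    (ht : t ∈ interior J) (hpos : 0 < virtualLength A v t) :
    DifferentiableAt ℝ (virtualLength A v) t ∧
    ∃ (x : normalSpace E c J t) (d : ℝ), x ≠ 0 ∧ HasDerivAt (deriv (virtualLength A v)) d t ∧
      d ≤ -(virtualLength A v t * sec (E := E) (c t) (velocity c J t) x) := by
  have hnhds : J ∈ 𝓝 t := mem_interior_iff_mem_nhds.1 ht
  have htJ := interior_subset ht
  obtain ⟨Y, hY⟩ := hA.exists_isDualFieldAt hJ hJ' hc ht₀ htJ
    ((hA.virtualLength_pos_iff hJ hJ' hc ht₀ htJ hv).1 hpos)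
  have hderiv : deriv (virtualLength A v) =ᶠ[𝓝 t] derivWithin (virtualLength A v) J := by
    filter_upwards [isOpen_interior.mem_nhds ht] with s hs
    exact (derivWithin_of_mem_nhds (mem_interior_iff_mem_nhds.1 hs)).symm
  refine ⟨((hY.hasDerivWithinAt_virtualLength hJ hJ' hc hA ht₀ htJ hv).hasDerivAt
      hnhds).differentiableAt,
    ⟨Y t, mem_normalSpace_iff.2 (hY.inner_velocity htJ)⟩, _,
    fun h ↦ hY.ne_zero htJ hv (congrArg Subtype.val h),
    ((hY.hasDerivWithinAt_derivWithin_virtualLength hJ hJ' hc hA ht₀ htJ hv).hasDerivAt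
      hnhds).congr_of_eventuallyEq hderiv, ?_⟩
  rw [hc.sec_velocity htJ (hY.inner_velocity htJ), ← mul_neg]
  have hcs := div_nonneg (sub_nonneg.2 (inner_sq_le_norm_sq_mul_norm_sq (covDeriv c J Y t) (Y t)))
    (pow_nonneg (norm_nonneg (Y t)) 4)
  exact mul_le_mul_of_nonneg_left (by linarith) hpos.le

theorem IsLagrangeTensor.concaveOn_virtualLength (hJ : J.OrdConnected) (hJ' : J.Nontrivial)
    (hc : IsUnitGeodesicOn (E := E) c J) (hA : IsLagrangeTensor A) (ht₀ : t₀ ∈ J) (hv : v ≠ 0)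
    (hsec : ∀ t ∈ J, ∀ x : normalSpace E c J t, x ≠ 0 →
      0 ≤ sec (E := E) (c t) (velocity c J t) x)
    (hKJ : K ⊆ J) (hK : K.OrdConnected) (hpos : ∀ t ∈ K, 0 < virtualLength A v t) :
    ConcaveOn ℝ K (virtualLength A v) := by
  have hderiv := fun t (ht : t ∈ interior K) ↦ hA.hasDerivAt_deriv_virtualLength hJ hJ' hc ht₀ hv
    (interior_mono hKJ ht) (hpos t (interior_subset ht))
  refine concaveOn_of_deriv2_nonpos hK.convex
    ((hA.continuousOn_virtualLength hJ hJ' hc ht₀ hv).mono hKJ)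
    (fun t ht ↦ (hderiv t ht).1.differentiableWithinAt) (fun t ht ↦ ?_) fun t ht ↦ ?_
  · obtain ⟨-, x, d, -, hd, -⟩ := hderiv t ht
    exact hd.differentiableAt.differentiableWithinAt
  · obtain ⟨-, x, d, hx, hd, hle⟩ := hderiv t ht
    change deriv (deriv (virtualLength A v)) t ≤ 0
    rw [hd.deriv]
    exact hle.trans (neg_nonpos.2 (mul_nonneg (hpos t (interior_subset ht)).le
      (hsec t (hKJ (interior_subset ht)) x hx)))

theorem IsLagrangeTensor.strictConcaveOn_virtualLength (hJ : J.OrdConnected)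
    (hJ' : J.Nontrivial) (hc : IsUnitGeodesicOn (E := E) c J) (hA : IsLagrangeTensor A)
    (ht₀ : t₀ ∈ J) (hv : v ≠ 0)
    (hsec : ∀ t ∈ J, ∀ x : normalSpace E c J t, x ≠ 0 →
      0 < sec (E := E) (c t) (velocity c J t) x)
    (hKJ : K ⊆ J) (hK : K.OrdConnected) (hpos : ∀ t ∈ K, 0 < virtualLength A v t) :
    StrictConcaveOn ℝ K (virtualLength A v) := by
  refine strictConcaveOn_of_deriv2_neg hK.convex
    ((hA.continuousOn_virtualLength hJ hJ' hc ht₀ hv).mono hKJ) fun t ht ↦ ?_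
  obtain ⟨-, x, d, hx, hd, hle⟩ := hA.hasDerivAt_deriv_virtualLength hJ hJ' hc ht₀ hv
    (interior_mono hKJ ht) (hpos t (interior_subset ht))
  change deriv (deriv (virtualLength A v)) t < 0
  rw [hd.deriv]
  exact hle.trans_lt (neg_neg_of_pos (mul_pos (hpos t (interior_subset ht))
    (hsec t (hKJ (interior_subset ht)) x hx)))

theorem IsDualFieldAt.inner_covDeriv_eq_zero_of_const (hJ : J.OrdConnected) (hJ' : J.Nontrivial)
    (hc : IsUnitGeodesicOn (E := E) c J) (hA : IsLagrangeTensor A) (hY : IsDualFieldAt A v t Y)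
    (ht₀ : t₀ ∈ J) (ht : t ∈ J) (hv : v ≠ 0) {k : ℝ} (hk : ∀ s ∈ J, virtualLength A v s = k) :
    inner ℝ (covDeriv c J Y t) (Y t) = 0 := by
  have hderiv := eq_zero_of_eventuallyEq_const (uniqueDiffOn_of_ordConnected hJ hJ' t ht) ht
    (hY.hasDerivWithinAt_virtualLength hJ hJ' hc hA ht₀ ht hv)
    (by filter_upwards [self_mem_nhdsWithin] with s hs using hk s hs)
  have hquot := (mul_eq_zero.1 (neg_eq_zero.1 hderiv)).resolve_left
    (hY.virtualLength_pos hJ hJ' hc hA ht₀ ht hv).ne'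
  exact (div_eq_zero_iff.1 hquot).resolve_right
    (pow_ne_zero 2 (norm_ne_zero_iff.2 (hY.ne_zero ht hv)))

theorem IsDualFieldAt.inner_tidal_eq_of_const (hJ : J.OrdConnected) (hJ' : J.Nontrivial)
    (hc : IsUnitGeodesicOn (E := E) c J) (hA : IsLagrangeTensor A) (hY : IsDualFieldAt A v t Y)
    (ht₀ : t₀ ∈ J) (ht : t ∈ J) (hv : v ≠ 0) {k : ℝ} (hk : ∀ s ∈ J, virtualLength A v s = k) :
    inner ℝ (tidal c J t (Y t)) (Y t) = -(3 * ‖covDeriv c J Y t‖ ^ 2) := by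
  have hn : ‖Y t‖ ≠ 0 := norm_ne_zero_iff.2 (hY.ne_zero ht hv)
  have hconst : derivWithin (virtualLength A v) J =ᶠ[𝓝[J] t] fun _ ↦ 0 := by
    filter_upwards [self_mem_nhdsWithin] with s hs
    rw [derivWithin_congr hk (hk s hs), derivWithin_fun_const, Pi.zero_apply]
  have hderiv := (mul_eq_zero.1 (eq_zero_of_eventuallyEq_const
    (uniqueDiffOn_of_ordConnected hJ hJ' t ht) ht
    (hY.hasDerivWithinAt_derivWithin_virtualLength hJ hJ' hc hA ht₀ ht hv) hconst)).resolve_left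
    (hY.virtualLength_pos hJ hJ' hc hA ht₀ ht hv).ne'
  rw [hY.inner_covDeriv_eq_zero_of_const hJ hJ' hc hA ht₀ ht hv hk] at hderiv
  field_simp at hderiv
  exact mul_right_cancel₀ (pow_ne_zero 2 hn) (by linear_combination -hderiv)

theorem IsDualFieldAt.covDeriv_eq_zero_and_tidal_eq_zero (hJ : J.OrdConnected)
    (hJ' : J.Nontrivial) (hc : IsUnitGeodesicOn (E := E) c J) (hA : IsLagrangeTensor A)
    (hY : IsDualFieldAt A v t Y) (ht₀ : t₀ ∈ J) (ht : t ∈ J) (hv : v ≠ 0)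
    (hsec : ∀ x : normalSpace E c J t, x ≠ 0 → 0 ≤ sec (E := E) (c t) (velocity c J t) x)
    {k : ℝ} (hk : ∀ s ∈ J, virtualLength A v s = k) :
    covDeriv c J Y t = 0 ∧ tidal c J t (Y t) = 0 := by
  have heq := hY.inner_tidal_eq_of_const hJ hJ' hc hA ht₀ ht hv hk
  let y : normalSpace E c J t := ⟨Y t, mem_normalSpace_iff.2 (hY.inner_velocity ht)⟩
  have hR := isPositive_normalTidal hc ht hsec
  have hnonneg : 0 ≤ inner ℝ (tidal c J t (Y t)) (Y t) := hR.inner_nonneg_left y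
  have hsq : ‖covDeriv c J Y t‖ ^ 2 = 0 := by linarith [sq_nonneg ‖covDeriv c J Y t‖]
  rw [hsq, mul_zero, neg_zero] at heq
  exact ⟨norm_eq_zero.1 (pow_eq_zero_iff two_ne_zero |>.1 hsq),
    congrArg Subtype.val (apply_eq_zero_of_isPositive hR (x := y) heq)⟩

theorem IsDualFieldAt.eq_and_tensorDeriv_eq_of_eq_id (hJ : J.OrdConnected) (hJ' : J.Nontrivial)
    (hc : IsUnitGeodesicOn (E := E) c J) (hA : IsLagrangeTensor A) (hY : IsDualFieldAt A v t₀ Y)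
    (ht₀ : t₀ ∈ J) (hid : A t₀ = LinearMap.id) :
    Y t₀ = v ∧ tensorDeriv A t₀ v = - covDeriv c J Y t₀ := by
  obtain ⟨u, hAu, hAu'⟩ := hY.exists_apply_eq hJ hJ' hc hA ht₀ ht₀
  have huv : u = v := ext_inner_right ℝ fun w ↦ by
    have hdual := hY.inner_apply ht₀ w
    rwa [← hAu, hid] at hdual
  subst huv
  rw [hid] at hAu
  exact ⟨hAu.symm, hAu'⟩

theorem IsLagrangeTensor.mem_ker_orthogonal_of_const (hJ : J.OrdConnected) (hJ' : J.Nontrivial)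
    (hc : IsUnitGeodesicOn (E := E) c J) (hA : IsLagrangeTensor A) (ht₀ : t₀ ∈ J) (ht : t ∈ J)
    (hv : v ≠ 0) {k : ℝ} (hk : ∀ s ∈ J, virtualLength A v s = k) :
    v ∈ (LinearMap.ker (A t))ᗮ := by
  obtain ⟨s, hs, hreg⟩ := hA.exists_regular
  rw [← hA.virtualLength_pos_iff hJ hJ' hc ht₀ ht hv, hk t ht, ← hk s hs,
    hA.virtualLength_pos_iff hJ hJ' hc ht₀ hs hv]
  exact hreg.mem_ker_orthogonal v

theorem IsLagrangeTensor.exists_parallel_of_const (hJ : J.OrdConnected) (hJ' : J.Nontrivial)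
    (hc : IsUnitGeodesicOn (E := E) c J) (hA : IsLagrangeTensor A) (ht₀ : t₀ ∈ J) (hv : v ≠ 0)
    (hsec : ∀ t ∈ J, ∀ x : normalSpace E c J t, x ≠ 0 →
      0 ≤ sec (E := E) (c t) (velocity c J t) x)
    {k : ℝ} (hk : ∀ s ∈ J, virtualLength A v s = k) :
    ∃ Y : ∀ t, TangentSpace 𝓘(ℝ, E) (c t),
      (∀ t ∈ J, IsRegularPt A t → Y t = virtualField A v t) ∧ IsJacobiField c J Y ∧
      (∀ t ∈ J, covDeriv c J Y t = 0) ∧ (A t₀ = LinearMap.id → ∀ t ∈ J, Y t = A t v) := by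
  obtain ⟨Y, hY⟩ := hA.exists_forall_isDualFieldAt hJ hJ' hc ht₀ fun t ht ↦
    hA.mem_ker_orthogonal_of_const hJ hJ' hc ht₀ ht hv hk
  have hpar := fun t (ht : t ∈ J) ↦ (hY t ht).covDeriv_eq_zero_and_tidal_eq_zero hJ hJ' hc hA ht₀
    ht hv (hsec t ht) hk
  have hjac := isJacobiField_of_covDeriv_eq_zero (fun t ht ↦ (hY t ht).smooth)
    (fun t ht ↦ (hpar t ht).1) fun t ht ↦ (hpar t ht).2
  refine ⟨Y, fun t ht hreg ↦ ((hY t ht).virtualField_eq ht hreg).symm, hjac,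
    fun t ht ↦ (hpar t ht).1, fun hid t ht ↦ ?_⟩
  obtain ⟨hYv, hderiv⟩ := (hY t₀ ht₀).eq_and_tensorDeriv_eq_of_eq_id hJ hJ' hc hA ht₀ hid
  refine hjac.eq_of_eq hJ hJ' hc.smooth (hA.jacobi v) ht₀ ?_ ?_ ht
  · rw [hYv, hid, LinearMap.id_apply]
  · rw [(hpar t₀ ht₀).1, neg_zero] at hderiv
    rw [(hpar t₀ ht₀).1]
    exact hderiv.symm

end Concavity

end VirtualJacobi

end

end

theorem theoremA
    {E : Type*} [NormedAddCommGroup E] [NormedSpace ℝ E] [FiniteDimensional ℝ E]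
    {M : Type*} [TopologicalSpace M] [ChartedSpace E M] [IsManifold 𝓘(ℝ, E) ∞ M]
    [RiemannianBundle (fun x : M ↦ TangentSpace 𝓘(ℝ, E) x)]
    [IsContMDiffRiemannianBundle 𝓘(ℝ, E) ∞ E (fun x : M ↦ TangentSpace 𝓘(ℝ, E) x)]
    (c : ℝ → M) (J : Set ℝ) (hJ : J.OrdConnected) (hJ' : J.Nontrivial)
    (hc : IsUnitGeodesicOn (E := E) c J)
    (t₀ : ℝ) (ht₀ : t₀ ∈ J)
    (A : ∀ t, normalSpace E c J t₀ →ₗ[ℝ] normalSpace E c J t) (hA : IsLagrangeTensor A)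
    (v : normalSpace E c J t₀) (hv : v ≠ 0) :
    -- the singular points are isolated, so that `g_v` is determined by its values at regular points
    (∀ t ∈ J, ∀ᶠ s in 𝓝[J \ {t}] t, IsRegularPt A s) ∧
    -- (a)
    (∀ t ∈ J, virtualLength A v t ≤ ‖A t v‖) ∧
    (∀ t ∈ J, IsRegularPt A t →
      iteratedDerivWithin 2 (virtualLength A v) J t / virtualLength A v t
        = - sec (E := E) (c t) (velocity c J t) (virtualField A v t)
          - 3 * (‖riccati A t (virtualField A v t)‖ ^ 2 / ‖virtualField A v t‖ ^ 2)
            * Real.sin (InnerProductGeometry.angle (riccati A t (virtualField A v t))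
                (virtualField A v t : TangentSpace 𝓘(ℝ, E) (c t))) ^ 2) ∧
    -- (b)
    ContinuousOn (virtualLength A v) J ∧
    (∀ t ∈ J, 0 < virtualLength A v t ↔ v ∈ (LinearMap.ker (A t))ᗮ) ∧
    (∀ t ∈ J, (ContDiffWithinAt ℝ ∞ (virtualLength A v) J t ∧ 0 < virtualLength A v t) ↔
      v ∈ (LinearMap.ker (A t))ᗮ) ∧
    (∀ t ∈ interior J, ContDiffAt ℝ ∞ (virtualLength A v) t ↔ v ∈ (LinearMap.ker (A t))ᗮ) ∧
    -- (c)
    ((∀ t ∈ J, ∀ x : normalSpace E c J t, x ≠ 0 → 0 ≤ sec (E := E) (c t) (velocity c J t) x) →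
      ∀ K ⊆ J, K.OrdConnected → (∀ t ∈ K, 0 < virtualLength A v t) →
        ConcaveOn ℝ K (virtualLength A v)) ∧
    ((∀ t ∈ J, ∀ x : normalSpace E c J t, x ≠ 0 → 0 < sec (E := E) (c t) (velocity c J t) x) →
      ∀ K ⊆ J, K.OrdConnected → (∀ t ∈ K, 0 < virtualLength A v t) →
        StrictConcaveOn ℝ K (virtualLength A v)) ∧
    ((∀ t ∈ J, ∀ x : normalSpace E c J t, x ≠ 0 → 0 ≤ sec (E := E) (c t) (velocity c J t) x) →
      (∃ k : ℝ, ∀ t ∈ J, virtualLength A v t = k) →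
        ∃ Y : ∀ t, TangentSpace 𝓘(ℝ, E) (c t),
          (∀ t ∈ J, IsRegularPt A t → Y t = virtualField A v t) ∧
          IsJacobiField c J Y ∧
          (∀ t ∈ J, covDeriv c J Y t = 0) ∧
          (A t₀ = LinearMap.id → ∀ t ∈ J, Y t = A t v)) := by
  exact ⟨fun _ ht ↦ hA.eventually_isRegularPt hJ hJ' hc ht₀ ht,
    fun _ ht ↦ hA.virtualLength_le hJ hJ' hc ht₀ ht hv,
    fun _ ht hreg ↦ hA.iteratedDerivWithin_two_virtualLength hJ hJ' hc ht₀ ht hv hreg,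
    hA.continuousOn_virtualLength hJ hJ' hc ht₀ hv,
    fun _ ht ↦ hA.virtualLength_pos_iff hJ hJ' hc ht₀ ht hv,
    fun _ ht ↦ hA.contDiffWithinAt_and_virtualLength_pos_iff hJ hJ' hc ht₀ ht hv,
    fun _ ht ↦ hA.contDiffAt_virtualLength_iff hJ hJ' hc ht₀ ht hv,
    fun hsec _ hKJ hK hpos ↦ hA.concaveOn_virtualLength hJ hJ' hc ht₀ hv hsec hKJ hK hpos,
    fun hsec _ hKJ hK hpos ↦ hA.strictConcaveOn_virtualLength hJ hJ' hc ht₀ hv hsec hKJ hK hpos,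
    fun hsec ⟨_, hk⟩ ↦ hA.exists_parallel_of_const hJ hJ' hc ht₀ hv hsec hk⟩
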